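/- Let $n\ge 1$ and let $A_0$ be the $2n\times 2n$ block-diagonal matrix with the diagonal blocks $\begin{pmatrix}0&-(2k-1)\\2k-1&0\end{pmatrix}$, $k=1,\dots,n$. For a real $2n\times 2n$ matrix $A=(a_{ik})$, a vector $b\in\mathbb R^{2n}\setminus\{0\}$ and a small real $\varepsilon\neq0$ consider $$\dot x=A_0x+\varepsilon\,g(x),\qquad g(x)=Ax+\varphi(x_1)b,\qquad(1)$$ where $\varphi(s)=-1$ for $s<-1$, $\varphi(s)=s$ for $|s|\le1$, $\varphi(s)=1$ for $s>1$. All orbits of $\dot x=A_0x$ other than the origin are periodic, with period $2\pi$. A limit cycle of (1) is the orbit of a nonconstant periodic solution that has a neighbourhood containing no other such orbit. A family of limit cycles $\gamma_\varepsilon$ of (1), given for small $\varepsilon\ne0$ (or only for a set of such $\varepsilon$ that accumulates at $0$), *bifurcates from* the periodic orbit of $\dot x=A_0x$ through $x_0\neq0$ if $\gamma_\varepsilon$ is the orbit of a $T_\varepsilon$-periodic solution $x(t,\varepsilon)$ with $x(0,\varepsilon)\to x_0$ and $T_\varepsilon\to T_0$ as $\varepsilon\to0$, for some $T_0>0$.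 Put $x_{2j-1}=r_j\cos\psi_j$, $x_{2j}=r_j\sin\psi_j$ with $\psi_j=(2j-1)\theta+\theta_j$, $\theta_1=0$, for $j=1,\dots,n$. Taking $\theta$ as the independent variable, (1) becomes, for $p=(r_1,\dots,r_n,\theta_2,\dots,\theta_n)$ in the domain $D=\{r_1,\dots,r_n>0\}$, a system $dp/d\theta=\varepsilon H(\theta,p)+O(\varepsilon^2)$ that is $2\pi$-periodic in $\theta$; here the $r_j$-component of $H$ is $g_{2j-1}\cos\psi_j+g_{2j}\sin\psi_j$, and the $\theta_j$-component is $s_j-(2j-1)s_1$ with $s_j=(g_{2j}\cos\psi_j-g_{2j-1}\sin\psi_j)/r_j$. Let $h(p)=\int_0^{2\pi}H(\theta,p)\,d\theta$ be the averaged function. **Theorem.** For all $A$ and all $b\ne0$: (a) If the averaging theory of first order applies at some point of $D$, in the sense that $h$ has an isolated zero in $D$, then at most one limit cycle of (1) bifurcates from the periodic orbits of $\dot x=A_0x$: any two families of limit cycles (given for the same $\varepsilon$) that bifurcate from such orbits coincide for all sufficiently small $|\varepsilon|>0$. (b) If every zero of $h$ in $D$ is isolated (in particular if there is none), then the same conclusion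 holds for the families of limit cycles that bifurcate from periodic orbits of $\dot x=A_0x$ through points with polar coordinates in $D$. (The averaging theorem also requires that $h$ has nonzero Brouwer degree at the isolated zero; this is not needed as a hypothesis here.) Moreover, for every $n\ge1$ there are $A$ and $b\neq0$ such that $h$ has a zero $p\in D$ near which $h$ is $C^1$ and at which its Jacobian determinant is not zero, and such that, for $|\varepsilon|>0$ sufficiently small, (1) has a limit cycle which bifurcates, with period tending to $2\pi$, from the periodic orbit of $\dot x=A_0x$ through the point with polar coordinates $\theta=0$ and $p$; by (a) it is the only one that bifurcates. -/

import Mathlib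

open Filter Topology

noncomputable section

namespace SatControl

/-- The phase space `ℝ²ⁿ`. The coordinates are grouped in `n` consecutive pairs: with `j : Fin n`
counted from `0`, the entries `(j, 0)` and `(j, 1)` are the coordinates number `2j+1` and `2j+2`;
in particular `(0, 0)` is the first coordinate. -/
abbrev Phase (n : ℕ) : Type := Fin n × Fin 2 → ℝ

/-- Real `2n × 2n` matrices, rows and columns grouped in pairs in the same way. -/
abbrev Mat (n : ℕ) : Type := Matrix (Fin n × Fin 2) (Fin n × Fin 2) ℝ

/-- The continuous piecewise linear saturation function. -/
def sat (s : ℝ) : ℝ := if s < -1 then -1 else if s ≤ 1 then s else 1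

/-- The frequency `1, 3, …, 2n-1` of the `j`-th block. -/
def freq {n : ℕ} (j : Fin n) : ℝ := 2 * (j : ℕ) + 1

/-- The block diagonal matrix with the `2 × 2` diagonal blocks `(0, -ω; ω, 0)`,
`ω = 1, 3, …, 2n-1`. -/
def centerMatrix (n : ℕ) : Mat n :=
  fun p q => if p.1 = q.1 then (!![0, -freq p.1; freq p.1, 0] : Matrix (Fin 2) (Fin 2) ℝ) p.2 q.2
    else 0

/-- The perturbing vector field `A x + φ(x₁) b`. -/
def perturbation {n : ℕ} [NeZero n] (A : Mat n) (b : Phase n) (x : Phase n) : Phase n :=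
  A.mulVec x + sat (x (0, 0)) • b

/-- The vector field `A₀ x + ε (A x + φ(x₁) b)`. -/
def field {n : ℕ} [NeZero n] (A : Mat n) (b : Phase n) (ε : ℝ) (x : Phase n) : Phase n :=
  (centerMatrix n).mulVec x + ε • perturbation A b x

/-! ### Periodic orbits and limit cycles -/

/-- `x` is a nonconstant solution of `ẋ = f x`, defined for all times, with period `T > 0`
(not necessarily the least one). -/
def IsPeriodicSolution {n : ℕ} (f : Phase n → Phase n) (x : ℝ → Phase n) (T : ℝ) : Prop :=
  0 < T ∧ (∀ t, HasDerivAt x (f (x t)) t) ∧ Function.Periodic x T ∧ ∃ t, x t ≠ x 0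

/-- `Γ` is a (nonconstant) periodic orbit of `ẋ = f x`. -/
def IsPeriodicOrbit {n : ℕ} (f : Phase n → Phase n) (Γ : Set (Phase n)) : Prop :=
  ∃ x T, IsPeriodicSolution f x T ∧ Set.range x = Γ

/-- `Γ` is a limit cycle of `ẋ = f x`: a periodic orbit which has a neighbourhood that contains no
other periodic orbit. -/
def IsLimitCycle {n : ℕ} (f : Phase n → Phase n) (Γ : Set (Phase n)) : Prop :=
  IsPeriodicOrbit f Γ ∧
    ∃ U, IsOpen U ∧ Γ ⊆ U ∧ ∀ Γ', IsPeriodicOrbit f Γ' → Γ' ⊆ U → Γ' = Γ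

/-- As `ε` tends to `0` along the filter `l`, the limit cycles `Γ ε` of the perturbed system tend
to the periodic orbit of `ẋ = A₀ x` through `x₀ ≠ 0`: they have parametrizations by periodic
solutions whose initial values tend to `x₀` and whose periods tend to `T₀ > 0`.
(The limit `T₀` is then a period of the solution of `ẋ = A₀ x` through `x₀`.) -/
def BifurcatesFrom {n : ℕ} [NeZero n] (A : Mat n) (b : Phase n) (l : Filter ℝ)
    (Γ : ℝ → Set (Phase n)) (x₀ : Phase n) (T₀ : ℝ) : Prop :=
  x₀ ≠ 0 ∧ 0 < T₀ ∧ ∃ (x : ℝ → ℝ → Phase n) (T : ℝ → ℝ),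
    (∀ᶠ ε in l, IsLimitCycle (field A b ε) (Γ ε) ∧
      IsPeriodicSolution (field A b ε) (x ε) (T ε) ∧ Set.range (x ε) = Γ ε) ∧
    Tendsto (fun ε => x ε 0) l (𝓝 x₀) ∧ Tendsto T l (𝓝 T₀)

/-- At most one limit cycle bifurcates from the periodic orbits of `ẋ = A₀ x` through points
of `S`: any two families of limit cycles that tend to such orbits coincide for all small `ε ≠ 0`
for which they are given. The filter `l` allows families that are given for all small `ε ≠ 0`,
only for small `ε > 0`, only for a sequence of values of `ε`, and so on. -/
def AtMostOneBifurcates {n : ℕ} [NeZero n] (A : Mat n) (b : Phase n) (S : Set (Phase n)) : Prop :=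
  ∀ l : Filter ℝ, l ≤ 𝓝[≠] (0 : ℝ) →
    ∀ (Γ Γ' : ℝ → Set (Phase n)) (x₀ x₀' : Phase n) (T₀ T₀' : ℝ), x₀ ∈ S → x₀' ∈ S →
      BifurcatesFrom A b l Γ x₀ T₀ → BifurcatesFrom A b l Γ' x₀' T₀' →
        ∀ᶠ ε in l, Γ ε = Γ' ε

/-! ### The averaged function of first order -/

/-- The slow polar variables `(r_j)_{0 ≤ j < n}` and `(θ_j)_{1 ≤ j < n}`; a real vector space of
dimension `2n-1`. The angles are real numbers, i.e. lifts of points of the circle. -/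
abbrev Slow (n : ℕ) [NeZero n] : Type := (Fin n → ℝ) × ({j : Fin n // j ≠ 0} → ℝ)

/-- The domain of the slow variables: all radii are positive. -/
def slowDomain (n : ℕ) [NeZero n] : Set (Slow n) := {p | ∀ j, 0 < p.1 j}

/-- The phase `(2j+1) θ + θ_j` of the `j`-th pair of coordinates, where `θ_0 = 0`. -/
def phase {n : ℕ} [NeZero n] (θ : ℝ) (p : Slow n) (j : Fin n) : ℝ :=
  freq j * θ + if h : j ≠ 0 then p.2 ⟨j, h⟩ else 0

/-- The polar change of variables: the `j`-th pair of coordinates is `r_j (cos, sin)` of its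
phase. -/
def polar {n : ℕ} [NeZero n] (θ : ℝ) (p : Slow n) : Phase n :=
  fun q => p.1 q.1 * ![Real.cos (phase θ p q.1), Real.sin (phase θ p q.1)] q.2

/-- Coefficient of `ε` in `dr_j/dθ`. -/
def radialH {n : ℕ} [NeZero n] (A : Mat n) (b : Phase n) (θ : ℝ) (p : Slow n) (j : Fin n) : ℝ :=
  let g := perturbation A b (polar θ p)
  g (j, 0) * Real.cos (phase θ p j) + g (j, 1) * Real.sin (phase θ p j)

/-- `r_j⁻¹` times the component of the perturbation in the positive angular direction of the
`j`-th plane; for `j = 0` this is the coefficient of `ε` in `dθ/dt`. -/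
def swirl {n : ℕ} [NeZero n] (A : Mat n) (b : Phase n) (θ : ℝ) (p : Slow n) (j : Fin n) : ℝ :=
  let g := perturbation A b (polar θ p)
  (g (j, 1) * Real.cos (phase θ p j) - g (j, 0) * Real.sin (phase θ p j)) / p.1 j

/-- Coefficient of `ε` in `dθ_j/dθ`. -/
def angularH {n : ℕ} [NeZero n] (A : Mat n) (b : Phase n) (θ : ℝ) (p : Slow n) (j : Fin n) : ℝ :=
  swirl A b θ p j - freq j * swirl A b θ p 0

/-- The averaged function of first order: the integral over one period of the coefficient of `ε`
in the system for the slow variables with independent variable `θ`. -/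
def averaged {n : ℕ} [NeZero n] (A : Mat n) (b : Phase n) (p : Slow n) : Slow n :=
  (fun j => ∫ θ in (0 : ℝ)..(2 * Real.pi), radialH A b θ p j,
   fun j => ∫ θ in (0 : ℝ)..(2 * Real.pi), angularH A b θ p j.1)

/-- `p` is an isolated zero of the averaged function. -/
def IsIsolatedZero {n : ℕ} [NeZero n] (A : Mat n) (b : Phase n) (p : Slow n) : Prop :=
  averaged A b p = 0 ∧ ∀ᶠ q in 𝓝[≠] p, averaged A b q ≠ 0

/-- `p` is a simple zero of the averaged function: the function is `C¹` near `p` and its Jacobian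
determinant at `p` is not zero. -/
def IsSimpleZero {n : ℕ} [NeZero n] (A : Mat n) (b : Phase n) (p : Slow n) : Prop :=
  averaged A b p = 0 ∧ ContDiffAt ℝ 1 (averaged A b) p ∧ (fderiv ℝ (averaged A b) p).det ≠ 0

end SatControl

end

noncomputable section

namespace SatControl

section

variable {n : ℕ}

/-! ### The saturation function -/

/-! Rotate the coordinates with the unperturbed flow and rescale time by `κ = 1 + ε σ`, so that the
period becomes a multiple of `2π`. A periodic solution then moves by `O(ε)` only; dividing its
periodicity defect by `ε` and letting `ε → 0` yields `AveragedEquation` for the limit point `w` and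
the period correction `σ`, normalized by the phase condition `w (0, 1) = 0`.

The frequencies are distinct odd integers and the saturation sees only the first coordinate, so
averaging decouples the blocks. With amplitude `ρ = w (0, 0)`, block `j` becomes one complex
equation `(a_j + i e_j) w_j + c_j(ρ) b_j = 0`, where `c_j` is `satCoeff j` and `e_j` is affine in
`σ`. The quotient `c_0(ρ) / ρ` is constant up to `ρ = 1` and strictly decreasing beyond. Hence, if
`ρ > 1`, `b (0, 0) ≠ 0` and the remaining coefficients do not vanish (`IsNondegenerate`), the first
block fixes `ρ` and `σ`, and the other blocks are uniquely solvable (`IsNondegenerate.unique`). If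
one of these conditions fails at a zero of the averaged function, the zero lies on a curve of zeros;
so isolated zeros are nondegenerate (`IsIsolatedZero.exists_isNondegenerate`).

The saturation is not differentiable, but an integral operator built from it is strictly
differentiable at a constant curve, since little time is spent near the switching values
(`hasStrictFDerivAt_perturbationOperator`). At a nondegenerate solution the derivative of the
bifurcation equations is invertible (`IsNondegenerate.exists_equiv`). Local injectivity gives
uniqueness: two families of limit cycles, followed over a common multiple of their limit periods,
give preimages of the same points converging to the same limit. Orbits with vanishing first block
are excluded beforehand, because nearby periodic orbits lie in the linear zone and come in scaled
copies (`not_isLimitCycle_of_abs_lt_one`). Part (b) reduces to (a), as the limit of a family in the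
polar domain is a zero of the averaged function.

For the example take `A = -1` and choose `b` so that a zero with prescribed amplitudes exists. Local
surjectivity gives periodic solutions. Their isolation among periodic orbits of every period needs
another argument: the first plane decouples, and comparing radii as functions of the angle shows
that two periodic orbits there must meet (`false_of_radial_lt`); the other blocks are damped linear
equations driven by the first, so bounded solutions are determined by it
(`range_eq_of_firstBlock_eq`). -/

theorem sat_eq_max_min (s : ℝ) : sat s = max (-1) (min s 1) := by
  unfold sat
  split_ifs with h₁ h₂
  · rw [min_eq_left (by linarith), max_eq_left (by linarith)]
  · rw [min_eq_left h₂, max_eq_right (by linarith)]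
  · rw [min_eq_right (by linarith), max_eq_right (by norm_num)]

theorem sat_of_abs_le {s : ℝ} (h : |s| ≤ 1) : sat s = s := by
  obtain ⟨h₁, h₂⟩ := abs_le.1 h
  rw [sat_eq_max_min, min_eq_left h₂, max_eq_right h₁]

theorem sat_of_one_le {s : ℝ} (h : 1 ≤ s) : sat s = 1 := by
  rw [sat_eq_max_min, min_eq_right h, max_eq_right (by norm_num)]

theorem sat_of_le_neg_one {s : ℝ} (h : s ≤ -1) : sat s = -1 := by
  rw [sat_eq_max_min, min_eq_left (by linarith), max_eq_left h]

theorem sat_zero : sat 0 = 0 := sat_of_abs_le (by simp)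

theorem sat_neg (s : ℝ) : sat (-s) = -sat s := by
  rcases le_total s (-1) with h | h
  · rw [sat_of_le_neg_one h, sat_of_one_le (by linarith), neg_neg]
  rcases le_total 1 s with h' | h'
  · rw [sat_of_one_le h', sat_of_le_neg_one (by linarith)]
  · rw [sat_of_abs_le (abs_le.2 ⟨h, h'⟩), sat_of_abs_le (abs_le.2 ⟨by linarith, by linarith⟩)]

theorem abs_sat_sub_sat_le (s t : ℝ) : |sat s - sat t| ≤ |s - t| := by
  simp only [sat_eq_max_min]
  calc |max (-1) (min s 1) - max (-1) (min t 1)| = |max (min s 1) (-1) - max (min t 1) (-1)| := by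
        simp only [max_comm]
    _ ≤ |min s 1 - min t 1| := abs_max_sub_max_le_abs _ _ _
    _ ≤ max |s - t| |(1 : ℝ) - 1| := abs_min_sub_min_le_max _ _ _ _
    _ = |s - t| := by simp

theorem abs_sat_le_one (s : ℝ) : |sat s| ≤ 1 := by
  rw [sat_eq_max_min, abs_le]
  exact ⟨le_max_left _ _, max_le (by norm_num) (min_le_right _ _)⟩

theorem continuous_sat : Continuous sat := by
  rw [show sat = fun s => max (-1) (min s 1) from funext sat_eq_max_min]
  fun_prop

theorem monotone_sat : Monotone sat := by
  intro s t h
  simp only [sat_eq_max_min]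
  gcongr

/-! ### Vectors grouped in pairs and the unperturbed flow -/

theorem phase_ext {x y : Phase n} (h₀ : ∀ j, x (j, 0) = y (j, 0)) (h₁ : ∀ j, x (j, 1) = y (j, 1)) :
    x = y := by
  funext ⟨j, i⟩
  fin_cases i
  · exact h₀ j
  · exact h₁ j

theorem freq_pos (j : Fin n) : 0 < freq j := by
  unfold freq; positivity

theorem freq_zero [NeZero n] : freq (0 : Fin n) = 1 := by
  simp [freq]

theorem cos_freq_add (j : Fin n) (t : ℝ) (m : ℕ) :
    Real.cos (freq j * (t + m * (2 * Real.pi))) = Real.cos (freq j * t) := by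
  have : freq j * (t + m * (2 * Real.pi)) =
      freq j * t + ((2 * (j : ℕ) + 1) * m : ℕ) * (2 * Real.pi) := by
    unfold freq; push_cast; ring
  rw [this, Real.cos_add_nat_mul_two_pi]

theorem sin_freq_add (j : Fin n) (t : ℝ) (m : ℕ) :
    Real.sin (freq j * (t + m * (2 * Real.pi))) = Real.sin (freq j * t) := by
  have : freq j * (t + m * (2 * Real.pi)) =
      freq j * t + ((2 * (j : ℕ) + 1) * m : ℕ) * (2 * Real.pi) := by
    unfold freq; push_cast; ring
  rw [this, Real.sin_add_nat_mul_two_pi]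

/-- The unperturbed linear vector field. -/
def centerMap (n : ℕ) : Phase n →L[ℝ] Phase n :=
  (centerMatrix n).mulVecLin.toContinuousLinearMap

theorem centerMap_eq (x : Phase n) : centerMap n x = (centerMatrix n).mulVec x := rfl

@[simp] theorem centerMap_zero (x : Phase n) (j : Fin n) :
    centerMap n x (j, 0) = -freq j * x (j, 1) := by
  simp [centerMap_eq, Matrix.mulVec, dotProduct, centerMatrix, Fintype.sum_prod_type, ite_mul]

@[simp] theorem centerMap_one (x : Phase n) (j : Fin n) :
    centerMap n x (j, 1) = freq j * x (j, 0) := by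
  simp [centerMap_eq, Matrix.mulVec, dotProduct, centerMatrix, Fintype.sum_prod_type, ite_mul]

/-- The flow of the unperturbed linear vector field. -/
def rot (n : ℕ) (t : ℝ) : Phase n →L[ℝ] Phase n :=
  LinearMap.toContinuousLinearMap
    { toFun := fun x q =>
        ![Real.cos (freq q.1 * t) * x (q.1, 0) - Real.sin (freq q.1 * t) * x (q.1, 1),
          Real.sin (freq q.1 * t) * x (q.1, 0) + Real.cos (freq q.1 * t) * x (q.1, 1)] q.2
      map_add' := fun x y => by
        apply phase_ext <;> intro j <;> simp <;> ring
      map_smul' := fun c x => by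
        apply phase_ext <;> intro j <;> simp <;> ring }

@[simp] theorem rot_apply_zero (t : ℝ) (x : Phase n) (j : Fin n) :
    rot n t x (j, 0) = Real.cos (freq j * t) * x (j, 0) - Real.sin (freq j * t) * x (j, 1) := rfl

@[simp] theorem rot_apply_one (t : ℝ) (x : Phase n) (j : Fin n) :
    rot n t x (j, 1) = Real.sin (freq j * t) * x (j, 0) + Real.cos (freq j * t) * x (j, 1) := rfl

theorem rot_add (s t : ℝ) (x : Phase n) : rot n (s + t) x = rot n s (rot n t x) := by
  apply phase_ext <;> intro j <;> simp [mul_add, Real.cos_add, Real.sin_add] <;> ring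

@[simp] theorem rot_zero (x : Phase n) : rot n 0 x = x := by
  apply phase_ext <;> intro j <;> simp

@[simp] theorem rot_rot_neg (t : ℝ) (x : Phase n) : rot n t (rot n (-t) x) = x := by
  rw [← rot_add]; simp

@[simp] theorem rot_neg_rot (t : ℝ) (x : Phase n) : rot n (-t) (rot n t x) = x := by
  rw [← rot_add]; simp

theorem rot_add_period (t : ℝ) (m : ℕ) (x : Phase n) :
    rot n (t + m * (2 * Real.pi)) x = rot n t x := by
  apply phase_ext <;> intro j <;> simp [cos_freq_add, sin_freq_add]

theorem rot_neg_add_period (t : ℝ) (m : ℕ) (x : Phase n) :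
    rot n (-(t + m * (2 * Real.pi))) x = rot n (-t) x := by
  rw [← rot_add_period _ m, neg_add, neg_add_cancel_right]

theorem rot_centerMap (t : ℝ) (x : Phase n) :
    rot n t (centerMap n x) = centerMap n (rot n t x) := by
  apply phase_ext <;> intro j <;> simp <;> ring

/-- The norm is the supremum norm, which rotations do not preserve; the crude factor `2` is the
source of the factors `2` and `4` in later estimates. -/
theorem norm_rot_apply_le (t : ℝ) (x : Phase n) : ‖rot n t x‖ ≤ 2 * ‖x‖ := by
  rw [pi_norm_le_iff_of_nonneg (by positivity)]
  rintro ⟨j, i⟩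
  have h₀ : |x (j, 0)| ≤ ‖x‖ := norm_le_pi_norm x (j, 0)
  have h₁ : |x (j, 1)| ≤ ‖x‖ := norm_le_pi_norm x (j, 1)
  have hc := Real.abs_cos_le_one (freq j * t)
  have hs := Real.abs_sin_le_one (freq j * t)
  have e₀ : ∀ (c y : ℝ), |c| ≤ 1 → |y| ≤ ‖x‖ → |c * y| ≤ ‖x‖ := fun c y hc hy => by
    rw [abs_mul]; nlinarith [abs_nonneg c, abs_nonneg y]
  fin_cases i
  · simp only [Fin.zero_eta, rot_apply_zero, Real.norm_eq_abs]
    linarith [abs_sub (Real.cos (freq j * t) * x (j, 0)) (Real.sin (freq j * t) * x (j, 1)),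
      e₀ _ _ hc h₀, e₀ _ _ hs h₁]
  · simp only [Fin.mk_one, rot_apply_one, Real.norm_eq_abs]
    linarith [abs_add_le (Real.sin (freq j * t) * x (j, 0)) (Real.cos (freq j * t) * x (j, 1)),
      e₀ _ _ hs h₀, e₀ _ _ hc h₁]

theorem continuous_rot_comp {α : Type*} [TopologicalSpace α] {f : α → ℝ} {g : α → Phase n}
    (hf : Continuous f) (hg : Continuous g) : Continuous fun a => rot n (f a) (g a) := by
  have hg' : ∀ q, Continuous fun a => g a q := fun q => (continuous_apply q).comp hg
  refine continuous_pi fun ⟨j, i⟩ => ?_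
  have h₀ := hg' (j, 0)
  have h₁ := hg' (j, 1)
  fin_cases i
  · simp only [Fin.zero_eta, rot_apply_zero]; fun_prop
  · simp only [Fin.mk_one, rot_apply_one]; fun_prop

theorem hasDerivAt_rot_comp {f : ℝ → ℝ} {x : ℝ → Phase n} {t f' : ℝ} {x' : Phase n}
    (hf : HasDerivAt f f' t) (hx : HasDerivAt x x' t) :
    HasDerivAt (fun s => rot n (f s) (x s))
      (f' • centerMap n (rot n (f t) (x t)) + rot n (f t) x') t := by
  have hx' := hasDerivAt_pi.1 hx
  refine hasDerivAt_pi.2 fun ⟨j, i⟩ => ?_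
  have hω : HasDerivAt (fun s => freq j * f s) (freq j * f') t := hf.const_mul _
  have h₀ := hx' (j, 0)
  have h₁ := hx' (j, 1)
  fin_cases i
  · simp only [Fin.zero_eta, rot_apply_zero, Pi.add_apply, Pi.smul_apply, centerMap_zero,
      rot_apply_one]
    refine ((hω.cos.mul h₀).sub (hω.sin.mul h₁)).congr_deriv ?_
    simp only [smul_eq_mul]; ring
  · simp only [Fin.mk_one, rot_apply_zero, Pi.add_apply, Pi.smul_apply, centerMap_one,
      rot_apply_one]
    refine ((hω.sin.mul h₀).add (hω.cos.mul h₁)).congr_deriv ?_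
    simp only [smul_eq_mul]; ring

/-! ### The perturbed vector field -/

section Field

variable [NeZero n] (A : Mat n) (b : Phase n)

theorem exists_perturbation_bound : ∃ C : NNReal, ∀ x y : Phase n,
    ‖perturbation A b x - perturbation A b y‖ ≤ C * ‖x - y‖ := by
  let T := A.mulVecLin.toContinuousLinearMap
  refine ⟨‖T‖₊ + ‖b‖₊, fun x y => ?_⟩
  have e : perturbation A b x - perturbation A b y =
      T (x - y) + (sat (x (0, 0)) - sat (y (0, 0))) • b := by
    have hT : ∀ z, T z = A.mulVec z := fun z => rfl
    simp only [perturbation, hT, Matrix.mulVec_sub, sub_smul]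
    abel
  have h₁ : |sat (x (0, 0)) - sat (y (0, 0))| ≤ ‖x - y‖ :=
    (abs_sat_sub_sat_le _ _).trans (norm_le_pi_norm (x - y) (0, 0))
  rw [e]
  calc _ ≤ ‖T (x - y)‖ + ‖(sat (x (0, 0)) - sat (y (0, 0))) • b‖ := norm_add_le _ _
    _ ≤ ‖T‖ * ‖x - y‖ + ‖x - y‖ * ‖b‖ := by
        rw [norm_smul, Real.norm_eq_abs]
        gcongr
        exact T.le_opNorm _
    _ = _ := by simp; ring

theorem perturbation_zero : perturbation A b 0 = 0 := by
  simp [perturbation, sat_zero]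

theorem continuous_perturbation : Continuous (perturbation A b) := by
  obtain ⟨C, hC⟩ := exists_perturbation_bound A b
  refine (LipschitzWith.of_dist_le_mul (K := C) fun x y => ?_).continuous
  simpa [dist_eq_norm] using hC x y

theorem field_eq (ε : ℝ) (x : Phase n) :
    field A b ε x = centerMap n x + ε • perturbation A b x := rfl

theorem exists_lipschitzWith_field (ε : ℝ) : ∃ K, LipschitzWith K (field A b ε) := by
  obtain ⟨C, hC⟩ := exists_perturbation_bound A b
  refine ⟨‖centerMap n‖₊ + ‖ε‖₊ * C, LipschitzWith.of_dist_le_mul fun x y => ?_⟩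
  rw [dist_eq_norm, dist_eq_norm]
  have e : field A b ε x - field A b ε y =
      centerMap n (x - y) + ε • (perturbation A b x - perturbation A b y) := by
    simp only [field_eq, map_sub, smul_sub]; abel
  rw [e]
  calc _ ≤ ‖centerMap n (x - y)‖ + ‖ε • (perturbation A b x - perturbation A b y)‖ :=
        norm_add_le _ _
    _ ≤ ‖centerMap n‖ * ‖x - y‖ + ‖ε‖ * (C * ‖x - y‖) := by
        rw [norm_smul]
        gcongr
        · exact (centerMap n).le_opNorm _
        · exact hC x y
    _ = _ := by simp; ring

variable {A b}

/-- The field is globally Lipschitz and autonomous. Allowing different times `s` and `s'` makes it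
possible to compare orbits with unrelated parametrizations. -/
theorem solution_unique {ε : ℝ} {x y : ℝ → Phase n}
    (hx : ∀ t, HasDerivAt x (field A b ε (x t)) t) (hy : ∀ t, HasDerivAt y (field A b ε (y t)) t)
    {s s' : ℝ} (h : x s = y s') (t : ℝ) : x (s + t) = y (s' + t) := by
  obtain ⟨K, hK⟩ := exists_lipschitzWith_field A b ε
  have := ODE_solution_unique_univ (v := fun _ => field A b ε) (s := fun _ => Set.univ) (K := K)
    (f := fun t => x (s + t)) (g := fun t => y (s' + t)) (t₀ := 0) (fun _ => hK.lipschitzOnWith)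
    (fun t => ⟨HasDerivAt.comp_const_add s t (hx (s + t)), trivial⟩)
    (fun t => ⟨HasDerivAt.comp_const_add s' t (hy (s' + t)), trivial⟩) (by simpa using h)
  exact congrFun this t

theorem range_eq_of_eq {ε : ℝ} {x y : ℝ → Phase n}
    (hx : ∀ t, HasDerivAt x (field A b ε (x t)) t) (hy : ∀ t, HasDerivAt y (field A b ε (y t)) t)
    {s s' : ℝ} (h : x s = y s') : Set.range x = Set.range y := by
  have := solution_unique hx hy h
  apply Set.Subset.antisymm
  · rintro _ ⟨t, rfl⟩
    exact ⟨s' + (t - s), by rw [← this, add_sub_cancel]⟩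
  · rintro _ ⟨t, rfl⟩
    exact ⟨s + (t - s'), by rw [this, add_sub_cancel]⟩

/-- A periodic orbit in the zone where the vector field is linear is not a limit cycle. -/
theorem not_isLimitCycle_of_abs_lt_one {ε : ℝ} {Γ : Set (Phase n)}
    (hΓ : ∀ x ∈ Γ, |x (0, 0)| < 1) : ¬ IsLimitCycle (field A b ε) Γ := by
  rintro ⟨⟨x, T, ⟨hT, hx, hper, t₁, ht₁⟩, rfl⟩, U, hU, hΓU, huniq⟩
  have hcont : Continuous x := continuous_iff_continuousAt.2 fun t => (hx t).continuousAt
  have hcomp : IsCompact (Set.range x) := by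
    rw [← hper.image_Icc hT 0]
    exact isCompact_Icc.image hcont
  have hΓ' : ∀ t, |x t (0, 0)| < 1 := fun t => hΓ _ ⟨t, rfl⟩
  -- all multiples by factors close to `1` lie in the same open set and in the linear zone
  have hV : IsOpen (U ∩ {y : Phase n | |y (0, 0)| < 1}) :=
    hU.inter (isOpen_lt (by fun_prop) continuous_const)
  have hev : ∀ᶠ c : ℝ in 𝓝 1, ∀ y ∈ Set.range x, c • y ∈ U ∩ {y : Phase n | |y (0, 0)| < 1} := by
    refine hcomp.eventually_forall_of_forall_eventually fun y hy => ?_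
    have hc : Continuous fun q : ℝ × Phase n => q.1 • q.2 := by fun_prop
    refine hc.continuousAt.eventually (hV.mem_nhds ?_)
    obtain ⟨t, rfl⟩ := hy
    simpa using ⟨hΓU ⟨t, rfl⟩, hΓ' t⟩
  have hev' : ∀ᶠ c : ℝ in 𝓝[≠] 1, ∀ y ∈ Set.range x, c • y ∈ U ∩ {y : Phase n | |y (0, 0)| < 1} :=
    hev.filter_mono nhdsWithin_le_nhds
  have hpos : ∀ᶠ c : ℝ in 𝓝[≠] 1, 0 < c :=
    (eventually_gt_nhds one_pos).filter_mono nhdsWithin_le_nhds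
  obtain ⟨c, hc, hc0, hc1⟩ := (hev'.and (hpos.and self_mem_nhdsWithin)).exists
  -- Where `|x₁| ≤ 1` the field is linear, so the scaled curve is again a periodic solution, and
  -- isolation identifies the two orbits.
  have key : Set.range (fun t => c • x t) = Set.range x := by
    refine huniq _ ⟨fun t => c • x t, T, ⟨hT, fun t => ?_, fun t => ?_, t₁, ?_⟩, rfl⟩ ?_
    · have h₁ : |c * x t (0, 0)| < 1 := by simpa using (hc _ ⟨t, rfl⟩).2
      have : field A b ε (c • x t) = c • field A b ε (x t) := by
        simp only [field_eq, perturbation, Pi.smul_apply, smul_eq_mul, sat_of_abs_le h₁.le,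
          sat_of_abs_le (hΓ' t).le, map_smul, Matrix.mulVec_smul, smul_add, smul_smul]
        ring_nf
      rw [this]
      exact (hx t).const_smul c
    · simp [hper t]
    · simpa using fun h => ht₁ (smul_right_injective _ hc0.ne' h)
    · rintro _ ⟨t, rfl⟩
      exact (hc _ ⟨t, rfl⟩).1
  -- A compact set containing a nonzero point is not invariant under scaling by a positive factor
  -- other than `1`: compare maximal norms.
  obtain ⟨y, ⟨s, rfl⟩, hmax⟩ := hcomp.exists_isMaxOn (Set.range_nonempty x) continuous_norm.continuousOn
  have hne : 0 < ‖x s‖ := by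
    by_contra h0
    have hz : ∀ t, x t = 0 := fun t =>
      norm_le_zero_iff.1 ((hmax ⟨t, rfl⟩).trans (not_lt.1 h0))
    exact ht₁ (by rw [hz, hz])
  have hle : c ≤ 1 := by
    have h₁ : c • x s ∈ Set.range x := key ▸ ⟨s, rfl⟩
    have h₂ : ‖c • x s‖ ≤ ‖x s‖ := hmax h₁
    rw [norm_smul, Real.norm_of_nonneg hc0.le] at h₂
    exact (mul_le_iff_le_one_left hne).1 h₂
  have hge : 1 ≤ c := by
    obtain ⟨t, ht⟩ : x s ∈ Set.range fun t => c • x t := key ▸ ⟨s, rfl⟩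
    have h₂ : ‖x t‖ ≤ ‖x s‖ := hmax ⟨t, rfl⟩
    have h₃ : c * ‖x t‖ = ‖x s‖ := by
      rw [← ht, norm_smul, Real.norm_of_nonneg hc0.le]
    nlinarith
  exact hc1 (le_antisymm hle hge)

end Field

end

section

variable {n : ℕ}

/-! ### Averages over a period -/

theorem integral_cos_int_mul {m : ℤ} (hm : m ≠ 0) :
    ∫ t in (0 : ℝ)..(2 * Real.pi), Real.cos (m * t) = 0 := by
  have hm' : (m : ℝ) ≠ 0 := by exact_mod_cast hm
  rw [intervalIntegral.integral_comp_mul_left (fun t => Real.cos t) hm', integral_cos]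
  have : Real.sin (m * (2 * Real.pi)) = 0 := by simpa using Real.sin_add_int_mul_two_pi 0 m
  simp [this]

theorem integral_sin_int_mul (m : ℤ) :
    ∫ t in (0 : ℝ)..(2 * Real.pi), Real.sin (m * t) = 0 := by
  rcases eq_or_ne m 0 with rfl | hm
  · simp
  have hm' : (m : ℝ) ≠ 0 := by exact_mod_cast hm
  rw [intervalIntegral.integral_comp_mul_left (fun t => Real.sin t) hm', integral_sin]
  simp [Real.cos_int_mul_two_pi]

theorem freq_sub_eq (j k : Fin n) : freq j - freq k = ((2 * ((j : ℕ) - (k : ℕ) : ℤ) : ℤ) : ℝ) := by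
  unfold freq; push_cast; ring

theorem freq_add_eq (j k : Fin n) :
    freq j + freq k = ((2 * ((j : ℕ) + (k : ℕ) + 1) : ℤ) : ℝ) := by
  unfold freq; push_cast; ring

theorem integral_cos_freq_sub (j k : Fin n) :
    ∫ t in (0 : ℝ)..(2 * Real.pi), Real.cos ((freq j - freq k) * t) =
      if j = k then 2 * Real.pi else 0 := by
  split_ifs with h
  · simp [h]
  · rw [freq_sub_eq]
    refine integral_cos_int_mul ?_
    have : (j : ℕ) ≠ k := fun e => h (Fin.ext e)
    omega

theorem integral_cos_freq_add (j k : Fin n) :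
    ∫ t in (0 : ℝ)..(2 * Real.pi), Real.cos ((freq j + freq k) * t) = 0 := by
  rw [freq_add_eq]
  exact integral_cos_int_mul (by omega)

/-- Sums and differences of frequencies are even integers, and the only one that can vanish is the
difference for `j = k`. -/
theorem integral_cos_mul_cos (j k : Fin n) :
    ∫ t in (0 : ℝ)..(2 * Real.pi), Real.cos (freq j * t) * Real.cos (freq k * t) =
      if j = k then Real.pi else 0 := by
  have e : ∀ t, Real.cos (freq j * t) * Real.cos (freq k * t) =
      (1 / 2) * (Real.cos ((freq j - freq k) * t) + Real.cos ((freq j + freq k) * t)) := by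
    intro t; rw [sub_mul, add_mul, Real.cos_sub, Real.cos_add]; ring
  simp_rw [e]
  rw [intervalIntegral.integral_const_mul, intervalIntegral.integral_add
    (Continuous.intervalIntegrable (by fun_prop) _ _)
    (Continuous.intervalIntegrable (by fun_prop) _ _), integral_cos_freq_sub, integral_cos_freq_add]
  split_ifs <;> ring

theorem integral_sin_mul_sin (j k : Fin n) :
    ∫ t in (0 : ℝ)..(2 * Real.pi), Real.sin (freq j * t) * Real.sin (freq k * t) =
      if j = k then Real.pi else 0 := by
  have e : ∀ t, Real.sin (freq j * t) * Real.sin (freq k * t) =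
      (1 / 2) * (Real.cos ((freq j - freq k) * t) - Real.cos ((freq j + freq k) * t)) := by
    intro t; rw [sub_mul, add_mul, Real.cos_sub, Real.cos_add]; ring
  simp_rw [e]
  rw [intervalIntegral.integral_const_mul, intervalIntegral.integral_sub
    (Continuous.intervalIntegrable (by fun_prop) _ _)
    (Continuous.intervalIntegrable (by fun_prop) _ _), integral_cos_freq_sub, integral_cos_freq_add]
  split_ifs <;> ring

theorem integral_cos_mul_sin (j k : Fin n) :
    ∫ t in (0 : ℝ)..(2 * Real.pi), Real.cos (freq j * t) * Real.sin (freq k * t) = 0 := by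
  have e : ∀ t, Real.cos (freq j * t) * Real.sin (freq k * t) =
      (1 / 2) * (Real.sin ((freq j + freq k) * t) - Real.sin ((freq j - freq k) * t)) := by
    intro t; rw [sub_mul, add_mul, Real.sin_sub, Real.sin_add]; ring
  simp_rw [e]
  rw [intervalIntegral.integral_const_mul, intervalIntegral.integral_sub
    (Continuous.intervalIntegrable (by fun_prop) _ _)
    (Continuous.intervalIntegrable (by fun_prop) _ _), freq_sub_eq, freq_add_eq,
    integral_sin_int_mul, integral_sin_int_mul]
  simp

theorem integral_sin_mul_cos (j k : Fin n) :
    ∫ t in (0 : ℝ)..(2 * Real.pi), Real.sin (freq j * t) * Real.cos (freq k * t) = 0 := by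
  simp_rw [mul_comm (Real.sin _)]
  exact integral_cos_mul_sin k j

/-- The Fourier coefficients of odd order of `t ↦ φ(r cos t)`, without normalizing factor. -/
def satCoeff (j : Fin n) (r : ℝ) : ℝ :=
  ∫ t in (0 : ℝ)..(2 * Real.pi), sat (r * Real.cos t) * Real.cos (freq j * t)

/-- The reflection `t ↦ 2π - t` fixes the cosine and reverses the sine. -/
theorem integral_sat_mul_sin (j : Fin n) (r : ℝ) :
    ∫ t in (0 : ℝ)..(2 * Real.pi), sat (r * Real.cos t) * Real.sin (freq j * t) = 0 := by
  have h := intervalIntegral.integral_comp_sub_left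
    (fun t => sat (r * Real.cos t) * Real.sin (freq j * t)) (a := 0) (b := 2 * Real.pi)
    (2 * Real.pi)
  have e : ∀ t, sat (r * Real.cos (2 * Real.pi - t)) * Real.sin (freq j * (2 * Real.pi - t)) =
      -(sat (r * Real.cos t) * Real.sin (freq j * t)) := by
    intro t
    have := sin_freq_add j (-t) 1
    rw [show freq j * (2 * Real.pi - t) = freq j * (-t + (1 : ℕ) * (2 * Real.pi)) by
      push_cast; ring, this, Real.cos_two_pi_sub, mul_neg, Real.sin_neg]
    ring
  simp only [e, intervalIntegral.integral_neg, sub_self, sub_zero] at h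
  linarith

/-- Below the threshold the saturation is the identity, so only the first harmonic is present and it
is proportional to the amplitude. This is what makes zeros with `r ≤ 1` non-isolated. -/
theorem satCoeff_of_le_one {r : ℝ} (h₀ : 0 ≤ r) (h₁ : r ≤ 1) [NeZero n] (j : Fin n) :
    satCoeff j r = if j = 0 then r * Real.pi else 0 := by
  have e : ∀ t, sat (r * Real.cos t) * Real.cos (freq j * t) =
      r * (Real.cos (freq j * t) * Real.cos (freq (0 : Fin n) * t)) := by
    intro t
    rw [sat_of_abs_le, freq_zero, one_mul]
    · ring
    · rw [abs_mul, abs_of_nonneg h₀]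
      nlinarith [abs_nonneg (Real.cos t), Real.abs_cos_le_one t]
  unfold satCoeff
  simp_rw [e]
  rw [intervalIntegral.integral_const_mul, integral_cos_mul_cos]
  split_ifs <;> simp

theorem continuous_satCoeff (j : Fin n) : Continuous (satCoeff j) := by
  refine intervalIntegral.continuous_parametric_intervalIntegral_of_continuous' ?_ 0 (2 * Real.pi)
  have := continuous_sat
  simp only [Function.uncurry_def]
  fun_prop

/-- Division-free form of the fact that `sat (r c) / r`, times the sign of `c`, does not increase
with `r`. -/
theorem mul_sat_mul_sign_le {r ρ c : ℝ} (hr : 0 < r) (h : r ≤ ρ) :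
    0 ≤ (ρ * sat (r * c) - r * sat (ρ * c)) * c := by
  have key : ∀ {c : ℝ}, 0 ≤ c → r * sat (ρ * c) ≤ ρ * sat (r * c) := by
    intro c hc
    have h₁ : sat (ρ * c) = min (ρ * c) 1 := by
      rw [sat_eq_max_min, max_eq_right]
      exact le_min (by nlinarith) (by norm_num)
    have h₂ : sat (r * c) = min (r * c) 1 := by
      rw [sat_eq_max_min, max_eq_right]
      exact le_min (by nlinarith) (by norm_num)
    rw [h₁, h₂]
    rcases le_total (r * c) 1 with h' | h'
    · rw [min_eq_left h']
      have := min_le_left (ρ * c) 1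
      nlinarith
    · rw [min_eq_right h']
      have := min_le_right (ρ * c) 1
      nlinarith
  rcases le_total 0 c with hc | hc
  · exact mul_nonneg (by linarith [key hc]) hc
  · have := key (c := -c) (by linarith)
    simp only [mul_neg, sat_neg] at this
    nlinarith

/-- The quotient of the first Fourier coefficient by the amplitude is strictly decreasing above
the threshold of saturation. -/
theorem satCoeff_zero_div_strictAnti [NeZero n] {r ρ : ℝ} (hr : 0 < r) (h : r < ρ) (hρ : 1 < ρ) :
    r * satCoeff (0 : Fin n) ρ < ρ * satCoeff (0 : Fin n) r := by
  have hc := continuous_sat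
  have hpos : 0 < ∫ t in (0 : ℝ)..(2 * Real.pi),
      (ρ * sat (r * Real.cos t) - r * sat (ρ * Real.cos t)) * Real.cos t := by
    -- Strictness comes from `t = 0`, where the larger oscillation is saturated.
    refine intervalIntegral.integral_pos Real.two_pi_pos (by fun_prop)
      (fun t _ => mul_sat_mul_sign_le hr h.le) ⟨0, by simp [Real.pi_pos.le], ?_⟩
    simp only [Real.cos_zero, mul_one]
    rw [sat_of_one_le hρ.le, sat_eq_max_min]
    rcases le_total r 1 with h' | h'
    · rw [min_eq_left h', max_eq_right (by linarith)]; nlinarith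
    · rw [min_eq_right h', max_eq_right (by linarith)]; linarith
  have e : ∀ t, (ρ * sat (r * Real.cos t) - r * sat (ρ * Real.cos t)) * Real.cos t =
      ρ * (sat (r * Real.cos t) * Real.cos (freq (0 : Fin n) * t)) -
      r * (sat (ρ * Real.cos t) * Real.cos (freq (0 : Fin n) * t)) := by
    intro t; rw [freq_zero, one_mul]; ring
  simp_rw [e] at hpos
  rw [intervalIntegral.integral_sub (Continuous.intervalIntegrable (by fun_prop) _ _)
    (Continuous.intervalIntegrable (by fun_prop) _ _), intervalIntegral.integral_const_mul,
    intervalIntegral.integral_const_mul] at hpos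
  unfold satCoeff
  linarith

/-! ### The perturbation averaged in rotating coordinates. -/

section Average

variable [NeZero n] (A : Mat n) (b : Phase n)

/-- The perturbation in the coordinates rotating with the unperturbed flow. -/
def rotatingField (t : ℝ) (x : Phase n) : Phase n := rot n (-t) (perturbation A b (rot n t x))

theorem rotatingField_add_period (t : ℝ) (m : ℕ) (x : Phase n) :
    rotatingField A b (t + m * (2 * Real.pi)) x = rotatingField A b t x := by
  unfold rotatingField
  rw [rot_add_period, rot_neg_add_period]

theorem continuous_rotatingField_comp {α : Type*} [TopologicalSpace α] {f : α → ℝ}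
    {g : α → Phase n} (hf : Continuous f) (hg : Continuous g) :
    Continuous fun a => rotatingField A b (f a) (g a) :=
  continuous_rot_comp hf.neg ((continuous_perturbation A b).comp (continuous_rot_comp hf hg))

/-- The integral of the perturbation over one period of the unperturbed flow. -/
def averagedField (x : Phase n) : Phase n :=
  ∫ t in (0 : ℝ)..(2 * Real.pi), rotatingField A b t x

omit [NeZero n] in
theorem intervalIntegral_phase_apply {f : ℝ → Phase n} {s t : ℝ}
    (hf : IntervalIntegrable f MeasureTheory.volume s t) (q : Fin n × Fin 2) :
    (∫ u in s..t, f u) q = ∫ u in s..t, f u q :=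
  ((ContinuousLinearMap.proj (R := ℝ) (φ := fun _ : Fin n × Fin 2 => ℝ) q).intervalIntegral_comp_comm
    hf).symm

theorem averagedField_apply (x : Phase n) (q : Fin n × Fin 2) :
    averagedField A b x q = ∫ t in (0 : ℝ)..(2 * Real.pi), rotatingField A b t x q :=
  intervalIntegral_phase_apply
    ((continuous_rotatingField_comp A b continuous_id continuous_const).intervalIntegrable _ _) q

/-- Real part of the average of the diagonal blocks of `A`. -/
def blockRe (A : Mat n) (j : Fin n) : ℝ := Real.pi * (A (j, 0) (j, 0) + A (j, 1) (j, 1))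

/-- Imaginary part of the average of the diagonal blocks of `A`. -/
def blockIm (A : Mat n) (j : Fin n) : ℝ := Real.pi * (A (j, 1) (j, 0) - A (j, 0) (j, 1))

omit [NeZero n] in
-- Conjugating the `(j, k)` block of a matrix by the flow produces exactly such combinations; only
-- the diagonal blocks survive the average.
theorem integral_trig_combination (j k : Fin n) (P Q R S : ℝ) :
    ∫ t in (0 : ℝ)..(2 * Real.pi),
      (P * (Real.cos (freq j * t) * Real.cos (freq k * t)) +
        Q * (Real.sin (freq j * t) * Real.sin (freq k * t)) +
        R * (Real.cos (freq j * t) * Real.sin (freq k * t)) +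
        S * (Real.sin (freq j * t) * Real.cos (freq k * t))) =
      if j = k then Real.pi * (P + Q) else 0 := by
  have hi : ∀ f : ℝ → ℝ, Continuous f →
    IntervalIntegrable f MeasureTheory.volume 0 (2 * Real.pi) :=
    fun f hf => hf.intervalIntegrable _ _
  rw [intervalIntegral.integral_add (hi _ (by fun_prop)) (hi _ (by fun_prop)),
    intervalIntegral.integral_add (hi _ (by fun_prop)) (hi _ (by fun_prop)),
    intervalIntegral.integral_add (hi _ (by fun_prop)) (hi _ (by fun_prop))]
  simp only [intervalIntegral.integral_const_mul, integral_cos_mul_cos, integral_sin_mul_sin,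
    integral_cos_mul_sin, integral_sin_mul_cos]
  split_ifs <;> ring

variable {A b}

omit [NeZero n] in
theorem mulVec_pair (x : Phase n) (q : Fin n × Fin 2) :
    A.mulVec x q = ∑ k : Fin n, (A q (k, 0) * x (k, 0) + A q (k, 1) * x (k, 1)) := by
  change ∑ r, A q r * x r = _
  rw [Fintype.sum_prod_type]
  simp only [Fin.sum_univ_two]

/-- Averaging over the flow keeps from each diagonal block of `A` only its part that commutes with
rotations, multiplication by `blockRe + i blockIm`. By `hx` the first coordinate along the
unperturbed orbit is `x (0, 0) cos t`, so the saturation enters through its cosine coefficients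
alone. -/
theorem averagedField_zero {x : Phase n} (hx : x (0, 1) = 0) (j : Fin n) :
    averagedField A b x (j, 0) = blockRe A j * x (j, 0) - blockIm A j * x (j, 1) +
      satCoeff j (x (0, 0)) * b (j, 0) := by
  have hs := continuous_sat
  rw [averagedField_apply]
  have e : ∀ t, rotatingField A b t x (j, 0) =
      (∑ k : Fin n,
        ((A (j, 0) (k, 0) * x (k, 0) + A (j, 0) (k, 1) * x (k, 1)) *
            (Real.cos (freq j * t) * Real.cos (freq k * t)) +
          (A (j, 1) (k, 1) * x (k, 0) - A (j, 1) (k, 0) * x (k, 1)) *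
            (Real.sin (freq j * t) * Real.sin (freq k * t)) +
          (A (j, 0) (k, 1) * x (k, 0) - A (j, 0) (k, 0) * x (k, 1)) *
            (Real.cos (freq j * t) * Real.sin (freq k * t)) +
          (A (j, 1) (k, 0) * x (k, 0) + A (j, 1) (k, 1) * x (k, 1)) *
            (Real.sin (freq j * t) * Real.cos (freq k * t)))) +
      (b (j, 0) * (sat (x (0, 0) * Real.cos t) * Real.cos (freq j * t)) +
        b (j, 1) * (sat (x (0, 0) * Real.cos t) * Real.sin (freq j * t))) := by
    intro t
    have e' : rotatingField A b t x (j, 0) =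
        Real.cos (freq j * t) * A.mulVec (rot n t x) (j, 0) +
          Real.sin (freq j * t) * A.mulVec (rot n t x) (j, 1) +
        (b (j, 0) * (sat (x (0, 0) * Real.cos t) * Real.cos (freq j * t)) +
          b (j, 1) * (sat (x (0, 0) * Real.cos t) * Real.sin (freq j * t))) := by
      simp only [rotatingField, perturbation, rot_apply_zero, Pi.add_apply, Pi.smul_apply, hx,
        freq_zero, smul_eq_mul, mul_neg, Real.cos_neg, Real.sin_neg, mul_zero, sub_zero, one_mul]
      rw [mul_comm (Real.cos t)]
      ring
    rw [e', mulVec_pair, mulVec_pair, Finset.mul_sum, Finset.mul_sum, ← Finset.sum_add_distrib]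
    congr 1
    refine Finset.sum_congr rfl fun k _ => ?_
    rw [rot_apply_zero, rot_apply_one]
    ring
  simp_rw [e]
  rw [intervalIntegral.integral_add (Continuous.intervalIntegrable (by fun_prop) _ _)
    (Continuous.intervalIntegrable (by fun_prop) _ _),
    intervalIntegral.integral_finsetSum fun k _ => Continuous.intervalIntegrable (by fun_prop) _ _,
    intervalIntegral.integral_add (Continuous.intervalIntegrable (by fun_prop) _ _)
    (Continuous.intervalIntegrable (by fun_prop) _ _), intervalIntegral.integral_const_mul,
    intervalIntegral.integral_const_mul, integral_sat_mul_sin, ← satCoeff]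
  simp only [integral_trig_combination, Finset.sum_ite_eq, Finset.mem_univ, if_true, blockRe,
    blockIm]
  ring

theorem averagedField_one {x : Phase n} (hx : x (0, 1) = 0) (j : Fin n) :
    averagedField A b x (j, 1) = blockIm A j * x (j, 0) + blockRe A j * x (j, 1) +
      satCoeff j (x (0, 0)) * b (j, 1) := by
  have hs := continuous_sat
  rw [averagedField_apply]
  have e : ∀ t, rotatingField A b t x (j, 1) =
      (∑ k : Fin n,
        ((A (j, 1) (k, 0) * x (k, 0) + A (j, 1) (k, 1) * x (k, 1)) *
            (Real.cos (freq j * t) * Real.cos (freq k * t)) +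
          (-A (j, 0) (k, 1) * x (k, 0) + A (j, 0) (k, 0) * x (k, 1)) *
            (Real.sin (freq j * t) * Real.sin (freq k * t)) +
          (A (j, 1) (k, 1) * x (k, 0) - A (j, 1) (k, 0) * x (k, 1)) *
            (Real.cos (freq j * t) * Real.sin (freq k * t)) +
          (-A (j, 0) (k, 0) * x (k, 0) - A (j, 0) (k, 1) * x (k, 1)) *
            (Real.sin (freq j * t) * Real.cos (freq k * t)))) +
      (b (j, 1) * (sat (x (0, 0) * Real.cos t) * Real.cos (freq j * t)) +
        -b (j, 0) * (sat (x (0, 0) * Real.cos t) * Real.sin (freq j * t))) := by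
    intro t
    have e' : rotatingField A b t x (j, 1) =
        -Real.sin (freq j * t) * A.mulVec (rot n t x) (j, 0) +
          Real.cos (freq j * t) * A.mulVec (rot n t x) (j, 1) +
        (b (j, 1) * (sat (x (0, 0) * Real.cos t) * Real.cos (freq j * t)) +
          -b (j, 0) * (sat (x (0, 0) * Real.cos t) * Real.sin (freq j * t))) := by
      simp only [rotatingField, perturbation, rot_apply_zero, rot_apply_one, Pi.add_apply,
        Pi.smul_apply, hx, freq_zero, smul_eq_mul, mul_neg, Real.cos_neg, Real.sin_neg, mul_zero,
        sub_zero, one_mul]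
      rw [mul_comm (Real.cos t)]
      ring
    rw [e', mulVec_pair, mulVec_pair, Finset.mul_sum, Finset.mul_sum, ← Finset.sum_add_distrib]
    congr 1
    refine Finset.sum_congr rfl fun k _ => ?_
    rw [rot_apply_zero, rot_apply_one]
    ring
  simp_rw [e]
  rw [intervalIntegral.integral_add (Continuous.intervalIntegrable (by fun_prop) _ _)
    (Continuous.intervalIntegrable (by fun_prop) _ _),
    intervalIntegral.integral_finsetSum fun k _ => Continuous.intervalIntegrable (by fun_prop) _ _,
    intervalIntegral.integral_add (Continuous.intervalIntegrable (by fun_prop) _ _)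
    (Continuous.intervalIntegrable (by fun_prop) _ _), intervalIntegral.integral_const_mul,
    intervalIntegral.integral_const_mul, integral_sat_mul_sin, ← satCoeff]
  simp only [integral_trig_combination, Finset.sum_ite_eq, Finset.mem_univ, if_true, blockRe,
    blockIm]
  ring

/-! ### The averaged function in polar coordinates -/

theorem phase_eq (θ : ℝ) (p : Slow n) (j : Fin n) : phase θ p j = freq j * θ + phase 0 p j := by
  simp [phase]

@[simp] theorem phase_zero_zero (p : Slow n) : phase 0 p 0 = 0 := by
  simp [phase]

theorem phase_zero_of_ne (p : Slow n) {j : Fin n} (h : j ≠ 0) : phase 0 p j = p.2 ⟨j, h⟩ := by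
  simp [phase, h]

theorem polar_apply_zero (θ : ℝ) (p : Slow n) (j : Fin n) :
    polar θ p (j, 0) = p.1 j * Real.cos (phase θ p j) := rfl

theorem polar_apply_one (θ : ℝ) (p : Slow n) (j : Fin n) :
    polar θ p (j, 1) = p.1 j * Real.sin (phase θ p j) := rfl

theorem polar_eq_rot (θ : ℝ) (p : Slow n) : polar θ p = rot n θ (polar 0 p) := by
  apply phase_ext <;> intro j <;>
    simp only [rot_apply_zero, rot_apply_one, polar_apply_zero, polar_apply_one, phase_eq θ,
      Real.cos_add, Real.sin_add] <;> ring

theorem polar_zero_zero_zero (p : Slow n) : polar 0 p (0, 0) = p.1 0 := by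
  simp [polar_apply_zero]

theorem polar_zero_zero_one (p : Slow n) : polar 0 p (0, 1) = 0 := by
  simp [polar_apply_one]

theorem continuous_rotatingField_apply (x : Phase n) (q : Fin n × Fin 2) :
    Continuous fun t => rotatingField A b t x q :=
  (continuous_apply q).comp (continuous_rotatingField_comp A b continuous_id continuous_const)

/-- The radial component of the perturbation at time `t` is the component of the rotating field at
`polar 0 p` along the fixed direction of phase `phase 0 p j`; the average is thus read off from
`averagedField`. -/
theorem averaged_radial (p : Slow n) (j : Fin n) :
    (averaged A b p).1 j = blockRe A j * p.1 j + satCoeff j (p.1 0) *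
      (b (j, 0) * Real.cos (phase 0 p j) + b (j, 1) * Real.sin (phase 0 p j)) := by
  have e : ∀ t, radialH A b t p j = Real.cos (phase 0 p j) * rotatingField A b t (polar 0 p) (j, 0) +
      Real.sin (phase 0 p j) * rotatingField A b t (polar 0 p) (j, 1) := by
    intro t
    simp only [radialH, polar_eq_rot t, phase_eq t, rotatingField, rot_apply_zero, rot_apply_one,
      Real.cos_add, Real.sin_add, mul_neg, Real.cos_neg, Real.sin_neg]
    ring
  have hc := continuous_rotatingField_apply (A := A) (b := b) (polar 0 p)
  simp only [averaged, e]
  rw [intervalIntegral.integral_add (((hc _).const_mul _).intervalIntegrable _ _)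
    (((hc _).const_mul _).intervalIntegrable _ _), intervalIntegral.integral_const_mul,
    intervalIntegral.integral_const_mul, ← averagedField_apply, ← averagedField_apply,
    averagedField_zero (polar_zero_zero_one p), averagedField_one (polar_zero_zero_one p),
    polar_zero_zero_zero, polar_apply_zero, polar_apply_one]
  linear_combination (blockRe A j * p.1 j) * Real.sin_sq_add_cos_sq (phase 0 p j)

theorem integral_swirl {p : Slow n} {j : Fin n} (hp : p.1 j ≠ 0) :
    ∫ t in (0 : ℝ)..(2 * Real.pi), swirl A b t p j = blockIm A j + satCoeff j (p.1 0) *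
      (b (j, 1) * Real.cos (phase 0 p j) - b (j, 0) * Real.sin (phase 0 p j)) / p.1 j := by
  have e : ∀ t, swirl A b t p j =
      (Real.cos (phase 0 p j) / p.1 j) * rotatingField A b t (polar 0 p) (j, 1) -
      (Real.sin (phase 0 p j) / p.1 j) * rotatingField A b t (polar 0 p) (j, 0) := by
    intro t
    simp only [swirl, polar_eq_rot t, phase_eq t, rotatingField, rot_apply_zero, rot_apply_one,
      Real.cos_add, Real.sin_add, mul_neg, Real.cos_neg, Real.sin_neg]
    ring
  have hc := continuous_rotatingField_apply (A := A) (b := b) (polar 0 p)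
  simp only [e]
  rw [intervalIntegral.integral_sub (((hc _).const_mul _).intervalIntegrable _ _)
    (((hc _).const_mul _).intervalIntegrable _ _), intervalIntegral.integral_const_mul,
    intervalIntegral.integral_const_mul, ← averagedField_apply, ← averagedField_apply,
    averagedField_zero (polar_zero_zero_one p), averagedField_one (polar_zero_zero_one p),
    polar_zero_zero_zero, polar_apply_zero, polar_apply_one]
  field_simp
  linear_combination (blockIm A j * p.1 j) * Real.sin_sq_add_cos_sq (phase 0 p j)

theorem continuous_swirl (p : Slow n) (j : Fin n) : Continuous fun t => swirl A b t p j := by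
  have hp : Continuous fun t => perturbation A b (polar t p) := by
    refine (continuous_perturbation A b).comp ?_
    rw [show (fun t => polar t p) = fun t => rot n t (polar 0 p) from
      funext fun t => polar_eq_rot t p]
    exact continuous_rot_comp continuous_id continuous_const
  have hq : ∀ q, Continuous fun t => perturbation A b (polar t p) q :=
    fun q => (continuous_apply q).comp hp
  have hph : Continuous fun t => phase t p j := by
    rw [show (fun t => phase t p j) = fun t => freq j * t + phase 0 p j from
      funext fun t => phase_eq t p j]
    fun_prop
  unfold swirl
  have h₀ := hq (j, 0)
  have h₁ := hq (j, 1)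
  fun_prop

theorem averaged_angular {p : Slow n} (hp : p ∈ slowDomain n) (j : {j : Fin n // j ≠ 0}) :
    (averaged A b p).2 j = blockIm A j + satCoeff (j : Fin n) (p.1 0) *
      (b (j, 1) * Real.cos (phase 0 p j) - b (j, 0) * Real.sin (phase 0 p j)) / p.1 j -
      freq (j : Fin n) * (blockIm A 0 + satCoeff (0 : Fin n) (p.1 0) * b (0, 1) / p.1 0) := by
  have h₀ : ∀ j, p.1 j ≠ 0 := fun j => (hp j).ne'
  simp only [averaged, angularH]
  rw [intervalIntegral.integral_sub ((continuous_swirl p _).intervalIntegrable _ _)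
    (((continuous_swirl p _).const_mul _).intervalIntegrable _ _),
    intervalIntegral.integral_const_mul, integral_swirl (h₀ _), integral_swirl (h₀ _)]
  simp

end Average

end

section

variable {n : ℕ} [NeZero n] {A : Mat n} {b : Phase n}

/-! ### Zeros of the averaged function -/

/-- The averaged angular velocity of the `j`-th block relative to the frame that rotates with the
first block, when the amplitude of the first block is `r`. -/
def relativeIm (A : Mat n) (b : Phase n) (r : ℝ) (j : Fin n) : ℝ :=
  blockIm A j - freq j * (blockIm A 0 + satCoeff (0 : Fin n) r * b (0, 1) / r)

/-- The radial average and `r_j` times the angular average are the two Cartesian expressions turned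
by the phase of block `j`, so both pairs vanish together. -/
theorem averaged_eq_zero_iff {p : Slow n} (hp : p ∈ slowDomain n) :
    averaged A b p = 0 ↔ ∀ j,
      blockRe A j * polar 0 p (j, 0) - relativeIm A b (p.1 0) j * polar 0 p (j, 1) +
        satCoeff j (p.1 0) * b (j, 0) = 0 ∧
      relativeIm A b (p.1 0) j * polar 0 p (j, 0) + blockRe A j * polar 0 p (j, 1) +
        satCoeff j (p.1 0) * b (j, 1) = 0 := by
  have hne : ∀ j, p.1 j ≠ 0 := fun j => (hp j).ne'
  simp only [polar_apply_zero, polar_apply_one]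
  constructor
  · intro h j
    have h₁ : (averaged A b p).1 j = 0 := by rw [h]; rfl
    rw [averaged_radial] at h₁
    have h₂ : relativeIm A b (p.1 0) j * p.1 j + satCoeff j (p.1 0) *
        (b (j, 1) * Real.cos (phase 0 p j) - b (j, 0) * Real.sin (phase 0 p j)) = 0 := by
      -- The averaged function has no angular component for the first block; the corresponding
      -- equation holds identically because `relativeIm` refers to the frame turning with that
      -- block.
      rcases eq_or_ne j 0 with rfl | hj
      · rw [relativeIm, freq_zero, phase_zero_zero, Real.cos_zero, Real.sin_zero]
        have := hne 0
        field_simp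
        ring
      · have h₂ : (averaged A b p).2 ⟨j, hj⟩ = 0 := by rw [h]; rfl
        rw [averaged_angular hp] at h₂
        rw [relativeIm]
        have hj' := hne j
        have h₃ : (satCoeff j (p.1 0) *
          (b (j, 1) * Real.cos (phase 0 p j) - b (j, 0) * Real.sin (phase 0 p j)) / p.1 j) *
            p.1 j = satCoeff j (p.1 0) *
          (b (j, 1) * Real.cos (phase 0 p j) - b (j, 0) * Real.sin (phase 0 p j)) :=
          div_mul_cancel₀ _ hj'
        linear_combination p.1 j * h₂ - h₃
    have hcs := Real.sin_sq_add_cos_sq (phase 0 p j)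
    constructor
    · linear_combination Real.cos (phase 0 p j) * h₁ - Real.sin (phase 0 p j) * h₂ -
        satCoeff j (p.1 0) * b (j, 0) * hcs
    · linear_combination Real.sin (phase 0 p j) * h₁ + Real.cos (phase 0 p j) * h₂ -
        satCoeff j (p.1 0) * b (j, 1) * hcs
  · intro h
    refine Prod.ext (funext fun j => ?_) (funext fun j => ?_)
    · obtain ⟨h₁, h₂⟩ := h j
      rw [averaged_radial, Prod.fst_zero, Pi.zero_apply]
      linear_combination Real.cos (phase 0 p j) * h₁ + Real.sin (phase 0 p j) * h₂ -
        blockRe A j * p.1 j * Real.sin_sq_add_cos_sq (phase 0 p j)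
    · obtain ⟨h₁, h₂⟩ := h j
      rw [averaged_angular hp, Prod.snd_zero, Pi.zero_apply]
      have h₃ : relativeIm A b (p.1 0) (j : Fin n) * p.1 j + satCoeff (j : Fin n) (p.1 0) *
        (b (j, 1) * Real.cos (phase 0 p j) - b (j, 0) * Real.sin (phase 0 p j)) = 0 := by
        linear_combination Real.cos (phase 0 p j) * h₂ - Real.sin (phase 0 p j) * h₁ -
          relativeIm A b (p.1 0) (j : Fin n) * p.1 j * Real.sin_sq_add_cos_sq (phase 0 p j)
      rw [relativeIm] at h₃
      have h₄ : (satCoeff (j : Fin n) (p.1 0) *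
          (b (j, 1) * Real.cos (phase 0 p j) - b (j, 0) * Real.sin (phase 0 p j)) / p.1 j) *
            p.1 j = satCoeff (j : Fin n) (p.1 0) *
          (b (j, 1) * Real.cos (phase 0 p j) - b (j, 0) * Real.sin (phase 0 p j)) :=
        div_mul_cancel₀ _ (hne j)
      refine mul_right_cancel₀ (hne j) ?_
      linear_combination h₃ + h₄

/-- The averaged equations in the original coordinates: `σ` is the correction of order `ε` of the
period, up to sign and scale. -/
def AveragedEquation (A : Mat n) (b : Phase n) (σ : ℝ) (w : Phase n) : Prop :=
  averagedField A b w + (2 * Real.pi * σ) • centerMap n w = 0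

theorem AveragedEquation.components {σ : ℝ} {w : Phase n} (h : AveragedEquation A b σ w)
    (hw : w (0, 1) = 0) (j : Fin n) :
    blockRe A j * w (j, 0) - (blockIm A j + 2 * Real.pi * σ * freq j) * w (j, 1) +
        satCoeff j (w (0, 0)) * b (j, 0) = 0 ∧
      (blockIm A j + 2 * Real.pi * σ * freq j) * w (j, 0) + blockRe A j * w (j, 1) +
        satCoeff j (w (0, 0)) * b (j, 1) = 0 := by
  have h₀ := congrFun h (j, 0)
  have h₁ := congrFun h (j, 1)
  simp only [Pi.add_apply, Pi.smul_apply, centerMap_zero, centerMap_one, smul_eq_mul,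
    averagedField_zero hw, averagedField_one hw, Pi.zero_apply] at h₀ h₁
  constructor
  · linear_combination h₀
  · linear_combination h₁

theorem averagedEquation_of_components {σ : ℝ} {w : Phase n} (hw : w (0, 1) = 0)
    (h : ∀ j, blockRe A j * w (j, 0) - (blockIm A j + 2 * Real.pi * σ * freq j) * w (j, 1) +
        satCoeff j (w (0, 0)) * b (j, 0) = 0 ∧
      (blockIm A j + 2 * Real.pi * σ * freq j) * w (j, 0) + blockRe A j * w (j, 1) +
        satCoeff j (w (0, 0)) * b (j, 1) = 0) : AveragedEquation A b σ w := by
  apply phase_ext <;> intro j <;>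
    simp only [Pi.add_apply, Pi.smul_apply, centerMap_zero, centerMap_one, smul_eq_mul,
      averagedField_zero hw, averagedField_one hw, Pi.zero_apply]
  · linear_combination (h j).1
  · linear_combination (h j).2

/-- The averaged equations force the correction of the period. -/
theorem AveragedEquation.relativeIm_eq {σ : ℝ} {w : Phase n} (h : AveragedEquation A b σ w)
    (hw : w (0, 1) = 0) (hw' : w (0, 0) ≠ 0) (j : Fin n) :
    blockIm A j + 2 * Real.pi * σ * freq j = relativeIm A b (w (0, 0)) j := by
  have h₁ := (h.components hw 0).2
  rw [hw, freq_zero] at h₁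
  have h₂ : satCoeff (0 : Fin n) (w (0, 0)) * b (0, 1) / w (0, 0) * w (0, 0) =
    satCoeff (0 : Fin n) (w (0, 0)) * b (0, 1) := div_mul_cancel₀ _ hw'
  unfold relativeIm
  refine mul_right_cancel₀ hw' ?_
  linear_combination freq j * h₁ + freq j * h₂

theorem averaged_eq_zero_of_averagedEquation {p : Slow n} (hp : p ∈ slowDomain n) {σ : ℝ}
    (h : AveragedEquation A b σ (polar 0 p)) : averaged A b p = 0 := by
  have h₁ := polar_zero_zero_one p
  have h₀ := polar_zero_zero_zero p
  refine (averaged_eq_zero_iff hp).2 fun j => ?_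
  have := h.components h₁ j
  rw [h.relativeIm_eq h₁ (h₀ ▸ (hp 0).ne'), h₀] at this
  exact this

theorem exists_averagedEquation {p : Slow n} (hp : p ∈ slowDomain n)
    (h : averaged A b p = 0) : ∃ σ, AveragedEquation A b σ (polar 0 p) ∧
      ∀ j, blockIm A j + 2 * Real.pi * σ * freq j = relativeIm A b (p.1 0) j := by
  -- This value of `σ` cancels the averaged angular drift of the first block.
  have e : ∀ j, blockIm A j + 2 * Real.pi *
      (-(blockIm A 0 + satCoeff (0 : Fin n) (p.1 0) * b (0, 1) / p.1 0) / (2 * Real.pi)) * freq j =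
      relativeIm A b (p.1 0) j := by
    intro j
    rw [mul_div_cancel₀ _ Real.two_pi_pos.ne', relativeIm]
    ring
  refine ⟨-(blockIm A 0 + satCoeff (0 : Fin n) (p.1 0) * b (0, 1) / p.1 0) / (2 * Real.pi),
    averagedEquation_of_components (polar_zero_zero_one p) fun j => ?_, e⟩
  rw [polar_zero_zero_zero, e]
  exact (averaged_eq_zero_iff hp).1 h j

/-- A solution of the averaged equations at which their linearization is invertible. -/
structure IsNondegenerate (A : Mat n) (b : Phase n) (σ : ℝ) (w : Phase n) : Prop where
  one_lt : 1 < w (0, 0)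
  im_eq_zero : w (0, 1) = 0
  input_ne_zero : b (0, 0) ≠ 0
  eq : AveragedEquation A b σ w
  block_ne_zero : ∀ j ≠ 0, blockRe A j ≠ 0 ∨ blockIm A j + 2 * Real.pi * σ * freq j ≠ 0

/-- This is `(a + i e)(x + i y) = 0`; multiply by the conjugate of the first factor. -/
theorem eq_zero_of_complex_mul {a e x y : ℝ} (h : a ≠ 0 ∨ e ≠ 0) (h₁ : a * x - e * y = 0)
    (h₂ : e * x + a * y = 0) : x = 0 ∧ y = 0 := by
  have hpos : a ^ 2 + e ^ 2 ≠ 0 := by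
    rcases h with h | h <;> positivity
  constructor
  · refine (mul_eq_zero.1 (?_ : (a ^ 2 + e ^ 2) * x = 0)).resolve_left hpos
    linear_combination a * h₁ + e * h₂
  · refine (mul_eq_zero.1 (?_ : (a ^ 2 + e ^ 2) * y = 0)).resolve_left hpos
    linear_combination a * h₂ - e * h₁

/-- The real parts of the first-block equations say that `satCoeff 0 r / r` agrees at both
amplitudes. One amplitude exceeds `1`, hence so does the larger one, and strict decrease forces
equality. The imaginary parts then give `σ`, and the other blocks are linear equations with the same
right hand side and nonzero coefficient. -/
theorem IsNondegenerate.unique {σ σ' : ℝ} {w w' : Phase n} (h : IsNondegenerate A b σ w)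
    (h' : AveragedEquation A b σ' w') (hw₁ : w' (0, 1) = 0) (hw₀ : 0 < w' (0, 0)) :
    w' = w ∧ σ' = σ := by
  have hρ : 0 < w (0, 0) := one_pos.trans h.one_lt
  have e := (h.eq.components h.im_eq_zero 0)
  have e' := (h'.components hw₁ 0)
  rw [h.im_eq_zero] at e
  rw [hw₁] at e'
  have hr : w' (0, 0) = w (0, 0) := by
    have key : w' (0, 0) * satCoeff (0 : Fin n) (w (0, 0)) =
        w (0, 0) * satCoeff (0 : Fin n) (w' (0, 0)) := by
      refine mul_right_cancel₀ h.input_ne_zero ?_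
      linear_combination w' (0, 0) * e.1 - w (0, 0) * e'.1
    rcases lt_trichotomy (w' (0, 0)) (w (0, 0)) with hlt | heq | hlt
    · exact absurd key (satCoeff_zero_div_strictAnti hw₀ hlt h.one_lt).ne
    · exact heq
    · exact absurd key
        (satCoeff_zero_div_strictAnti hρ hlt (h.one_lt.trans hlt)).ne'
  have hσ : σ' = σ := by
    have h₁ := e.2
    have h₂ := e'.2
    rw [hr] at h₂
    rw [freq_zero] at h₁ h₂
    have : 2 * Real.pi * w (0, 0) ≠ 0 := (mul_pos Real.two_pi_pos hρ).ne'
    refine mul_left_cancel₀ this ?_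
    linear_combination h₂ - h₁
  refine ⟨?_, hσ⟩
  have hj : ∀ j, w' (j, 0) - w (j, 0) = 0 ∧ w' (j, 1) - w (j, 1) = 0 := by
    intro j
    rcases eq_or_ne j 0 with rfl | hj
    · exact ⟨sub_eq_zero.2 hr, by rw [hw₁, h.im_eq_zero, sub_zero]⟩
    obtain ⟨h₁, h₂⟩ := h.eq.components h.im_eq_zero j
    obtain ⟨h₁', h₂'⟩ := h'.components hw₁ j
    rw [hr, hσ] at h₁' h₂'
    exact eq_zero_of_complex_mul (h.block_ne_zero j hj) (by linear_combination h₁' - h₁)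
      (by linear_combination h₂' - h₂)
  exact phase_ext (fun j => sub_eq_zero.1 (hj j).1) fun j => sub_eq_zero.1 (hj j).2

/-! ### Isolated zeros are nondegenerate -/

theorem IsIsolatedZero.false_of_tendsto {p : Slow n} (h : IsIsolatedZero A b p) {l : Filter ℝ}
    [l.NeBot] {γ : ℝ → Slow n} (hγ : Tendsto γ l (𝓝 p))
    (hz : ∀ᶠ t in l, γ t ≠ p ∧ averaged A b (γ t) = 0) : False := by
  have : Tendsto γ l (𝓝[≠] p) :=
    tendsto_nhdsWithin_iff.2 ⟨hγ, hz.mono fun t ht => ht.1⟩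
  obtain ⟨t, h₁, h₂⟩ := ((this.eventually h.2).and hz).exists
  exact h₁ h₂.2

theorem tendsto_update_radius (p : Slow n) (j : Fin n) :
    Tendsto (fun t : ℝ => ((Function.update p.1 j t, p.2) : Slow n)) (𝓝 (p.1 j)) (𝓝 p) := by
  have : Continuous fun t : ℝ => ((Function.update p.1 j t, p.2) : Slow n) := by fun_prop
  simpa using this.tendsto (p.1 j)

theorem update_radius_ne {p : Slow n} {j : Fin n} {t : ℝ} (h : t ≠ p.1 j) :
    ((Function.update p.1 j t, p.2) : Slow n) ≠ p := fun e => by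
  have := congrFun (congrArg Prod.fst e) j
  simp only [Function.update_self] at this
  exact h this

theorem update_radius_mem {p : Slow n} (hp : p ∈ slowDomain n) {j : Fin n} {t : ℝ} (h : 0 < t) :
    ((Function.update p.1 j t, p.2) : Slow n) ∈ slowDomain n := fun k => by
  rcases eq_or_ne k j with rfl | hk
  · simpa using h
  · simpa [hk] using hp k

theorem polar_update_radius_zero (p : Slow n) (j : Fin n) (t : ℝ) (k : Fin n) :
    polar 0 (Function.update p.1 j t, p.2) (k, 0) =
      if k = j then t * Real.cos (phase 0 p j) else polar 0 p (k, 0) := by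
  rw [polar_apply_zero, polar_apply_zero]
  split_ifs with h
  · subst h; simp [phase]
  · simp [h, phase]

theorem polar_update_radius_one (p : Slow n) (j : Fin n) (t : ℝ) (k : Fin n) :
    polar 0 (Function.update p.1 j t, p.2) (k, 1) =
      if k = j then t * Real.sin (phase 0 p j) else polar 0 p (k, 1) := by
  rw [polar_apply_one, polar_apply_one]
  split_ifs with h
  · subst h; simp [phase]
  · simp [h, phase]

/-- If the complex coefficient of block `j` vanishes, the equations do not involve `r_j` at all, and
varying this radius gives a line of zeros. -/
theorem IsIsolatedZero.block_ne_zero {p : Slow n} (hp : p ∈ slowDomain n)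
    (h : IsIsolatedZero A b p) {j : Fin n} (hj : j ≠ 0) :
    blockRe A j ≠ 0 ∨ relativeIm A b (p.1 0) j ≠ 0 := by
  by_contra! hzero
  have hz := (averaged_eq_zero_iff hp).1 h.1
  refine h.false_of_tendsto (l := 𝓝[≠] (p.1 j))
    ((tendsto_update_radius p j).mono_left nhdsWithin_le_nhds) ?_
  filter_upwards [self_mem_nhdsWithin, (eventually_gt_nhds (hp j)).filter_mono nhdsWithin_le_nhds]
    with t ht ht0
  refine ⟨update_radius_ne ht, (averaged_eq_zero_iff (update_radius_mem hp ht0)).2 fun k => ?_⟩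
  have h0 : Function.update p.1 j t 0 = p.1 0 := by simp [hj.symm]
  simp only [polar_update_radius_zero, polar_update_radius_one, h0]
  have := hz k
  split_ifs with hk
  · subst hk
    simpa [hzero.1, hzero.2] using this
  · exact this

/-- Without saturation the first-block equations are homogeneous in its amplitude and the others do
not depend on it, so that amplitude may be varied. It is only decreased, since the given value may
be exactly `1`. -/
theorem IsIsolatedZero.one_lt {p : Slow n} (hp : p ∈ slowDomain n)
    (h : IsIsolatedZero A b p) : 1 < p.1 0 := by
  by_contra! hle
  have hz := (averaged_eq_zero_iff hp).1 h.1
  refine h.false_of_tendsto (l := 𝓝[<] (p.1 0))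
    ((tendsto_update_radius p 0).mono_left nhdsWithin_le_nhds) ?_
  filter_upwards [self_mem_nhdsWithin, (eventually_gt_nhds (hp 0)).filter_mono nhdsWithin_le_nhds]
    with t ht ht0
  have ht' : t < p.1 0 := ht
  refine ⟨update_radius_ne ht'.ne, (averaged_eq_zero_iff (update_radius_mem hp ht0)).2 fun k => ?_⟩
  have hrel : relativeIm A b t k = relativeIm A b (p.1 0) k := by
    have := (hp 0).ne'
    simp only [relativeIm, satCoeff_of_le_one (hp 0).le hle, if_true,
      satCoeff_of_le_one ht0.le (ht'.le.trans hle)]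
    field_simp
  have := hz k
  simp only [polar_update_radius_zero, polar_update_radius_one, Function.update_self, hrel,
    satCoeff_of_le_one (hp 0).le hle, satCoeff_of_le_one ht0.le (ht'.le.trans hle)] at this ⊢
  split_ifs at this ⊢ with hk
  · subst hk
    rw [polar_apply_zero, polar_apply_one] at this
    have hr := (hp 0).ne'
    constructor
    · refine (mul_eq_zero.1 (?_ : p.1 0 * _ = 0)).resolve_left hr
      linear_combination t * this.1
    · refine (mul_eq_zero.1 (?_ : p.1 0 * _ = 0)).resolve_left hr
      linear_combination t * this.2
  · exact this

/-- If `b (0, 0) = 0`, the first radial equation forces `blockRe A 0 = 0`, and then the first block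
is satisfied for every amplitude `t`. The other coefficients `D t j` stay invertible near `p.1 0`,
so solving the remaining blocks for `z t j` produces a curve of zeros through `p`. -/
theorem IsIsolatedZero.input_ne_zero {p : Slow n} (hp : p ∈ slowDomain n)
    (h : IsIsolatedZero A b p) : b (0, 0) ≠ 0 := by
  intro hb
  have hz := (averaged_eq_zero_iff hp).1 h.1
  have ha : blockRe A 0 = 0 := by
    have := (hz 0).1
    rw [polar_zero_zero_zero, polar_zero_zero_one, hb] at this
    simpa [(hp 0).ne'] using this
  let D : ℝ → Fin n → ℂ := fun t j => ⟨blockRe A j, relativeIm A b t j⟩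
  let z : ℝ → Fin n → ℂ := fun t j => -(satCoeff j t : ℂ) * ⟨b (j, 0), b (j, 1)⟩ / D t j
  have hrel : ∀ j, ContinuousAt (fun t => relativeIm A b t j) (p.1 0) := by
    intro j
    unfold relativeIm
    have := (continuous_satCoeff (0 : Fin n)).continuousAt (x := p.1 0)
    have h0 := (hp 0).ne'
    fun_prop (disch := exact h0)
  have hD : ∀ j, ContinuousAt (fun t => D t j) (p.1 0) := by
    intro j
    have : (fun t => D t j) =
        fun t => (blockRe A j : ℂ) + (relativeIm A b t j : ℂ) * Complex.I := by
      funext t; exact Complex.mk_eq_add_mul_I _ _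
    rw [this]
    exact continuousAt_const.add
      ((Complex.continuous_ofReal.continuousAt.comp (hrel j)).mul continuousAt_const)
  have hD0 : ∀ j, j ≠ 0 → D (p.1 0) j ≠ 0 := by
    intro j hj e
    rcases h.block_ne_zero hp hj with h' | h'
    · exact h' (congrArg Complex.re e)
    · exact h' (congrArg Complex.im e)
  have hzc : ∀ j, j ≠ 0 → ContinuousAt (fun t => z t j) (p.1 0) := by
    intro j hj
    refine ContinuousAt.div ?_ (hD j) (hD0 j hj)
    have := (continuous_satCoeff j).continuousAt (x := p.1 0)
    exact ((Complex.continuous_ofReal.continuousAt.comp this).neg).mul continuousAt_const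
  -- the point `p` is on the curve
  have hzp : ∀ j, j ≠ 0 → z (p.1 0) j =
      p.1 j * Complex.exp ((phase 0 p j : ℝ) * Complex.I) := by
    intro j hj
    rw [div_eq_iff (hD0 j hj), Complex.exp_mul_I, ← Complex.ofReal_cos, ← Complex.ofReal_sin]
    obtain ⟨h₁, h₂⟩ := hz j
    rw [polar_apply_zero, polar_apply_one] at h₁ h₂
    apply Complex.ext
    · simp [D, -Complex.ofReal_cos, -Complex.ofReal_sin]
      linear_combination -h₁
    · simp [D, -Complex.ofReal_cos, -Complex.ofReal_sin]
      linear_combination -h₂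
  have hzp0 : ∀ j, j ≠ 0 → z (p.1 0) j ≠ 0 := by
    intro j hj
    rw [hzp j hj]
    exact mul_ne_zero (by exact_mod_cast (hp j).ne') (Complex.exp_ne_zero _)
  -- The angles are lifts to the line: the increment is the argument of a quotient close to `1`,
  -- where the principal argument is continuous.
  let γ : ℝ → Slow n := fun t =>
    (fun j => if j = 0 then t else ‖z t j‖,
      fun j => p.2 j + Complex.arg (z t j / z (p.1 0) j))
  have hγ0 : γ (p.1 0) = p := by
    refine Prod.ext (funext fun j => ?_) (funext fun j => ?_)
    · simp only [γ]
      split_ifs with hj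
      · rw [hj]
      · rw [hzp j hj, norm_mul, Complex.norm_exp_ofReal_mul_I, mul_one, Complex.norm_real,
          Real.norm_of_nonneg (hp j).le]
    · simp only [γ]
      rw [div_self (hzp0 j j.2), Complex.arg_one, add_zero]
  have hγ : ContinuousAt γ (p.1 0) := by
    refine ContinuousAt.prodMk (continuousAt_pi.2 fun j => ?_) (continuousAt_pi.2 fun j => ?_)
    · split_ifs with hj
      · exact continuousAt_id
      · exact (hzc j hj).norm
    · refine continuousAt_const.add (ContinuousAt.comp (g := Complex.arg)
        (f := fun t => z t j / z (p.1 0) j) ?_ ((hzc j j.2).div_const _))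
      rw [div_self (hzp0 j j.2)]
      exact Complex.continuousAt_arg Complex.one_mem_slitPlane
  refine h.false_of_tendsto (l := 𝓝[≠] (p.1 0)) (γ := γ) ?_ ?_
  · have := hγ.tendsto
    rw [hγ0] at this
    exact this.mono_left nhdsWithin_le_nhds
  have hev : ∀ᶠ t in 𝓝 (p.1 0), ∀ j, j ≠ 0 → z t j ≠ 0 ∧ D t j ≠ 0 := by
    refine eventually_all.2 fun j => ?_
    rcases eq_or_ne j 0 with hj | hj
    · exact Eventually.of_forall fun t h => absurd hj h
    · filter_upwards [(hzc j hj).eventually_ne (hzp0 j hj), (hD j).eventually_ne (hD0 j hj)]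
        with t h₁ h₂ _ using ⟨h₁, h₂⟩
  filter_upwards [self_mem_nhdsWithin, hev.filter_mono nhdsWithin_le_nhds,
    (eventually_gt_nhds (hp 0)).filter_mono nhdsWithin_le_nhds] with t ht htz ht0
  have hγt : (γ t).1 0 = t := by simp [γ]
  refine ⟨fun e => ht ?_, ?_⟩
  · rw [← hγt, e]; rfl
  have hdom : γ t ∈ slowDomain n := by
    intro j
    simp only [γ]
    split_ifs with hj
    · exact ht0
    · exact norm_pos_iff.2 (htz j hj).1
  refine (averaged_eq_zero_iff hdom).2 fun j => ?_
  rw [hγt]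
  rcases eq_or_ne j 0 with rfl | hj
  · rw [polar_zero_zero_zero, polar_zero_zero_one, hγt, ha, hb, relativeIm, freq_zero]
    constructor
    · ring
    · have := ht0.ne'
      field_simp
      ring
  have hpol : (⟨polar 0 (γ t) (j, 0), polar 0 (γ t) (j, 1)⟩ : ℂ) = z t j := by
    have h₁ : (γ t).1 j = ‖z t j‖ := by simp [γ, hj]
    have h₂ : phase 0 (γ t) j = phase 0 p j + Complex.arg (z t j / z (p.1 0) j) := by
      rw [phase_zero_of_ne _ hj, phase_zero_of_ne _ hj]
    have e₁ : (⟨polar 0 (γ t) (j, 0), polar 0 (γ t) (j, 1)⟩ : ℂ) =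
        (‖z t j‖ : ℂ) * Complex.exp ((phase 0 (γ t) j : ℝ) * Complex.I) := by
      rw [Complex.exp_mul_I, ← Complex.ofReal_cos, ← Complex.ofReal_sin]
      apply Complex.ext <;> 
        simp [polar_apply_zero, polar_apply_one, h₁, -Complex.ofReal_cos, -Complex.ofReal_sin]
    have e₂ : (‖z t j‖ : ℂ) = p.1 j * ‖z t j / z (p.1 0) j‖ := by
      have hn : ‖z (p.1 0) j‖ = p.1 j := by
        rw [hzp j hj, norm_mul, Complex.norm_exp_ofReal_mul_I, mul_one, Complex.norm_real,
          Real.norm_of_nonneg (hp j).le]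
      rw [norm_div (z t j) (z (p.1 0) j), hn, Complex.ofReal_div, mul_div_cancel₀]
      exact_mod_cast (hp j).ne'
    rw [e₁, h₂, Complex.ofReal_add, add_mul, Complex.exp_add, e₂]
    calc _ = (p.1 j * Complex.exp ((phase 0 p j : ℝ) * Complex.I)) *
          ((‖z t j / z (p.1 0) j‖ : ℂ) *
            Complex.exp ((Complex.arg (z t j / z (p.1 0) j) : ℝ) * Complex.I)) := by ring
      _ = _ := by
        rw [Complex.norm_mul_exp_arg_mul_I, ← hzp j hj, mul_div_cancel₀ _ (hzp0 j hj)]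
  have hmul : z t j * D t j = -(satCoeff j t : ℂ) * ⟨b (j, 0), b (j, 1)⟩ :=
    div_mul_cancel₀ _ (htz j hj).2
  rw [← hpol] at hmul
  have h₁ := congrArg Complex.re hmul
  have h₂ := congrArg Complex.im hmul
  simp [D] at h₁ h₂
  constructor
  · linear_combination h₁
  · linear_combination h₂

theorem IsIsolatedZero.exists_isNondegenerate {p : Slow n} (hp : p ∈ slowDomain n)
    (h : IsIsolatedZero A b p) : ∃ σ, IsNondegenerate A b σ (polar 0 p) := by
  obtain ⟨σ, h₁, h₂⟩ := exists_averagedEquation hp h.1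
  exact ⟨σ, by simpa [polar_zero_zero_zero] using h.one_lt hp, polar_zero_zero_one p,
    h.input_ne_zero hp, h₁, fun j hj => by simpa [h₂] using h.block_ne_zero hp hj⟩

end

section

variable {n : ℕ}

/-! ### Curves over several periods and integral operators on them -/

/-- The multiple `m` of the period of the unperturbed flow. -/
def multiPeriod (m : ℕ) : ℝ := m * (2 * Real.pi)

theorem multiPeriod_nonneg (m : ℕ) : 0 ≤ multiPeriod m := by
  unfold multiPeriod; positivity

/-- Continuous curves defined over `m` periods. -/
abbrev Curves (m n : ℕ) : Type := C(Set.Icc (0 : ℝ) (multiPeriod m), Phase n)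

/-- Extension of a curve to the real line by constants. -/
def extendCurve {m : ℕ} (y : Curves m n) (t : ℝ) : Phase n :=
  y (Set.projIcc 0 (multiPeriod m) (multiPeriod_nonneg m) t)

theorem continuous_extendCurve {m : ℕ} (y : Curves m n) : Continuous (extendCurve y) :=
  y.continuous.comp continuous_projIcc

theorem norm_extendCurve_le {m : ℕ} (y : Curves m n) (t : ℝ) : ‖extendCurve y t‖ ≤ ‖y‖ :=
  y.norm_coe_le_norm _

theorem extendCurve_apply {m : ℕ} (y : Curves m n) (t : Set.Icc (0 : ℝ) (multiPeriod m)) :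
    extendCurve y t = y t := by
  simp [extendCurve]

theorem extendCurve_of_mem {m : ℕ} (y : Curves m n) {t : ℝ}
    (ht : t ∈ Set.Icc (0 : ℝ) (multiPeriod m)) : extendCurve y t = y ⟨t, ht⟩ :=
  extendCurve_apply y ⟨t, ht⟩

theorem intervalIntegrable_of_norm_le {E : Type*} [NormedAddCommGroup E] [MeasurableSpace E]
    [BorelSpace E] [SecondCountableTopology E] {f : ℝ → E} (hf : Measurable f) {C : ℝ}
    (hC : ∀ t, ‖f t‖ ≤ C) (s t : ℝ) : IntervalIntegrable f MeasureTheory.volume s t :=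
  (intervalIntegrable_const (c := C)).mono_fun' hf.aestronglyMeasurable
    (Eventually.of_forall hC)

/-- The primitive of a locally integrable function, as a continuous curve. -/
def primitiveCurve (m : ℕ) (f : ℝ → Phase n)
    (hf : ∀ s t, IntervalIntegrable f MeasureTheory.volume s t) : Curves m n :=
  ⟨fun t => ∫ s in (0 : ℝ)..t, f s,
    (intervalIntegral.continuous_primitive hf 0).comp continuous_subtype_val⟩

/-- A bounded measurable family of linear maps of the phase space. -/
structure LinearKernel (n : ℕ) where
  toFun : ℝ → Phase n → Phase n
  map_add : ∀ t x y, toFun t (x + y) = toFun t x + toFun t y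
  map_smul : ∀ t (c : ℝ) x, toFun t (c • x) = c • toFun t x
  measurable : ∀ y : ℝ → Phase n, Continuous y → Measurable fun t => toFun t (y t)
  bound : ℝ
  bound_nonneg : 0 ≤ bound
  norm_le : ∀ t x, ‖toFun t x‖ ≤ bound * ‖x‖

theorem LinearKernel.intervalIntegrable (K : LinearKernel n) {m : ℕ} (y : Curves m n) (s t : ℝ) :
    IntervalIntegrable (fun t => K.toFun t (extendCurve y t)) MeasureTheory.volume s t :=
  intervalIntegrable_of_norm_le (K.measurable _ (continuous_extendCurve y))
    (fun t => (K.norm_le t _).trans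
      (mul_le_mul_of_nonneg_left (norm_extendCurve_le y t) K.bound_nonneg)) s t

/-- The integral operator with a given kernel. -/
def LinearKernel.integralOperator (K : LinearKernel n) (m : ℕ) : Curves m n →L[ℝ] Curves m n :=
  LinearMap.mkContinuous
    { toFun := fun y => primitiveCurve m (fun t => K.toFun t (extendCurve y t))
        (K.intervalIntegrable y)
      map_add' := fun y z => by
        ext1 t
        simp only [primitiveCurve, ContinuousMap.coe_mk, ContinuousMap.add_apply]
        rw [← intervalIntegral.integral_add (K.intervalIntegrable y _ _)
          (K.intervalIntegrable z _ _)]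
        refine intervalIntegral.integral_congr fun s _ => ?_
        exact K.map_add s (extendCurve y s) (extendCurve z s)
      map_smul' := fun c y => by
        ext1 t
        simp only [primitiveCurve, ContinuousMap.coe_mk, ContinuousMap.smul_apply,
          RingHom.id_apply]
        rw [← intervalIntegral.integral_smul]
        refine intervalIntegral.integral_congr fun s _ => ?_
        exact K.map_smul s c (extendCurve y s) }
    (K.bound * multiPeriod m) fun y => by
      have h0 := K.bound_nonneg
      have h1 := multiPeriod_nonneg m
      refine (ContinuousMap.norm_le _ (by positivity)).2 fun t => ?_
      have ht := t.2
      refine (intervalIntegral.norm_integral_le_of_norm_le_const (C := K.bound * ‖y‖)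
        fun s _ => (K.norm_le s _).trans
          (mul_le_mul_of_nonneg_left (norm_extendCurve_le y s) h0)).trans ?_
      rw [sub_zero, abs_of_nonneg ht.1]
      calc K.bound * ‖y‖ * t ≤ K.bound * ‖y‖ * multiPeriod m := by
            gcongr
            exact ht.2
        _ = _ := by ring

theorem LinearKernel.integralOperator_apply (K : LinearKernel n) {m : ℕ} (y : Curves m n)
    (t : Set.Icc (0 : ℝ) (multiPeriod m)) :
    K.integralOperator m y t = ∫ s in (0 : ℝ)..t, K.toFun s (extendCurve y s) := rfl

/-- The kernel given by the unperturbed linear vector field. -/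
def centerKernel (n : ℕ) : LinearKernel n where
  toFun _ x := centerMap n x
  map_add _ := map_add _
  map_smul _ := map_smul _
  measurable _ hy := ((centerMap n).continuous.comp hy).measurable
  bound := ‖centerMap n‖
  bound_nonneg := norm_nonneg _
  norm_le _ := (centerMap n).le_opNorm

/-! ### The slope of the saturation and the time spent near switching. -/

/-- The derivative of the saturation function along `t ↦ ρ cos t`. -/
def satSlope (ρ t : ℝ) : ℝ := if |ρ * Real.cos t| < 1 then 1 else 0

theorem measurable_satSlope (ρ : ℝ) : Measurable (satSlope ρ) := by
  refine Measurable.ite ?_ measurable_const measurable_const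
  exact measurableSet_lt (by fun_prop) measurable_const

theorem satSlope_nonneg (ρ t : ℝ) : 0 ≤ satSlope ρ t := by
  unfold satSlope; split_ifs <;> norm_num

theorem satSlope_le_one (ρ t : ℝ) : satSlope ρ t ≤ 1 := by
  unfold satSlope; split_ifs <;> norm_num

theorem satSlope_add_period (ρ t : ℝ) (m : ℕ) :
    satSlope ρ (t + m * (2 * Real.pi)) = satSlope ρ t := by
  unfold satSlope
  rw [Real.cos_add_nat_mul_two_pi]

theorem countable_cos_eq (c : ℝ) : {t : ℝ | Real.cos t = c}.Countable := by
  rcases Set.eq_empty_or_nonempty {t : ℝ | Real.cos t = c} with h | ⟨s, hs⟩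
  · rw [h]; exact Set.countable_empty
  refine ((Set.countable_range fun k : ℤ => 2 * (k : ℝ) * Real.pi + s).union
    (Set.countable_range fun k : ℤ => 2 * (k : ℝ) * Real.pi - s)).mono fun t ht => ?_
  have ht' : Real.cos s = Real.cos t := by
    rw [show Real.cos s = c from hs, show Real.cos t = c from ht]
  obtain ⟨k, hk | hk⟩ := Real.cos_eq_cos_iff.1 ht'
  · exact Or.inl ⟨k, hk.symm⟩
  · exact Or.inr ⟨k, hk.symm⟩

/-- The exact switching times are solutions of two equations `cos t = c`, hence countable; for `ρ =
0` there are none. -/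
theorem ae_abs_mul_cos_ne_one (ρ : ℝ) : ∀ᵐ t, |ρ * Real.cos t| ≠ 1 := by
  have hs : {t : ℝ | ¬ |ρ * Real.cos t| ≠ 1} ⊆
      {t | Real.cos t = 1 / ρ} ∪ {t | Real.cos t = -1 / ρ} := by
    intro t ht
    have ht' : |ρ * Real.cos t| = 1 := not_not.1 ht
    have hρ : ρ ≠ 0 := by rintro rfl; simp at ht'
    rcases eq_or_eq_neg_of_abs_eq ht' with h | h
    · exact Or.inl ((eq_div_iff hρ).2 (by rw [mul_comm]; exact h))
    · exact Or.inr ((eq_div_iff hρ).2 (by rw [mul_comm]; exact h))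
  exact (((countable_cos_eq _).union (countable_cos_eq _)).mono hs).measure_zero _

/-- The indicator function of the times at which `ρ cos t` is close to a switching value. -/
def nearSwitch (ρ δ t : ℝ) : ℝ := if |(|ρ * Real.cos t| - 1)| ≤ δ then 1 else 0

theorem measurable_nearSwitch (ρ δ : ℝ) : Measurable (nearSwitch ρ δ) := by
  refine Measurable.ite ?_ measurable_const measurable_const
  exact measurableSet_le (by fun_prop) measurable_const

theorem nearSwitch_nonneg (ρ δ t : ℝ) : 0 ≤ nearSwitch ρ δ t := by
  unfold nearSwitch; split_ifs <;> norm_num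

theorem nearSwitch_le_one (ρ δ t : ℝ) : nearSwitch ρ δ t ≤ 1 := by
  unfold nearSwitch; split_ifs <;> norm_num

theorem intervalIntegrable_nearSwitch (ρ δ s t : ℝ) :
    IntervalIntegrable (nearSwitch ρ δ) MeasureTheory.volume s t :=
  intervalIntegrable_of_norm_le (measurable_nearSwitch ρ δ) (C := 1)
    (fun t => by
      rw [Real.norm_of_nonneg (nearSwitch_nonneg _ _ _)]; exact nearSwitch_le_one _ _ _) s t

/-- Dominated convergence: off the exact switching times the indicator vanishes once `δ` is small.
-/
theorem tendsto_integral_nearSwitch (ρ L : ℝ) :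
    Tendsto (fun δ => ∫ t in (0 : ℝ)..L, nearSwitch ρ δ t) (𝓝[>] 0) (𝓝 0) := by
  have := intervalIntegral.tendsto_integral_filter_of_dominated_convergence
    (μ := MeasureTheory.volume) (a := 0) (b := L) (l := 𝓝[>] (0 : ℝ))
    (F := fun δ t => nearSwitch ρ δ t) (f := fun _ => (0 : ℝ)) (fun _ => 1)
    (Eventually.of_forall fun δ => (measurable_nearSwitch ρ δ).aestronglyMeasurable)
    (Eventually.of_forall fun δ => Eventually.of_forall fun t _ => by
      rw [Real.norm_of_nonneg (nearSwitch_nonneg _ _ _)]; exact nearSwitch_le_one _ _ _)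
    intervalIntegrable_const ?_
  · simpa using this
  · filter_upwards [ae_abs_mul_cos_ne_one ρ] with t ht _
    refine tendsto_const_nhds.congr' ?_
    have hpos : 0 < |(|ρ * Real.cos t| - 1)| := abs_pos.2 (sub_ne_zero.2 ht)
    filter_upwards [(eventually_lt_nhds hpos).filter_mono nhdsWithin_le_nhds] with δ hδ
    rw [nearSwitch, if_neg (not_le.2 hδ)]

/-- If `ρ cos t` is farther than `δ` from the switching values, `u` and `v` lie in the same affine
piece and the linearization is exact. Otherwise monotonicity and the Lipschitz constant `1` bound
the error by `|u - v|`, whichever slope `0` or `1` is used. -/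
theorem abs_sat_sub_sub_satSlope_le {ρ t δ u v : ℝ} (hu : |u - ρ * Real.cos t| ≤ δ)
    (hv : |v - ρ * Real.cos t| ≤ δ) :
    |sat u - sat v - satSlope ρ t * (u - v)| ≤ nearSwitch ρ δ t * |u - v| := by
  unfold nearSwitch satSlope
  rw [abs_le] at hu hv
  set c := ρ * Real.cos t
  by_cases hn : |(|c| - 1)| ≤ δ
  · rw [if_pos hn, one_mul]
    have h₁ := abs_sat_sub_sat_le u v
    have h₂ : 0 ≤ (sat u - sat v) * (u - v) := by
      rcases le_total u v with h | h
      · exact mul_nonneg_of_nonpos_of_nonpos (sub_nonpos.2 (monotone_sat h)) (sub_nonpos.2 h)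
      · exact mul_nonneg (sub_nonneg.2 (monotone_sat h)) (sub_nonneg.2 h)
    split_ifs
    · rw [one_mul]
      rcases le_total u v with h | h
      · have h₃ := monotone_sat h
        rw [abs_of_nonpos (sub_nonpos.2 h), abs_of_nonpos (sub_nonpos.2 h₃)] at h₁
        rw [abs_of_nonpos (sub_nonpos.2 h), abs_le]
        constructor <;> linarith
      · have h₃ := monotone_sat h
        rw [abs_of_nonneg (sub_nonneg.2 h), abs_of_nonneg (sub_nonneg.2 h₃)] at h₁
        rw [abs_of_nonneg (sub_nonneg.2 h), abs_le]
        constructor <;> linarith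
    · rw [zero_mul, sub_zero]; exact h₁
  · rw [if_neg hn, zero_mul]
    push Not at hn
    split_ifs with hc
    · rw [abs_of_neg (by linarith)] at hn
      have := abs_le.1 (le_refl |c|)
      rw [sat_of_abs_le (abs_le.2 ⟨by linarith, by linarith⟩),
        sat_of_abs_le (abs_le.2 ⟨by linarith, by linarith⟩)]
      simp
    · rw [abs_of_nonneg (by linarith)] at hn
      rcases le_total 0 c with h0 | h0
      · rw [abs_of_nonneg h0] at hn
        rw [sat_of_one_le (by linarith), sat_of_one_le (by linarith)]
        simp
      · rw [abs_of_nonpos h0] at hn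
        rw [sat_of_le_neg_one (by linarith), sat_of_le_neg_one (by linarith)]
        simp

/-! ### Strict differentiability of the perturbation operator. -/

section Kernel

variable [NeZero n] (A : Mat n) (b : Phase n)

/-- The linearization of the perturbation, in rotating coordinates, along a solution of the
unperturbed system whose first coordinate is `ρ cos t`. -/
def linearizedField (ρ t : ℝ) (x : Phase n) : Phase n :=
  rot n (-t) (A.mulVec (rot n t x)) + (satSlope ρ t * rot n t x (0, 0)) • rot n (-t) b

theorem linearizedField_add_period (ρ t : ℝ) (m : ℕ) (x : Phase n) :
    linearizedField A b ρ (t + m * (2 * Real.pi)) x = linearizedField A b ρ t x := by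
  unfold linearizedField
  rw [rot_add_period, rot_neg_add_period, rot_neg_add_period, satSlope_add_period]

omit [NeZero n] in
theorem abs_rot_apply_le (t : ℝ) (x : Phase n) (q : Fin n × Fin 2) : |rot n t x q| ≤ 2 * ‖x‖ :=
  (norm_le_pi_norm (rot n t x) q).trans (norm_rot_apply_le t x)

theorem measurable_linearizedField (ρ : ℝ) {y : ℝ → Phase n} (hy : Continuous y) :
    Measurable fun t => linearizedField A b ρ t (y t) := by
  have hA : Continuous fun x : Phase n => A.mulVec x :=
    A.mulVecLin.toContinuousLinearMap.continuous
  have h₁ : Continuous fun t => rot n (-t) (A.mulVec (rot n t (y t))) :=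
    continuous_rot_comp continuous_neg (hA.comp (continuous_rot_comp continuous_id hy))
  have h₂ : Continuous fun t => rot n t (y t) (0, 0) :=
    (continuous_apply _).comp (continuous_rot_comp continuous_id hy)
  have h₃ : Continuous fun t : ℝ => rot n (-t) b :=
    continuous_rot_comp continuous_neg continuous_const
  exact h₁.measurable.add (((measurable_satSlope ρ).mul h₂.measurable).smul h₃.measurable)

/-- The kernel given by the linearization of the perturbation. -/
def linearizedKernel (ρ : ℝ) : LinearKernel n where
  toFun := linearizedField A b ρ
  map_add t x y := by
    simp only [linearizedField, map_add, Matrix.mulVec_add, Pi.add_apply, mul_add, add_smul]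
    abel
  map_smul t c x := by
    simp only [linearizedField, map_smul, Matrix.mulVec_smul, Pi.smul_apply, smul_eq_mul, smul_add,
      smul_smul]
    ring_nf
  measurable y hy := measurable_linearizedField A b ρ hy
  bound := 4 * ‖A.mulVecLin.toContinuousLinearMap‖ + 4 * ‖b‖
  bound_nonneg := by positivity
  norm_le t x := by
    have h₁ : ‖rot n (-t) (A.mulVec (rot n t x))‖ ≤
        2 * (‖A.mulVecLin.toContinuousLinearMap‖ * (2 * ‖x‖)) := by
      refine (norm_rot_apply_le _ _).trans ?_
      gcongr
      exact (A.mulVecLin.toContinuousLinearMap.le_opNorm (rot n t x)).trans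
        (mul_le_mul_of_nonneg_left (norm_rot_apply_le t x) (norm_nonneg _))
    have h₂ : ‖(satSlope ρ t * rot n t x (0, 0)) • rot n (-t) b‖ ≤ (1 * (2 * ‖x‖)) * (2 * ‖b‖) := by
      rw [norm_smul, norm_mul, Real.norm_of_nonneg (satSlope_nonneg ρ t)]
      gcongr
      · exact satSlope_le_one ρ t
      · exact abs_rot_apply_le t x (0, 0)
      · exact norm_rot_apply_le _ _
    calc _ ≤ _ := norm_add_le _ _
      _ ≤ 2 * (‖A.mulVecLin.toContinuousLinearMap‖ * (2 * ‖x‖)) + (1 * (2 * ‖x‖)) * (2 * ‖b‖) :=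
        add_le_add h₁ h₂
      _ = _ := by ring

theorem continuous_rotatingField_curve {m : ℕ} (y : Curves m n) :
    Continuous fun t => rotatingField A b t (extendCurve y t) :=
  continuous_rotatingField_comp A b continuous_id (continuous_extendCurve y)

/-- The nonlinear integral operator given by the perturbation in rotating coordinates. -/
def perturbationOperator (m : ℕ) (y : Curves m n) : Curves m n :=
  primitiveCurve m (fun t => rotatingField A b t (extendCurve y t))
    fun _ _ => (continuous_rotatingField_curve A b y).intervalIntegrable _ _

theorem perturbationOperator_apply {m : ℕ} (y : Curves m n)
    (t : Set.Icc (0 : ℝ) (multiPeriod m)) :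
    perturbationOperator A b m y t = ∫ s in (0 : ℝ)..t, rotatingField A b s (extendCurve y s) := rfl

/-- The matrix part cancels exactly and leaves the scalar error of the saturation times the rotated
`b`. -/
theorem norm_rotatingField_sub_sub_le {ρ δ t : ℝ} {w x y : Phase n} (hw₁ : w (0, 1) = 0)
    (hw₀ : w (0, 0) = ρ) (hx : ‖x - w‖ ≤ δ) (hy : ‖y - w‖ ≤ δ) :
    ‖rotatingField A b t x - rotatingField A b t y - linearizedField A b ρ t (x - y)‖ ≤
      nearSwitch ρ (2 * δ) t * (4 * ‖b‖ * ‖x - y‖) := by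
  have hrot : rot n t w (0, 0) = ρ * Real.cos t := by
    rw [rot_apply_zero, hw₁, hw₀, freq_zero]; ring_nf
  have hclose : ∀ z, ‖z - w‖ ≤ δ → |rot n t z (0, 0) - ρ * Real.cos t| ≤ 2 * δ := by
    intro z hz
    rw [← hrot, ← Pi.sub_apply, ← map_sub]
    exact (abs_rot_apply_le t _ _).trans (by linarith)
  have e : rotatingField A b t x - rotatingField A b t y - linearizedField A b ρ t (x - y) =
      (sat (rot n t x (0, 0)) - sat (rot n t y (0, 0)) -
        satSlope ρ t * (rot n t x (0, 0) - rot n t y (0, 0))) • rot n (-t) b := by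
    simp only [rotatingField, linearizedField, perturbation, map_add, map_sub, map_smul,
      Matrix.mulVec_sub, Pi.sub_apply, sub_smul]
    abel
  rw [e, norm_smul, Real.norm_eq_abs]
  have h₁ := abs_sat_sub_sub_satSlope_le (hclose x hx) (hclose y hy)
  have h₂ : |rot n t x (0, 0) - rot n t y (0, 0)| ≤ 2 * ‖x - y‖ := by
    rw [← Pi.sub_apply, ← map_sub]
    exact abs_rot_apply_le t _ _
  have h₃ := nearSwitch_nonneg ρ (2 * δ) t
  calc _ ≤ (nearSwitch ρ (2 * δ) t * (2 * ‖x - y‖)) * (2 * ‖b‖) := by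
        gcongr
        · exact h₁.trans (by gcongr)
        · exact norm_rot_apply_le _ _
    _ = _ := by ring

/-- Near a switching time the pointwise error is comparable to the increment, but its time integral
is at most the increment times the duration of such moments, which shrinks with the neighbourhood of
the constant curve. -/
theorem hasStrictFDerivAt_perturbationOperator (m : ℕ) {w : Phase n} (hw₁ : w (0, 1) = 0) :
    HasStrictFDerivAt (perturbationOperator A b m)
      ((linearizedKernel A b (w (0, 0))).integralOperator m)
      (ContinuousMap.const _ w) := by
  refine .of_isLittleO (Asymptotics.isLittleO_iff.2 fun c hc => ?_)
  set ρ := w (0, 0)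
  have hlim : Tendsto (fun δ => (∫ t in (0 : ℝ)..multiPeriod m, nearSwitch ρ δ t) * (4 * ‖b‖))
      (𝓝[>] 0) (𝓝 0) := by
    simpa using (tendsto_integral_nearSwitch ρ (multiPeriod m)).mul_const (4 * ‖b‖)
  -- The balls below have radius `δ / 2` because rotation may double a distance.
  obtain ⟨δ, hδc, hδ⟩ := ((hlim.eventually (eventually_le_nhds hc)).and self_mem_nhdsWithin).exists
  have hδ' : (0 : ℝ) < δ / 2 := half_pos hδ
  have hball : Metric.ball (ContinuousMap.const (Set.Icc (0 : ℝ) (multiPeriod m)) w) (δ / 2) ×ˢ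
      Metric.ball (ContinuousMap.const (Set.Icc (0 : ℝ) (multiPeriod m)) w) (δ / 2) ∈
      𝓝 (ContinuousMap.const (Set.Icc (0 : ℝ) (multiPeriod m)) w,
        ContinuousMap.const (Set.Icc (0 : ℝ) (multiPeriod m)) w) :=
    prod_mem_nhds (Metric.ball_mem_nhds _ hδ') (Metric.ball_mem_nhds _ hδ')
  filter_upwards [hball] with ⟨x, y⟩ ⟨hx, hy⟩
  have hclose : ∀ z : Curves m n, z ∈ Metric.ball (ContinuousMap.const _ w) (δ / 2) →
      ∀ t, ‖extendCurve z t - w‖ ≤ δ / 2 := by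
    intro z hz t
    rw [Metric.mem_ball, dist_eq_norm] at hz
    exact ((z - ContinuousMap.const _ w).norm_coe_le_norm
      (Set.projIcc 0 (multiPeriod m) (multiPeriod_nonneg m) t)).trans hz.le
  refine (ContinuousMap.norm_le _ (by positivity)).2 fun t => ?_
  simp only [ContinuousMap.sub_apply, perturbationOperator_apply,
    LinearKernel.integralOperator_apply]
  have hix := (continuous_rotatingField_curve A b x).intervalIntegrable
    (μ := MeasureTheory.volume) 0 t
  have hiy := (continuous_rotatingField_curve A b y).intervalIntegrable
    (μ := MeasureTheory.volume) 0 t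
  rw [← intervalIntegral.integral_sub hix hiy, ← intervalIntegral.integral_sub (hix.sub hiy)
    ((linearizedKernel A b ρ).intervalIntegrable _ _ _)]
  have hpt : ∀ s, ‖rotatingField A b s (extendCurve x s) - rotatingField A b s (extendCurve y s) -
      linearizedField A b ρ s (extendCurve (x - y) s)‖ ≤
      nearSwitch ρ δ s * (4 * ‖b‖ * ‖x - y‖) := by
    intro s
    have := norm_rotatingField_sub_sub_le A b (t := s) hw₁ rfl (hclose x hx s) (hclose y hy s)
    rw [mul_div_cancel₀ δ two_ne_zero] at this
    refine this.trans ?_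
    have h₁ := nearSwitch_nonneg ρ δ s
    gcongr
    exact norm_extendCurve_le (x - y) s
  refine (intervalIntegral.norm_integral_le_of_norm_le t.2.1 (Eventually.of_forall fun s _ => hpt s)
    ((intervalIntegrable_nearSwitch ρ δ _ _).mul_const _)).trans ?_
  rw [intervalIntegral.integral_mul_const]
  have hmono : ∫ s in (0 : ℝ)..t, nearSwitch ρ δ s ≤
      ∫ s in (0 : ℝ)..multiPeriod m, nearSwitch ρ δ s :=
    intervalIntegral.integral_mono_interval le_rfl t.2.1 t.2.2
      (Eventually.of_forall fun s => nearSwitch_nonneg ρ δ s) (intervalIntegrable_nearSwitch _ _ _ _)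
  calc _ ≤ (∫ s in (0 : ℝ)..multiPeriod m, nearSwitch ρ δ s) * (4 * ‖b‖ * ‖x - y‖) := by gcongr
    _ = (∫ s in (0 : ℝ)..multiPeriod m, nearSwitch ρ δ s) * (4 * ‖b‖) * ‖x - y‖ := by ring
    _ ≤ c * ‖x - y‖ := by gcongr

end Kernel

end

section

variable {n : ℕ} [NeZero n]

/-! ### The linearization of the averaged equations -/

/-- Odd under `t ↦ 2π - t`, which leaves `satSlope` unchanged. -/
theorem integral_satSlope_mul_cos_mul_sin (ρ : ℝ) :
    ∫ t in (0 : ℝ)..(2 * Real.pi), satSlope ρ t * (Real.cos t * Real.sin t) = 0 := by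
  have h := intervalIntegral.integral_comp_sub_left
    (fun t => satSlope ρ t * (Real.cos t * Real.sin t)) (a := 0) (b := 2 * Real.pi)
    (2 * Real.pi)
  have e : ∀ t, satSlope ρ (2 * Real.pi - t) *
      (Real.cos (2 * Real.pi - t) * Real.sin (2 * Real.pi - t)) =
      -(satSlope ρ t * (Real.cos t * Real.sin t)) := by
    intro t
    rw [satSlope, satSlope, Real.cos_two_pi_sub, Real.sin_two_pi_sub]
    ring
  simp only [e, intervalIntegral.integral_neg, sub_self, sub_zero] at h
  linarith

theorem intervalIntegrable_satSlope_mul (ρ : ℝ) {f : ℝ → ℝ} (hf : Continuous f) {C : ℝ}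
    (hC : ∀ t, |f t| ≤ C) (s t : ℝ) :
    IntervalIntegrable (fun t => satSlope ρ t * f t) MeasureTheory.volume s t := by
  refine intervalIntegrable_of_norm_le ((measurable_satSlope ρ).mul hf.measurable) (C := C)
    (fun t => ?_) s t
  change ‖satSlope ρ t * f t‖ ≤ C
  rw [norm_mul, Real.norm_of_nonneg (satSlope_nonneg ρ t)]
  exact (mul_le_of_le_one_left (norm_nonneg _) (satSlope_le_one ρ t)).trans (hC t)

theorem abs_cos_mul_cos_le (s t : ℝ) : |Real.cos s * Real.cos t| ≤ 1 := by
  rw [abs_mul]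
  exact mul_le_one₀ (Real.abs_cos_le_one s) (abs_nonneg _) (Real.abs_cos_le_one t)

theorem abs_cos_mul_sin_le (s t : ℝ) : |Real.cos s * Real.sin t| ≤ 1 := by
  rw [abs_mul]
  exact mul_le_one₀ (Real.abs_cos_le_one s) (abs_nonneg _) (Real.abs_sin_le_one t)

/-- The first Fourier coefficient of the saturated oscillation and its derivative with respect to
the amplitude. -/
theorem mul_integral_satSlope_lt_satCoeff {ρ : ℝ} (hρ : 1 < ρ) :
    ρ * ∫ t in (0 : ℝ)..(2 * Real.pi), satSlope ρ t * (Real.cos t * Real.cos t) <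
      satCoeff (0 : Fin n) ρ := by
  have hρ0 : 0 < ρ := one_pos.trans hρ
  have hs := continuous_sat
  -- The difference of the integrands is `0` at unsaturated times and `|cos t|` at saturated ones.
  -- It is discontinuous, so strict positivity is obtained from this continuous minorant.
  have hpos : 0 < ∫ t in (0 : ℝ)..(2 * Real.pi), max 0 (|Real.cos t| - 1 / ρ) := by
    refine intervalIntegral.integral_pos Real.two_pi_pos (by fun_prop)
      (fun t _ => le_max_left _ _) ⟨0, by simp [Real.pi_pos.le], ?_⟩
    rw [Real.cos_zero, abs_one]
    refine lt_max_of_lt_right (sub_pos.2 ?_)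
    rw [div_lt_one hρ0]; exact hρ
  have hi₁ : IntervalIntegrable (fun t => sat (ρ * Real.cos t) * Real.cos (freq (0 : Fin n) * t))
      MeasureTheory.volume 0 (2 * Real.pi) := Continuous.intervalIntegrable (by fun_prop) _ _
  have hi₂ : IntervalIntegrable (fun t => ρ * (satSlope ρ t * (Real.cos t * Real.cos t)))
      MeasureTheory.volume 0 (2 * Real.pi) :=
    (intervalIntegrable_satSlope_mul ρ (by fun_prop) (fun t => abs_cos_mul_cos_le t t) _ _).const_mul
      ρ
  have hle : ∫ t in (0 : ℝ)..(2 * Real.pi), max 0 (|Real.cos t| - 1 / ρ) ≤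
      ∫ t in (0 : ℝ)..(2 * Real.pi), (sat (ρ * Real.cos t) * Real.cos (freq (0 : Fin n) * t) -
        ρ * (satSlope ρ t * (Real.cos t * Real.cos t))) := by
    refine intervalIntegral.integral_mono Real.two_pi_pos.le
      (Continuous.intervalIntegrable (by fun_prop) _ _) (hi₁.sub hi₂) fun t => ?_
    simp only [freq_zero, one_mul]
    have hinv : 0 < 1 / ρ := by positivity
    unfold satSlope
    split_ifs with h
    · rw [sat_of_abs_le h.le]
      rw [abs_mul, abs_of_pos hρ0] at h
      have : |Real.cos t| < 1 / ρ := by rw [lt_div_iff₀ hρ0]; linarith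
      rw [max_eq_left (by linarith)]
      apply le_of_eq; ring
    · push Not at h
      have key : sat (ρ * Real.cos t) * Real.cos t = |Real.cos t| := by
        rcases le_total 0 (Real.cos t) with h0 | h0
        · rw [abs_of_nonneg (by positivity)] at h
          rw [sat_of_one_le h, abs_of_nonneg h0, one_mul]
        · rw [abs_of_nonpos (mul_nonpos_of_nonneg_of_nonpos hρ0.le h0)] at h
          rw [sat_of_le_neg_one (by linarith), abs_of_nonpos h0, neg_one_mul]
      rw [key, zero_mul, mul_zero, sub_zero]
      exact max_le (abs_nonneg _) (by linarith)
  rw [intervalIntegral.integral_sub hi₁ hi₂, intervalIntegral.integral_const_mul] at hle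
  unfold satCoeff
  linarith

variable {A : Mat n} {b : Phase n}

theorem linearizedField_eq (ρ t : ℝ) (x : Phase n) : linearizedField A b ρ t x =
    rotatingField A 0 t x + (satSlope ρ t * rot n t x (0, 0)) • rot n (-t) b := by
  simp [linearizedField, rotatingField, perturbation]

theorem intervalIntegrable_linearizedField (ρ : ℝ) (x : Phase n) (s t : ℝ) :
    IntervalIntegrable (fun t => linearizedField A b ρ t x) MeasureTheory.volume s t :=
  intervalIntegrable_of_norm_le (measurable_linearizedField A b ρ continuous_const)
    (C := (linearizedKernel A b ρ).bound * ‖x‖) (fun t => (linearizedKernel A b ρ).norm_le t x) s t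

/-- Eliminating `blockRe A 0` between the first component and the averaged equation leaves `v (0, 0)
b (0, 0) (ρ I - satCoeff 0 ρ) = 0`, with `I` the derivative of the coefficient at `ρ`; by
`mul_integral_satSlope_lt_satCoeff` this forces `v (0, 0) = 0`. The saturation then drops out of the
linearization, the second component gives `s = 0`, and the other blocks are multiplications by
nonzero complex numbers. -/
theorem IsNondegenerate.linearized_injective {σ : ℝ} {w : Phase n} (h : IsNondegenerate A b σ w)
    {v : Phase n} {s : ℝ} (hv : v (0, 1) = 0)
    (he : (∫ t in (0 : ℝ)..(2 * Real.pi), linearizedField A b (w (0, 0)) t v) +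
      (2 * Real.pi * σ) • centerMap n v + (2 * Real.pi * s) • centerMap n w = 0) :
    v = 0 ∧ s = 0 := by
  set ρ := w (0, 0)
  have hρ0 : 0 < ρ := one_pos.trans h.one_lt
  have hq : ∀ q, (∫ t in (0 : ℝ)..(2 * Real.pi), linearizedField A b ρ t v q) +
      (2 * Real.pi * σ) * centerMap n v q + (2 * Real.pi * s) * centerMap n w q = 0 := by
    intro q
    have := congrFun he q
    simpa only [Pi.add_apply, Pi.smul_apply, smul_eq_mul, Pi.zero_apply,
      intervalIntegral_phase_apply (intervalIntegrable_linearizedField ρ v _ _)] using this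
  have hrot : ∀ t, rot n t v (0, 0) = v (0, 0) * Real.cos t := by
    intro t; rw [rot_apply_zero, hv, freq_zero]; ring_nf
  have hc := continuous_rotatingField_apply (A := A) (b := 0) v
  have hv₀ : v (0, 0) = 0 := by
    have e : ∀ t, linearizedField A b ρ t v (0, 0) = rotatingField A 0 t v (0, 0) +
        ((v (0, 0) * b (0, 0)) * (satSlope ρ t * (Real.cos t * Real.cos t)) +
        (v (0, 0) * b (0, 1)) * (satSlope ρ t * (Real.cos t * Real.sin t))) := by
      intro t
      simp only [linearizedField_eq, Pi.add_apply, Pi.smul_apply, smul_eq_mul, hrot,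
        rot_apply_zero (-t), freq_zero, mul_neg, Real.cos_neg, Real.sin_neg, one_mul]
      ring
    have hi₁ := (intervalIntegrable_satSlope_mul ρ (f := fun t => Real.cos t * Real.cos t)
      (by fun_prop) (fun t => abs_cos_mul_cos_le t t) 0 (2 * Real.pi)).const_mul
        (v (0, 0) * b (0, 0))
    have hi₂ := (intervalIntegrable_satSlope_mul ρ (f := fun t => Real.cos t * Real.sin t)
      (by fun_prop) (fun t => abs_cos_mul_sin_le t t) 0 (2 * Real.pi)).const_mul
        (v (0, 0) * b (0, 1))
    have h₁ := hq (0, 0)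
    simp_rw [e] at h₁
    rw [intervalIntegral.integral_add ((hc _).intervalIntegrable _ _) (hi₁.add hi₂),
      intervalIntegral.integral_add hi₁ hi₂, intervalIntegral.integral_const_mul,
      intervalIntegral.integral_const_mul, integral_satSlope_mul_cos_mul_sin,
      ← averagedField_apply, averagedField_zero hv, centerMap_zero, centerMap_zero, hv,
      h.im_eq_zero] at h₁
    have h₂ := (h.eq.components h.im_eq_zero 0).1
    rw [h.im_eq_zero] at h₂
    have h₃ := (mul_integral_satSlope_lt_satCoeff (n := n) h.one_lt).ne
    by_contra hne
    refine h₃ (mul_left_cancel₀ (mul_ne_zero hne h.input_ne_zero) ?_)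
    simp only [Pi.zero_apply] at h₁
    linear_combination ρ * h₁ - v (0, 0) * h₂
  have e : ∀ t, linearizedField A b ρ t v = rotatingField A 0 t v := by
    intro t
    rw [linearizedField_eq, hrot, hv₀]
    simp
  simp_rw [e, ← averagedField_apply] at hq
  have hs : s = 0 := by
    have h₁ := hq (0, 1)
    rw [averagedField_one hv, centerMap_one, centerMap_one, hv, hv₀, freq_zero] at h₁
    have : 2 * Real.pi * ρ ≠ 0 := (mul_pos Real.two_pi_pos hρ0).ne'
    refine (mul_eq_zero.1 (?_ : 2 * Real.pi * ρ * s = 0)).resolve_left this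
    simp only [Pi.zero_apply] at h₁
    linear_combination h₁
  refine ⟨?_, hs⟩
  have hj : ∀ j, v (j, 0) = 0 ∧ v (j, 1) = 0 := by
    intro j
    rcases eq_or_ne j 0 with rfl | hj
    · exact ⟨hv₀, hv⟩
    have h₁ := hq (j, 0)
    have h₂ := hq (j, 1)
    rw [averagedField_zero hv, centerMap_zero, hs] at h₁
    rw [averagedField_one hv, centerMap_one, hs] at h₂
    simp only [Pi.zero_apply] at h₁ h₂
    exact eq_zero_of_complex_mul (h.block_ne_zero j hj) (by linear_combination h₁)
      (by linear_combination h₂)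
  exact phase_ext (fun j => (hj j).1) fun j => (hj j).2

omit [NeZero n] in
/-- Integrals over several periods. -/
theorem integral_multiPeriod {f : ℝ → Phase n} (m : ℕ)
    (hper : ∀ t, f (t + 2 * Real.pi) = f t)
    (hf : ∀ s t, IntervalIntegrable f MeasureTheory.volume s t) :
    ∫ t in (0 : ℝ)..multiPeriod m, f t = (m : ℝ) • ∫ t in (0 : ℝ)..(2 * Real.pi), f t := by
  have := Function.Periodic.intervalIntegral_add_zsmul_eq (f := f) (T := 2 * Real.pi) hper m 0 hf
  rw [zero_add, zero_add, zsmul_eq_mul, Int.cast_natCast] at this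
  rw [multiPeriod, this, natCast_zsmul, Nat.cast_smul_eq_nsmul]

/-! ### The bifurcation equations in a space of curves -/

/-- The integral of the right hand side of the equation for the curve in rotating coordinates. -/
def driftOperator (A : Mat n) (b : Phase n) (m : ℕ) (ε : ℝ) (y : Curves m n) (σ : ℝ) :
    Curves m n :=
  σ • (centerKernel n).integralOperator m y + (1 + ε * σ) • perturbationOperator A b m y

/-- The endpoint of the interval of definition of the curves. -/
def endTime (m : ℕ) : Set.Icc (0 : ℝ) (multiPeriod m) :=
  ⟨multiPeriod m, multiPeriod_nonneg m, le_rfl⟩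

/-- Parameter, curve, initial value, and correction of the period. -/
abbrev BifurcationSpace (m n : ℕ) : Type := ℝ × Curves m n × Phase n × ℝ

/-- The parameter, the defect in the integral equation for the curve, the defect in the periodicity,
and a phase condition. -/
def bifurcationMap (A : Mat n) (b : Phase n) (m : ℕ) (u : BifurcationSpace m n) :
    BifurcationSpace m n :=
  (u.1, u.2.1 - ContinuousMap.const _ u.2.2.1 - u.1 • driftOperator A b m u.1 u.2.1 u.2.2.2,
    driftOperator A b m u.1 u.2.1 u.2.2.2 (endTime m), u.2.2.1 (0, 1))

/-- Constant curves, as a continuous linear map. -/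
def constCurve (m n : ℕ) : Phase n →L[ℝ] Curves m n :=
  LinearMap.mkContinuous
    { toFun := fun x => ContinuousMap.const _ x
      map_add' := fun _ _ => rfl
      map_smul' := fun _ _ => rfl } 1 fun x => by
    rw [one_mul]
    exact (ContinuousMap.norm_le _ (norm_nonneg x)).2 fun _ => le_rfl

omit [NeZero n] in
theorem constCurve_apply (m : ℕ) (x : Phase n) : constCurve m n x = ContinuousMap.const _ x := rfl

/-- Apart from the perturbation operator everything is linear or a product. The parameter `ε` is
carried along as a component so that the inverse function theorem acts as an implicit function
theorem, and the periodicity defect is already divided by `ε`, which keeps the equations from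
degenerating at `ε = 0`. -/
theorem exists_hasStrictFDerivAt_bifurcationMap (m : ℕ) {σ : ℝ} {w : Phase n}
    (hw : w (0, 1) = 0) :
    ∃ D : BifurcationSpace m n →L[ℝ] BifurcationSpace m n,
      HasStrictFDerivAt (bifurcationMap A b m) D (0, ContinuousMap.const _ w, w, σ) ∧
      ∀ u : BifurcationSpace m n,
        let q := σ • (centerKernel n).integralOperator m u.2.1 +
          u.2.2.2 • (centerKernel n).integralOperator m (ContinuousMap.const _ w) +
          (linearizedKernel A b (w (0, 0))).integralOperator m u.2.1 +
          (u.1 * σ) • perturbationOperator A b m (ContinuousMap.const _ w)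
        D u = (u.1, u.2.1 - ContinuousMap.const _ u.2.2.1 -
          u.1 • driftOperator A b m 0 (ContinuousMap.const _ w) σ, q (endTime m),
          u.2.2.1 (0, 1)) := by
  let E := BifurcationSpace m n
  let u₀ : E := (0, ContinuousMap.const _ w, w, σ)
  let pε : E →L[ℝ] ℝ := ContinuousLinearMap.fst ℝ _ _
  let py : E →L[ℝ] Curves m n :=
    (ContinuousLinearMap.fst ℝ _ _).comp (ContinuousLinearMap.snd ℝ _ _)
  let pw : E →L[ℝ] Phase n := (ContinuousLinearMap.fst ℝ _ _).comp
    ((ContinuousLinearMap.snd ℝ _ _).comp (ContinuousLinearMap.snd ℝ _ _))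
  let pσ : E →L[ℝ] ℝ := (ContinuousLinearMap.snd ℝ _ _).comp
    ((ContinuousLinearMap.snd ℝ _ _).comp (ContinuousLinearMap.snd ℝ _ _))
  have hε : HasStrictFDerivAt (fun u : E => u.1) pε u₀ := pε.hasStrictFDerivAt
  have hy : HasStrictFDerivAt (fun u : E => u.2.1) py u₀ := py.hasStrictFDerivAt
  have hσ : HasStrictFDerivAt (fun u : E => u.2.2.2) pσ u₀ := pσ.hasStrictFDerivAt
  have hconst : HasStrictFDerivAt (fun u : E => ContinuousMap.const _ u.2.2.1)
      ((constCurve m n).comp pw) u₀ := ((constCurve m n).comp pw).hasStrictFDerivAt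
  have hC : HasStrictFDerivAt (fun u : E => (centerKernel n).integralOperator m u.2.1)
      (((centerKernel n).integralOperator m).comp py) u₀ :=
    (((centerKernel n).integralOperator m).comp py).hasStrictFDerivAt
  have hP : HasStrictFDerivAt (fun u : E => perturbationOperator A b m u.2.1)
      (((linearizedKernel A b (w (0, 0))).integralOperator m).comp py) u₀ :=
    (hasStrictFDerivAt_perturbationOperator A b m hw).comp u₀ hy
  have hN := (hσ.smul hC).add (((hε.mul hσ).const_add 1).smul hP)
  have hend : HasStrictFDerivAt (fun y : Curves m n => y (endTime m))
      (ContinuousMap.evalCLM ℝ (endTime m)) (driftOperator A b m 0 (ContinuousMap.const _ w) σ) :=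
    (ContinuousMap.evalCLM ℝ (endTime m) : Curves m n →L[ℝ] Phase n).hasStrictFDerivAt
  let c₀₁ : E →L[ℝ] ℝ :=
    (ContinuousLinearMap.proj (R := ℝ) (φ := fun _ : Fin n × Fin 2 => ℝ) (0, 1)).comp pw
  have hc₀₁ : HasStrictFDerivAt (fun u : E => u.2.2.1 (0, 1)) c₀₁ u₀ := c₀₁.hasStrictFDerivAt
  have hend' := HasStrictFDerivAt.comp (g := fun y : Curves m n => y (endTime m))
    (f := fun u : E => driftOperator A b m u.1 u.2.1 u.2.2.2) u₀ hend hN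
  refine ⟨_, hε.prodMk (((hy.sub hconst).sub (hε.smul hN)).prodMk (hend'.prodMk hc₀₁)),
    fun u => ?_⟩
  refine Prod.ext rfl (Prod.ext ?_ (Prod.ext ?_ rfl))
  · simp [u₀, pε, py, pw, pσ, driftOperator, constCurve_apply]
  · simp [u₀, pε, py, pw, pσ]
    module

/-- At `ε = 0` the integral equation determines the increment of the curve from that of the initial
value and the data. What remains is the finite dimensional map `T`, for which injectivity implies
surjectivity. -/
theorem IsNondegenerate.exists_equiv {m : ℕ} (hm : m ≠ 0) {σ : ℝ} {w : Phase n}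
    (h : IsNondegenerate A b σ w) :
    ∃ D : BifurcationSpace m n ≃L[ℝ] BifurcationSpace m n,
      HasStrictFDerivAt (bifurcationMap A b m) (D : BifurcationSpace m n →L[ℝ] BifurcationSpace m n)
        (0, ContinuousMap.const _ w, w, σ) := by
  obtain ⟨D, hD, hDeq⟩ :=
    exists_hasStrictFDerivAt_bifurcationMap (A := A) (b := b) m (σ := σ) h.im_eq_zero
  have hm' : (m : ℝ) ≠ 0 := by exact_mod_cast hm
  -- the finite dimensional part
  let K : Curves m n →L[ℝ] Phase n := (ContinuousMap.evalCLM ℝ (endTime m)).comp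
    (σ • (centerKernel n).integralOperator m + (linearizedKernel A b (w (0, 0))).integralOperator m)
  let T : Phase n × ℝ →ₗ[ℝ] Phase n × ℝ :=
    { toFun := fun z => (K (constCurve m n z.1) +
        z.2 • (centerKernel n).integralOperator m (ContinuousMap.const _ w) (endTime m),
          z.1 (0, 1))
      map_add' := fun y z => by
        refine Prod.ext ?_ rfl
        simp only [Prod.fst_add, Prod.snd_add, map_add, add_smul]
        abel
      map_smul' := fun c z => by
        refine Prod.ext ?_ rfl
        simp [smul_add, smul_smul] }
  have hcenter : ∀ v : Phase n, (centerKernel n).integralOperator m (ContinuousMap.const _ v)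
      (endTime m) = (m : ℝ) • (2 * Real.pi) • centerMap n v := by
    intro v
    rw [LinearKernel.integralOperator_apply]
    change ∫ s in (0 : ℝ)..multiPeriod m, centerMap n v = _
    rw [intervalIntegral.integral_const, sub_zero, multiPeriod, smul_smul]
  have hlin : ∀ v : Phase n, (linearizedKernel A b (w (0, 0))).integralOperator m
      (ContinuousMap.const _ v) (endTime m) =
      (m : ℝ) • ∫ t in (0 : ℝ)..(2 * Real.pi), linearizedField A b (w (0, 0)) t v := by
    intro v
    rw [LinearKernel.integralOperator_apply]
    refine integral_multiPeriod m (fun t => ?_) (intervalIntegrable_linearizedField _ v)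
    have := linearizedField_add_period A b (w (0, 0)) t 1 v
    rw [Nat.cast_one, one_mul] at this
    exact this
  -- Over `m` periods each term is `m` times its value over one period, so `linearized_injective`
  -- applies after cancelling `m`.
  have hT : Function.Injective T := by
    refine (injective_iff_map_eq_zero T).2 fun z hz => ?_
    have h₁ : z.1 (0, 1) = 0 := congrArg Prod.snd hz
    have h₂ : K (constCurve m n z.1) +
        z.2 • (centerKernel n).integralOperator m (ContinuousMap.const _ w) (endTime m) = 0 :=
      congrArg Prod.fst hz
    have h₃ : (m : ℝ) • ((∫ t in (0 : ℝ)..(2 * Real.pi), linearizedField A b (w (0, 0)) t z.1) +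
        (2 * Real.pi * σ) • centerMap n z.1 + (2 * Real.pi * z.2) • centerMap n w) = 0 := by
      rw [← h₂]
      simp only [K, ContinuousLinearMap.comp_apply, add_apply,
        smul_apply, ContinuousMap.evalCLM_apply, ContinuousMap.add_apply,
        ContinuousMap.smul_apply, constCurve_apply, hcenter, hlin]
      module
    obtain ⟨h₄, h₅⟩ := h.linearized_injective h₁ ((smul_eq_zero.1 h₃).resolve_left hm')
    exact Prod.ext h₄ h₅
  have hTs : Function.Surjective T := LinearMap.injective_iff_surjective.1 hT
  have hker : D.ker = ⊥ := by
    refine LinearMap.ker_eq_bot'.2 fun u hu => ?_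
    have hu' : D u = 0 := hu
    rw [hDeq] at hu'
    obtain ⟨e, y, v, s⟩ := u
    simp only [Prod.mk_eq_zero] at hu'
    obtain ⟨he, h₁, h₂, h₃⟩ := hu'
    subst he
    rw [zero_smul, sub_zero, sub_eq_zero] at h₁
    subst h₁
    have hz : T (v, s) = 0 := by
      refine Prod.ext ?_ h₃
      rw [zero_mul, zero_smul, add_zero] at h₂
      simp only [T, K, LinearMap.coe_mk, AddHom.coe_mk, ContinuousLinearMap.comp_apply,
        add_apply, smul_apply, ContinuousMap.evalCLM_apply,
        ContinuousMap.add_apply, ContinuousMap.smul_apply, constCurve_apply, Prod.fst_zero] at h₂ ⊢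
      rw [← h₂]; abel
    obtain ⟨rfl, rfl⟩ := Prod.mk_eq_zero.1 (hT (hz.trans (map_zero T).symm))
    rfl
  have hrange : D.range = ⊤ := by
    refine LinearMap.range_eq_top.2 fun u => ?_
    obtain ⟨e, f, z, s⟩ := u
    -- The part of the curve forced by the data; its contribution to the periodicity condition is
    -- moved to the right hand side of the equation for `T`.
    let g := f + e • driftOperator A b m 0 (ContinuousMap.const _ w) σ
    obtain ⟨⟨v, τ⟩, hv⟩ := hTs (z - K g -
      (e * σ) • perturbationOperator A b m (ContinuousMap.const _ w) (endTime m), s)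
    have hv₁ := congrArg Prod.fst hv
    have hv₂ : v (0, 1) = s := congrArg Prod.snd hv
    refine ⟨(e, constCurve m n v + g, v, τ), ?_⟩
    change D (e, constCurve m n v + g, v, τ) = _
    rw [hDeq]
    refine Prod.ext rfl (Prod.ext ?_ (Prod.ext ?_ hv₂))
    · simp only [g, constCurve_apply]
      abel
    · simp only [T, K, LinearMap.coe_mk, AddHom.coe_mk, ContinuousLinearMap.comp_apply,
        add_apply, smul_apply, ContinuousMap.evalCLM_apply,
        ContinuousMap.add_apply, ContinuousMap.smul_apply, constCurve_apply, map_add,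
        smul_add] at hv₁ ⊢
      rw [eq_sub_iff_add_eq, eq_sub_iff_add_eq] at hv₁
      rw [← hv₁]
      abel
  refine ⟨ContinuousLinearEquiv.ofBijective D hker hrange, ?_⟩
  rwa [ContinuousLinearEquiv.coe_ofBijective]

end

section

variable {n : ℕ} [NeZero n] {A : Mat n} {b : Phase n}

/-! ### Solutions in rotating coordinates -/

/-- A solution in rotating coordinates, after an affine change of time. -/
def rotCurve (x : ℝ → Phase n) (κ s t : ℝ) : Phase n := rot n (-t) (x (κ * t + s))

omit [NeZero n] in
theorem rotCurve_zero (x : ℝ → Phase n) (κ s : ℝ) : rotCurve x κ s 0 = x s := by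
  simp [rotCurve]

omit [NeZero n] in
theorem rot_rotCurve (x : ℝ → Phase n) (κ s t : ℝ) :
    rot n t (rotCurve x κ s t) = x (κ * t + s) := by
  simp [rotCurve]

/-- Rotation cancels the unperturbed field up to the mismatch `κ - 1` of the time scales, so the
velocity is small when `κ` is near `1` and `ε` near `0`. -/
theorem hasDerivAt_rotCurve {ε : ℝ} {x : ℝ → Phase n}
    (hx : ∀ t, HasDerivAt x (field A b ε (x t)) t) (κ s t : ℝ) :
    HasDerivAt (rotCurve x κ s) ((κ - 1) • centerMap n (rotCurve x κ s t) +
      (κ * ε) • rotatingField A b t (rotCurve x κ s t)) t := by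
  have hτ : HasDerivAt (fun t => κ * t + s) κ t := by
    simpa using ((hasDerivAt_id t).const_mul κ).add_const s
  have h₁ : HasDerivAt (fun t => x (κ * t + s)) (κ • field A b ε (x (κ * t + s))) t :=
    (hx (κ * t + s)).scomp t hτ
  refine (hasDerivAt_rot_comp (hasDerivAt_neg t) h₁).congr_deriv ?_
  rw [rotatingField, rot_rotCurve, field_eq, map_smul, map_add, map_smul, rot_centerMap]
  simp only [rotCurve]
  module

theorem continuous_rotCurve {ε : ℝ} {x : ℝ → Phase n}
    (hx : ∀ t, HasDerivAt x (field A b ε (x t)) t) (κ s : ℝ) : Continuous (rotCurve x κ s) :=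
  continuous_iff_continuousAt.2 fun t => (hasDerivAt_rotCurve hx κ s t).continuousAt

variable (A b) in
-- Grönwall's inequality bounds the curve, hence its velocity, and the mean value inequality bounds
-- the displacement with a factor `η`.
theorem exists_rotCurve_bound : ∃ K : ℝ, 0 ≤ K ∧ ∀ (ε κ s η L : ℝ) (x : ℝ → Phase n), 0 ≤ η →
    (∀ t, HasDerivAt x (field A b ε (x t)) t) → |κ - 1| ≤ η → |κ * ε| ≤ η →
    ∀ t ∈ Set.Icc 0 L, ‖rotCurve x κ s t - x s‖ ≤
      η * K * (‖x s‖ * Real.exp (η * K * L)) * L := by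
  obtain ⟨C, hC⟩ := exists_perturbation_bound A b
  have hG : ∀ t x, ‖rotatingField A b t x‖ ≤ 4 * C * ‖x‖ := by
    intro t x
    have h₁ := hC (rot n t x) 0
    rw [perturbation_zero, sub_zero, sub_zero] at h₁
    calc ‖rotatingField A b t x‖ ≤ 2 * ‖perturbation A b (rot n t x)‖ := norm_rot_apply_le _ _
      _ ≤ 2 * (C * (2 * ‖x‖)) := by
          gcongr
          exact h₁.trans (by gcongr; exact norm_rot_apply_le t x)
      _ = _ := by ring
  refine ⟨‖centerMap n‖ + 4 * C, by positivity, ?_⟩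
  intro ε κ s η L x hη hx hκ hε t ht
  set K := ‖centerMap n‖ + 4 * (C : ℝ)
  have hK : 0 ≤ K := by positivity
  set y := rotCurve x κ s
  have hder := hasDerivAt_rotCurve hx κ s
  have hbound : ∀ t, ‖(κ - 1) • centerMap n (y t) + (κ * ε) • rotatingField A b t (y t)‖ ≤
      η * K * ‖y t‖ := by
    intro t
    calc _ ≤ ‖(κ - 1) • centerMap n (y t)‖ + ‖(κ * ε) • rotatingField A b t (y t)‖ :=
          norm_add_le _ _
      _ ≤ η * (‖centerMap n‖ * ‖y t‖) + η * (4 * C * ‖y t‖) := by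
          rw [norm_smul, norm_smul]
          gcongr
          · exact hκ
          · exact (centerMap n).le_opNorm _
          · exact hε
          · exact hG _ _
      _ = _ := by ring
  have hy0 : y 0 = x s := rotCurve_zero x κ s
  have hcont : Continuous y := continuous_rotCurve hx κ s
  have hgron : ∀ t ∈ Set.Icc 0 L, ‖y t‖ ≤ ‖x s‖ * Real.exp (η * K * L) := by
    intro t ht
    have := norm_le_gronwallBound_of_norm_deriv_right_le (f := y) (δ := ‖x s‖) (K := η * K)
      (ε := 0) (a := 0) (b := L) hcont.continuousOn (fun t _ => (hder t).hasDerivWithinAt)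
      (by rw [hy0]) (fun t _ => by rw [add_zero]; exact hbound t) t ht
    rw [gronwallBound_ε0, sub_zero] at this
    refine this.trans ?_
    gcongr
    exact ht.2
  have hL : 0 ≤ L := ht.1.trans ht.2
  have := norm_image_sub_le_of_norm_deriv_le_segment' (f := y) (a := 0) (b := L)
    (C := η * K * (‖x s‖ * Real.exp (η * K * L)))
    (fun t _ => (hder t).hasDerivWithinAt) (fun t ht => (hbound t).trans (by
      gcongr
      exact hgron t ⟨ht.1, ht.2.le⟩)) t ht
  rw [hy0] at this
  refine this.trans ?_
  gcongr
  linarith [ht.2]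

/-- Solutions in rotating coordinates are almost constant over bounded times. -/
theorem eventually_rotCurve_close {l : Filter ℝ} (hl : Tendsto id l (𝓝 0)) {x : ℝ → ℝ → Phase n}
    {κ s : ℝ → ℝ} {w : Phase n} (hx : ∀ᶠ ε in l, ∀ t, HasDerivAt (x ε) (field A b ε (x ε t)) t)
    (hκ : Tendsto κ l (𝓝 1)) (hs : Tendsto (fun ε => x ε (s ε)) l (𝓝 w)) (L : ℝ) {δ : ℝ}
    (hδ : 0 < δ) :
    ∀ᶠ ε in l, ∀ t ∈ Set.Icc 0 L, ‖rotCurve (x ε) (κ ε) (s ε) t - w‖ ≤ δ := by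
  obtain ⟨K, hK, hbound⟩ := exists_rotCurve_bound A b
  let η : ℝ → ℝ := fun ε => |κ ε - 1| + |κ ε * ε|
  have hη : Tendsto η l (𝓝 0) := by
    have h₁ : Tendsto (fun ε => |κ ε - 1|) l (𝓝 0) := by simpa using (hκ.sub_const 1).abs
    have h₂ : Tendsto (fun ε => |κ ε * ε|) l (𝓝 0) := by simpa using (hκ.mul hl).abs
    have := h₁.add h₂
    rwa [add_zero] at this
  have hlim : Tendsto (fun ε => η ε * K * (‖x ε (s ε)‖ * Real.exp (η ε * K * L)) * L +
      ‖x ε (s ε) - w‖) l (𝓝 0) := by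
    have h₁ : Tendsto (fun ε => Real.exp (η ε * K * L)) l (𝓝 (Real.exp (0 * K * L))) :=
      (Real.continuous_exp.tendsto _).comp ((hη.mul_const K).mul_const L)
    have h₂ : Tendsto (fun ε => ‖x ε (s ε) - w‖) l (𝓝 0) := by
      simpa using (hs.sub_const w).norm
    simpa using ((((hη.mul_const K).mul (hs.norm.mul h₁)).mul_const L).add h₂)
  filter_upwards [hx, hlim.eventually (eventually_le_nhds hδ)] with ε hxε hle t ht
  calc ‖rotCurve (x ε) (κ ε) (s ε) t - w‖ ≤
        ‖rotCurve (x ε) (κ ε) (s ε) t - x ε (s ε)‖ + ‖x ε (s ε) - w‖ :=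
        norm_sub_le_norm_sub_add_norm_sub _ _ _
    _ ≤ δ := by
        refine le_trans (add_le_add ?_ le_rfl) hle
        exact hbound ε (κ ε) (s ε) (η ε) L (x ε) (by positivity) hxε
          (le_add_of_nonneg_right (abs_nonneg _)) (le_add_of_nonneg_left (abs_nonneg _)) t ht

theorem tendsto_solution {l : Filter ℝ} (hl : Tendsto id l (𝓝 0)) {x : ℝ → ℝ → Phase n}
    {w : Phase n} (hx : ∀ᶠ ε in l, ∀ t, HasDerivAt (x ε) (field A b ε (x ε t)) t)
    (h0 : Tendsto (fun ε => x ε 0) l (𝓝 w)) {τ : ℝ → ℝ} {t₀ : ℝ} (ht₀ : 0 < t₀)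
    (hτ : Tendsto τ l (𝓝 t₀)) : Tendsto (fun ε => x ε (τ ε)) l (𝓝 (rot n t₀ w)) := by
  have h₁ : Tendsto (fun ε => rotCurve (x ε) 1 0 (τ ε)) l (𝓝 w) := by
    refine Metric.tendsto_nhds.2 fun δ hδ => ?_
    filter_upwards [eventually_rotCurve_close hl hx (κ := fun _ => 1) (s := fun _ => 0)
      tendsto_const_nhds h0 (t₀ + 1) (half_pos hδ), hτ.eventually (lt_mem_nhds ht₀),
      hτ.eventually (gt_mem_nhds (lt_add_one t₀))] with ε h h₁ h₂
    rw [dist_eq_norm]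
    exact (h _ ⟨h₁.le, h₂.le⟩).trans_lt (half_lt_self hδ)
  have hc : Continuous fun q : ℝ × Phase n => rot n q.1 q.2 :=
    continuous_rot_comp continuous_fst continuous_snd
  have h₂ := (hc.tendsto (t₀, w)).comp (hτ.prodMk_nhds h₁)
  refine h₂.congr fun ε => ?_
  simp [rot_rotCurve]

/-- The part of a solution in rotating coordinates over several periods. -/
def solutionCurve (m : ℕ) {ε : ℝ} {x : ℝ → Phase n}
    (hx : ∀ t, HasDerivAt x (field A b ε (x t)) t) (κ s : ℝ) : Curves m n :=
  ⟨fun t => rotCurve x κ s t, (continuous_rotCurve hx κ s).comp continuous_subtype_val⟩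

theorem driftOperator_apply (m : ℕ) (ε : ℝ) (y : Curves m n) (σ : ℝ)
    (t : Set.Icc (0 : ℝ) (multiPeriod m)) :
    driftOperator A b m ε y σ t = ∫ s in (0 : ℝ)..t, (σ • centerMap n (extendCurve y s) +
      (1 + ε * σ) • rotatingField A b s (extendCurve y s)) := by
  have h₁ : Continuous fun s => centerMap n (extendCurve y s) :=
    (centerMap n).continuous.comp (continuous_extendCurve y)
  have h₂ := continuous_rotatingField_curve A b y
  rw [intervalIntegral.integral_add (Continuous.intervalIntegrable (by fun_prop) _ _)
    (Continuous.intervalIntegrable (by fun_prop) _ _), intervalIntegral.integral_smul,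
    intervalIntegral.integral_smul]
  rfl

/-- With `κ = 1 + ε σ` the differential equation integrates to the equation for the curve. Its
endpoint value is `ε` times the drift, and it vanishes by periodicity of both the solution and the
rotation. -/
theorem bifurcationMap_solutionCurve {m : ℕ} {ε κ s : ℝ} (hε : ε ≠ 0) {x : ℝ → Phase n}
    (hx : ∀ t, HasDerivAt x (field A b ε (x t)) t)
    (hper : x (κ * multiPeriod m + s) = x s) (hs : x s (0, 1) = 0) :
    bifurcationMap A b m (ε, solutionCurve m hx κ s, x s, (κ - 1) / ε) = (ε, 0, 0, 0) := by
  have hσ : ε * ((κ - 1) / ε) = κ - 1 := mul_div_cancel₀ _ hε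
  have key : ∀ t : Set.Icc (0 : ℝ) (multiPeriod m), rotCurve x κ s t - x s =
      ε • driftOperator A b m ε (solutionCurve m hx κ s) ((κ - 1) / ε) t := by
    intro t
    have hder := hasDerivAt_rotCurve hx κ s
    have hc := continuous_rotCurve hx κ s
    have hint : Continuous fun t => (κ - 1) • centerMap n (rotCurve x κ s t) +
      (κ * ε) • rotatingField A b t (rotCurve x κ s t) := by
      have h₁ := continuous_rotatingField_comp A b continuous_id hc
      simp only [id] at h₁
      fun_prop
    rw [← rotCurve_zero x κ s, ← intervalIntegral.integral_eq_sub_of_hasDerivAt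
      (fun t _ => hder t) (hint.intervalIntegrable _ _), driftOperator_apply,
      ← intervalIntegral.integral_smul]
    refine intervalIntegral.integral_congr fun u hu => ?_
    rw [Set.uIcc_of_le t.2.1] at hu
    have hext : extendCurve (solutionCurve m hx κ s) u = rotCurve x κ s u :=
      extendCurve_of_mem _ ⟨hu.1, hu.2.trans t.2.2⟩
    simp only [hext, smul_add, smul_smul, hσ]
    congr 2
    ring
  refine Prod.ext rfl (Prod.ext ?_ (Prod.ext ?_ hs))
  · ext1 t
    change rotCurve x κ s t - x s -
      ε • driftOperator A b m ε (solutionCurve m hx κ s) ((κ - 1) / ε) t = 0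
    rw [key, sub_self]
  · have h₁ := key (endTime m)
    have h₂ : rotCurve x κ s (multiPeriod m) = x s := by
      rw [rotCurve, hper, multiPeriod, ← zero_add ((m : ℝ) * (2 * Real.pi)), rot_neg_add_period,
        neg_zero, rot_zero]
    change rotCurve x κ s (multiPeriod m) - x s = _ at h₁
    rw [h₂, sub_self] at h₁
    exact (smul_eq_zero.1 h₁.symm).resolve_left hε

/-! ### Convergence of families of periodic solutions -/

/-- Choose `s ε` with `P` whose distance to `t₀` is within `|ε|` of the infimum; the margin is
positive as `ε ≠ 0` and tends to zero along `l`. -/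
theorem exists_tendsto_of_forall_eventually {l : Filter ℝ} (hl : l ≤ 𝓝[≠] 0)
    {P : ℝ → ℝ → Prop} {t₀ : ℝ} (h : ∀ δ > 0, ∀ᶠ ε in l, ∃ t, |t - t₀| ≤ δ ∧ P ε t) :
    ∃ s : ℝ → ℝ, Tendsto s l (𝓝 t₀) ∧ ∀ᶠ ε in l, P ε (s ε) := by
  let d : ℝ → ℝ := fun ε => sInf {r | ∃ t, |t - t₀| = r ∧ P ε t}
  have hbdd : ∀ ε, BddBelow {r | ∃ t, |t - t₀| = r ∧ P ε t} := fun ε =>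
    ⟨0, by rintro _ ⟨t, rfl, _⟩; exact abs_nonneg _⟩
  have hex : ∀ ε, ∃ s, ε ≠ 0 → (∃ t, P ε t) → |s - t₀| < d ε + |ε| ∧ P ε s := by
    intro ε
    by_cases hε : ε ≠ 0 ∧ ∃ t, P ε t
    · obtain ⟨hε0, t, ht⟩ := hε
      obtain ⟨_, ⟨s, rfl, hs⟩, hlt⟩ := exists_lt_of_csInf_lt
        (s := {r | ∃ t, |t - t₀| = r ∧ P ε t}) ⟨_, t, rfl, ht⟩
        (lt_add_of_pos_right (d ε) (abs_pos.2 hε0))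
      exact ⟨s, fun _ _ => ⟨hlt, hs⟩⟩
    · exact ⟨0, fun h₁ h₂ => absurd ⟨h₁, h₂⟩ hε⟩
  choose s hs using hex
  have hne : ∀ᶠ ε in l, ε ≠ 0 := hl self_mem_nhdsWithin
  have hl0 : Tendsto id l (𝓝 (0 : ℝ)) := hl.trans nhdsWithin_le_nhds
  refine ⟨s, Metric.tendsto_nhds.2 fun δ hδ => ?_, ?_⟩
  · have habs : Tendsto (fun ε : ℝ => |ε|) l (𝓝 0) := by simpa using hl0.abs
    filter_upwards [hne, h (δ / 2) (half_pos hδ), habs.eventually (gt_mem_nhds (half_pos hδ))]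
      with ε hε ⟨t, ht, hP⟩ hsmall
    have h₁ : d ε ≤ |t - t₀| := csInf_le (hbdd ε) ⟨t, rfl, hP⟩
    have h₂ := (hs ε hε ⟨t, hP⟩).1
    rw [Real.dist_eq]
    linarith
  · filter_upwards [hne, h 1 one_pos] with ε hε ⟨t, _, hP⟩
    exact (hs ε hε ⟨t, hP⟩).2

/-- Times at which a family of solutions satisfies the phase condition. -/
theorem exists_phase_shift {l : Filter ℝ} (hl : l ≤ 𝓝[≠] 0) {x : ℝ → ℝ → Phase n}
    {w : Phase n} (hx : ∀ᶠ ε in l, ∀ t, HasDerivAt (x ε) (field A b ε (x ε t)) t)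
    (h0 : Tendsto (fun ε => x ε 0) l (𝓝 w)) {t₀ : ℝ} (ht₀ : 0 < t₀)
    (hw₁ : rot n t₀ w (0, 1) = 0) (hw₀ : 0 < rot n t₀ w (0, 0)) :
    ∃ s : ℝ → ℝ, Tendsto s l (𝓝 t₀) ∧ ∀ᶠ ε in l, x ε (s ε) (0, 1) = 0 := by
  have hl0 : Tendsto id l (𝓝 (0 : ℝ)) := hl.trans nhdsWithin_le_nhds
  refine exists_tendsto_of_forall_eventually hl (P := fun ε t => x ε t (0, 1) = 0) fun δ hδ => ?_
  -- The bound `t₀ / 2` keeps the times positive and the bound `1 < π` makes `sin η` positive; the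
  -- second coordinate then changes sign between `t₀ - η` and `t₀ + η`.
  let η := min (δ : ℝ) (min (t₀ / 2) 1)
  have hη : 0 < η := lt_min hδ (lt_min (half_pos ht₀) one_pos)
  have hη₁ : η ≤ 1 := (min_le_right _ _).trans (min_le_right _ _)
  have hη₂ : η ≤ t₀ / 2 := (min_le_right _ _).trans (min_le_left _ _)
  have hsin : 0 < Real.sin η := Real.sin_pos_of_pos_of_lt_pi hη (by linarith [Real.pi_gt_three])
  have hval : ∀ u, rot n (u + t₀) w (0, 1) = Real.sin u * rot n t₀ w (0, 0) := by
    intro u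
    rw [rot_add, rot_apply_one u, hw₁, freq_zero]; ring_nf
  have hlim : ∀ u, 0 < u + t₀ → Tendsto (fun ε => x ε (u + t₀) (0, 1)) l
      (𝓝 (Real.sin u * rot n t₀ w (0, 0))) := by
    intro u hu
    rw [← hval]
    exact ((continuous_apply ((0 : Fin n), (1 : Fin 2))).tendsto _).comp
      (tendsto_solution hl0 hx h0 hu tendsto_const_nhds)
  have h₁ := (hlim η (by linarith)).eventually (lt_mem_nhds (mul_pos hsin hw₀))
  have hneg : Real.sin (-η) * rot n t₀ w (0, 0) < 0 := by
    rw [Real.sin_neg]; nlinarith [mul_pos hsin hw₀]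
  have h₂ := (hlim (-η) (by linarith)).eventually (gt_mem_nhds hneg)
  filter_upwards [h₁, h₂, hx] with ε hp hn hxε
  have hc : Continuous fun t => x ε t (0, 1) :=
    (continuous_apply _).comp (continuous_iff_continuousAt.2 fun t => (hxε t).continuousAt)
  obtain ⟨t, ht, hz⟩ := intermediate_value_Icc (by linarith : -η + t₀ ≤ η + t₀) hc.continuousOn
    (⟨hn.le, hp.le⟩ : (0 : ℝ) ∈ Set.Icc _ _)
  refine ⟨t, ?_, hz⟩
  have : η ≤ δ := min_le_left _ _
  rw [abs_le]
  constructor <;> linarith [ht.1, ht.2]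

theorem perturbationOperator_const_endTime (m : ℕ) (w : Phase n) :
    perturbationOperator A b m (ContinuousMap.const _ w) (endTime m) =
      (m : ℝ) • averagedField A b w := by
  rw [perturbationOperator_apply]
  refine integral_multiPeriod m (fun t => ?_) fun s t =>
    (continuous_rotatingField_comp A b continuous_id continuous_const).intervalIntegrable _ _
  have := rotatingField_add_period A b t 1 w
  rw [Nat.cast_one, one_mul] at this
  exact this

omit [NeZero n] in
theorem center_integralOperator_const_endTime (m : ℕ) (w : Phase n) :
    (centerKernel n).integralOperator m (ContinuousMap.const _ w) (endTime m) =
      (m : ℝ) • (2 * Real.pi) • centerMap n w := by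
  rw [LinearKernel.integralOperator_apply]
  change ∫ s in (0 : ℝ)..multiPeriod m, centerMap n w = _
  rw [intervalIntegral.integral_const, sub_zero, multiPeriod, smul_smul]

/-- A family of periodic solutions near a periodic orbit of the unperturbed system gives solutions
of the bifurcation equations that converge to a solution of the averaged equations. -/
theorem exists_tendsto_bifurcationSpace {l : Filter ℝ} [l.NeBot] (hl : l ≤ 𝓝[≠] 0)
    {x : ℝ → ℝ → Phase n} {T : ℝ → ℝ} {w : Phase n} {T₀ : ℝ}
    (hx : ∀ᶠ ε in l, IsPeriodicSolution (field A b ε) (x ε) (T ε))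
    (h0 : Tendsto (fun ε => x ε 0) l (𝓝 w)) (hT : Tendsto T l (𝓝 T₀)) {t₀ : ℝ} (ht₀ : 0 < t₀)
    (hw₁ : rot n t₀ w (0, 1) = 0) (hw₀ : 0 < rot n t₀ w (0, 0)) {m k : ℕ} (hm : m ≠ 0)
    (hk : k * T₀ = multiPeriod m) :
    ∃ (σ₀ : ℝ) (s : ℝ → ℝ) (u : ℝ → BifurcationSpace m n),
      AveragedEquation A b σ₀ (rot n t₀ w) ∧
      Tendsto u l (𝓝 (0, ContinuousMap.const _ (rot n t₀ w), rot n t₀ w, σ₀)) ∧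
      ∀ᶠ ε in l, (u ε).2.2.1 = x ε (s ε) ∧ bifurcationMap A b m (u ε) = (ε, 0, 0, 0) := by
  classical
  have hl0 : Tendsto id l (𝓝 (0 : ℝ)) := hl.trans nhdsWithin_le_nhds
  have hne : ∀ᶠ ε in l, ε ≠ 0 := hl self_mem_nhdsWithin
  have hx' : ∀ᶠ ε in l, ∀ t, HasDerivAt (x ε) (field A b ε (x ε t)) t := hx.mono fun ε h => h.2.1
  set v := rot n t₀ w
  have hL : 0 < multiPeriod m :=
    mul_pos (by exact_mod_cast Nat.pos_of_ne_zero hm) Real.two_pi_pos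
  obtain ⟨s, hs, hsz⟩ := exists_phase_shift hl hx' h0 ht₀ hw₁ hw₀
  have hxs : Tendsto (fun ε => x ε (s ε)) l (𝓝 v) := tendsto_solution hl0 hx' h0 ht₀ hs
  -- Rescales `k` periods of the solution to exactly `m` periods of the unperturbed flow.
  let κ : ℝ → ℝ := fun ε => k * T ε / multiPeriod m
  have hκ : Tendsto κ l (𝓝 1) := by
    have := (hT.const_mul (k : ℝ)).div_const (multiPeriod m)
    rwa [hk, div_self hL.ne'] at this
  let y : ℝ → Curves m n := fun ε =>
    if h : ∀ t, HasDerivAt (x ε) (field A b ε (x ε t)) t then solutionCurve m h (κ ε) (s ε) else 0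
  have hy : Tendsto y l (𝓝 (ContinuousMap.const _ v)) := by
    refine Metric.tendsto_nhds.2 fun δ hδ => ?_
    filter_upwards [eventually_rotCurve_close hl0 hx' hκ hxs (multiPeriod m) (half_pos hδ), hx']
      with ε h hxε
    rw [dist_eq_norm]
    refine lt_of_le_of_lt ?_ (half_lt_self hδ)
    refine (ContinuousMap.norm_le _ (half_pos hδ).le).2 fun t => ?_
    simp only [y, dif_pos hxε]
    exact h t t.2
  let σ : ℝ → ℝ := fun ε => (κ ε - 1) / ε
  have hzero : ∀ᶠ ε in l, bifurcationMap A b m (ε, y ε, x ε (s ε), σ ε) = (ε, 0, 0, 0) := by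
    filter_upwards [hx, hne, hsz] with ε hxε hε hz
    simp only [y, dif_pos hxε.2.1]
    refine bifurcationMap_solutionCurve hε hxε.2.1 ?_ hz
    rw [div_mul_cancel₀ _ hL.ne', add_comm]
    have := hxε.2.2.1.nat_mul k (s ε)
    exact this
  -- convergence of the terms of the periodicity condition
  let V : ℝ → Phase n := fun ε => (centerKernel n).integralOperator m (y ε) (endTime m)
  let P : ℝ → Phase n := fun ε => perturbationOperator A b m (y ε) (endTime m)
  have hend : Continuous fun z : Curves m n => z (endTime m) :=
    (ContinuousMap.evalCLM ℝ (endTime m) : Curves m n →L[ℝ] Phase n).continuous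
  have hV : Tendsto V l (𝓝 ((m : ℝ) • (2 * Real.pi) • centerMap n v)) := by
    rw [← center_integralOperator_const_endTime]
    exact (hend.tendsto _).comp
      ((((centerKernel n).integralOperator m).continuous.tendsto _).comp hy)
  have hP : Tendsto P l (𝓝 ((m : ℝ) • averagedField A b v)) := by
    rw [← perturbationOperator_const_endTime]
    exact (hend.tendsto _).comp
      ((hasStrictFDerivAt_perturbationOperator A b m hw₁).continuousAt.tendsto.comp hy)
  have heq : ∀ᶠ ε in l, σ ε • V ε + κ ε • P ε = 0 := by
    filter_upwards [hzero, hne] with ε h hε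
    have h₁ : driftOperator A b m ε (y ε) (σ ε) (endTime m) = 0 :=
      congrArg (fun u : BifurcationSpace m n => u.2.2.1) h
    have h₂ : 1 + ε * σ ε = κ ε := by
      simp only [σ]; rw [mul_div_cancel₀ _ hε]; ring
    rw [driftOperator, h₂] at h₁
    exact h₁
  have hcoord : ∀ {f : ℝ → Phase n} {z : Phase n}, Tendsto f l (𝓝 z) →
      Tendsto (fun ε => f ε (0, 1)) l (𝓝 (z (0, 1))) := fun hf =>
    ((continuous_apply ((0 : Fin n), (1 : Fin 2))).tendsto _).comp hf
  -- Nothing bounds `σ ε = (κ ε - 1) / ε` beforehand. In this coordinate the factor of `σ ε` has a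
  -- nonzero limit, so the periodicity condition can be solved for `σ ε` and yields its convergence.
  have hV0 : ((m : ℝ) • (2 * Real.pi) • centerMap n v) (0, 1) ≠ 0 := by
    rw [Pi.smul_apply, Pi.smul_apply, centerMap_one, freq_zero, one_mul]
    have : (m : ℝ) ≠ 0 := by exact_mod_cast hm
    exact mul_ne_zero this (mul_ne_zero Real.two_pi_pos.ne' hw₀.ne')
  let σ₀ : ℝ := -(1 * ((m : ℝ) • averagedField A b v) (0, 1)) /
    ((m : ℝ) • (2 * Real.pi) • centerMap n v) (0, 1)
  have hσ : Tendsto σ l (𝓝 σ₀) := by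
    refine (((hκ.mul (hcoord hP)).neg).div (hcoord hV) hV0).congr' ?_
    filter_upwards [heq, (hcoord hV).eventually_ne hV0] with ε h h0
    have h₁ := congrFun h (0, 1)
    simp only [Pi.add_apply, Pi.smul_apply, smul_eq_mul, Pi.zero_apply] at h₁
    change -(κ ε * P ε (0, 1)) / V ε (0, 1) = σ ε
    rw [div_eq_iff h0]
    linarith
  have hlim : σ₀ • (m : ℝ) • (2 * Real.pi) • centerMap n v +
      (1 : ℝ) • (m : ℝ) • averagedField A b v = 0 := by
    refine tendsto_nhds_unique ((hσ.smul hV).add (hκ.smul hP)) ?_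
    exact tendsto_const_nhds.congr' (heq.mono fun ε h => h.symm)
  refine ⟨σ₀, s, fun ε => (ε, y ε, x ε (s ε), σ ε), ?_, ?_, ?_⟩
  · have hm' : (m : ℝ) ≠ 0 := by exact_mod_cast hm
    have : (m : ℝ) • (averagedField A b v + (2 * Real.pi * σ₀) • centerMap n v) = 0 := by
      rw [← hlim]
      module
    exact (smul_eq_zero.1 this).resolve_left hm'
  · exact hl0.prodMk_nhds (hy.prodMk_nhds (hxs.prodMk_nhds hσ))
  · filter_upwards [hzero] with ε h using ⟨rfl, h⟩

/-! ### Uniqueness of the bifurcating limit cycle -/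

/-- Turn back by the argument of the first pair, after adding a full turn to make the time positive.
-/
theorem exists_rot_normal {w : Phase n} (hw : w (0, 0) ≠ 0 ∨ w (0, 1) ≠ 0) :
    ∃ t₀ > 0, rot n t₀ w (0, 1) = 0 ∧ 0 < rot n t₀ w (0, 0) := by
  let z : ℂ := ⟨w (0, 0), w (0, 1)⟩
  have hz : z ≠ 0 := by
    rintro h
    rcases hw with hw | hw
    · exact hw (congrArg Complex.re h)
    · exact hw (congrArg Complex.im h)
  have hre : w (0, 0) = ‖z‖ * Real.cos z.arg := (Complex.norm_mul_cos_arg z).symm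
  have him : w (0, 1) = ‖z‖ * Real.sin z.arg := (Complex.norm_mul_sin_arg z).symm
  refine ⟨2 * Real.pi - z.arg, by linarith [Complex.arg_le_pi z, Real.pi_pos], ?_, ?_⟩
  · rw [rot_apply_one, freq_zero, one_mul, Real.sin_two_pi_sub, Real.cos_two_pi_sub, hre, him]
    ring
  · rw [rot_apply_zero, freq_zero, one_mul, Real.sin_two_pi_sub, Real.cos_two_pi_sub, hre, him]
    have : 0 < ‖z‖ := norm_pos_iff.2 hz
    nlinarith [Real.sin_sq_add_cos_sq z.arg]

/-- Limit cycles cannot bifurcate from orbits on which the first coordinate vanishes. -/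
theorem BifurcatesFrom.first_block_ne_zero {l : Filter ℝ} [l.NeBot] (hl : l ≤ 𝓝[≠] 0)
    {Γ : ℝ → Set (Phase n)} {x₀ : Phase n} {T₀ : ℝ} (h : BifurcatesFrom A b l Γ x₀ T₀) :
    x₀ (0, 0) ≠ 0 ∨ x₀ (0, 1) ≠ 0 := by
  by_contra! hzero
  obtain ⟨_, _, x, T, hev, h0, hT⟩ := h
  have hl0 : Tendsto id l (𝓝 (0 : ℝ)) := hl.trans nhdsWithin_le_nhds
  have hx' : ∀ᶠ ε in l, ∀ t, HasDerivAt (x ε) (field A b ε (x ε t)) t :=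
    hev.mono fun ε h => h.2.1.2.1
  -- Rotation at most doubles the distance `1 / 4`, so the first coordinate stays below `1`; the
  -- time `T₀ + 1` covers a whole period.
  obtain ⟨ε, ⟨hlim, hper, hrange⟩, hclose, hTε⟩ := (hev.and ((eventually_rotCurve_close hl0 hx'
    (κ := fun _ => 1) (s := fun _ => 0) tendsto_const_nhds h0 (T₀ + 1)
    (by norm_num : (0 : ℝ) < 1 / 4)).and (hT.eventually (gt_mem_nhds (lt_add_one T₀))))).exists
  refine not_isLimitCycle_of_abs_lt_one ?_ hlim
  rw [← hrange, ← hper.2.2.1.image_Icc hper.1 0]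
  rintro _ ⟨t, ht, rfl⟩
  have h₁ : x ε t = rot n t (rotCurve (x ε) 1 0 t) := by simp [rot_rotCurve]
  have h₂ : rot n t x₀ (0, 0) = 0 := by simp [hzero.1, hzero.2]
  have h₃ : x ε t (0, 0) = rot n t (rotCurve (x ε) 1 0 t - x₀) (0, 0) := by
    rw [map_sub, Pi.sub_apply, h₂, sub_zero, ← h₁]
  rw [h₃]
  have h₄ := hclose t ⟨ht.1, by linarith [ht.2]⟩
  linarith [abs_rot_apply_le t (rotCurve (x ε) 1 0 t - x₀) (0, 0)]

/-- In the limit `T₀` is a period of the unperturbed orbit, whose first block is nonzero and has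
frequency `1`. -/
theorem BifurcatesFrom.exists_period_eq {l : Filter ℝ} [l.NeBot] (hl : l ≤ 𝓝[≠] 0)
    {Γ : ℝ → Set (Phase n)} {x₀ : Phase n} {T₀ : ℝ} (h : BifurcatesFrom A b l Γ x₀ T₀) :
    ∃ q : ℕ, q ≠ 0 ∧ T₀ = multiPeriod q := by
  have hne := h.first_block_ne_zero hl
  obtain ⟨_, hT₀, x, T, hev, h0, hT⟩ := h
  have hl0 : Tendsto id l (𝓝 (0 : ℝ)) := hl.trans nhdsWithin_le_nhds
  have hx' : ∀ᶠ ε in l, ∀ t, HasDerivAt (x ε) (field A b ε (x ε t)) t :=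
    hev.mono fun ε h => h.2.1.2.1
  have h₁ := tendsto_solution hl0 hx' h0 hT₀ hT
  have h₂ : rot n T₀ x₀ = x₀ := by
    refine tendsto_nhds_unique h₁ (h0.congr' ?_)
    filter_upwards [hev] with ε hε
    simpa using (hε.2.1.2.2.1 0).symm
  have e₀ := congrFun h₂ (0, 0)
  have e₁ := congrFun h₂ (0, 1)
  rw [rot_apply_zero, freq_zero, one_mul] at e₀
  rw [rot_apply_one, freq_zero, one_mul] at e₁
  have hcos : Real.cos T₀ = 1 := by
    have hpos : x₀ (0, 0) ^ 2 + x₀ (0, 1) ^ 2 ≠ 0 := by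
      rcases hne with h | h <;> positivity
    refine mul_right_cancel₀ hpos ?_
    linear_combination x₀ (0, 0) * e₀ + x₀ (0, 1) * e₁
  obtain ⟨k, hk⟩ := (Real.cos_eq_one_iff T₀).1 hcos
  have hk0 : 0 < k := by
    have : (0 : ℝ) < k := by
      by_contra! hle
      nlinarith [Real.two_pi_pos]
    exact_mod_cast this
  lift k to ℕ using hk0.le
  refine ⟨k, ?_, ?_⟩
  · rintro rfl; exact absurd hk0 (by simp)
  · rw [← hk, multiPeriod]; simp

/-- The limit periods `2πq` and `2πq'` may differ, so both families are followed over `q q'`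
periods. They then solve the same bifurcation equations and, by `IsNondegenerate.unique`, converge
to the same point, where the map is locally injective. -/
theorem IsNondegenerate.atMostOneBifurcates {σ : ℝ} {w : Phase n} (h : IsNondegenerate A b σ w) :
    AtMostOneBifurcates A b {x | x ≠ 0} := by
  intro l hl Γ Γ' x₀ x₀' T₀ T₀' _ _ hΓ hΓ'
  rcases l.eq_or_neBot with rfl | hbot
  · exact eventually_bot
  obtain ⟨q, hq, hqT⟩ := hΓ.exists_period_eq hl
  obtain ⟨q', hq', hqT'⟩ := hΓ'.exists_period_eq hl
  obtain ⟨t₀, ht₀, hw₁, hw₀⟩ := exists_rot_normal (hΓ.first_block_ne_zero hl)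
  obtain ⟨t₀', ht₀', hw₁', hw₀'⟩ := exists_rot_normal (hΓ'.first_block_ne_zero hl)
  obtain ⟨_, _, x, T, hev, h0, hT⟩ := hΓ
  obtain ⟨_, _, x', T', hev', h0', hT'⟩ := hΓ'
  have hm : q * q' ≠ 0 := mul_ne_zero hq hq'
  obtain ⟨σ₁, s, u, hae, hu, hu0⟩ := exists_tendsto_bifurcationSpace hl (hev.mono fun ε h => h.2.1)
    h0 hT ht₀ hw₁ hw₀ (m := q * q') (k := q') hm (by rw [hqT, multiPeriod, multiPeriod]; push_cast; ring)
  obtain ⟨σ₁', s', u', hae', hu', hu0'⟩ := exists_tendsto_bifurcationSpace hl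
    (hev'.mono fun ε h => h.2.1) h0' hT' ht₀' hw₁' hw₀' (m := q * q') (k := q) hm
    (by rw [hqT', multiPeriod, multiPeriod]; push_cast; ring)
  obtain ⟨e₁, e₂⟩ := h.unique hae hw₁ hw₀
  obtain ⟨e₁', e₂'⟩ := h.unique hae' hw₁' hw₀'
  rw [e₁, e₂] at hu
  rw [e₁', e₂'] at hu'
  obtain ⟨D, hD⟩ := h.exists_equiv hm
  have hinv := hD.eventually_left_inverse
  filter_upwards [hu0, hu0', hu.eventually hinv, hu'.eventually hinv, hev, hev']
    with ε ⟨h₁, h₂⟩ ⟨h₁', h₂'⟩ h₃ h₃' h₄ h₄'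
  have huu : u ε = u' ε := by rw [← h₃, ← h₃', h₂, h₂']
  rw [← h₄.2.2, ← h₄'.2.2]
  exact range_eq_of_eq h₄.2.1.2.1 h₄'.2.1.2.1 (s := s ε) (s' := s' ε) (by rw [← h₁, ← h₁', huu])

theorem polar_ne_zero {θ : ℝ} {p : Slow n} (hp : p ∈ slowDomain n) : polar θ p ≠ 0 := by
  intro h
  rw [polar_eq_rot] at h
  have h₁ : polar 0 p = 0 := by
    rw [← rot_neg_rot θ (polar 0 p), h, map_zero]
  have h₂ := congrFun h₁ (0, 0)
  rw [polar_zero_zero_zero] at h₂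
  exact (hp 0).ne' h₂

theorem atMostOneBifurcates_of_isIsolatedZero {p : Slow n} (hp : p ∈ slowDomain n)
    (h : IsIsolatedZero A b p) : AtMostOneBifurcates A b {x | x ≠ 0} := by
  obtain ⟨σ, hσ⟩ := h.exists_isNondegenerate hp
  exact hσ.atMostOneBifurcates

/-- A periodic orbit in the domain of the polar coordinates from which limit cycles bifurcate
gives a zero of the averaged function. -/
theorem BifurcatesFrom.averaged_eq_zero {l : Filter ℝ} [l.NeBot] (hl : l ≤ 𝓝[≠] 0)
    {Γ : ℝ → Set (Phase n)} {θ : ℝ} {p : Slow n} (hp : p ∈ slowDomain n) {T₀ : ℝ}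
    (h : BifurcatesFrom A b l Γ (polar θ p) T₀) : averaged A b p = 0 := by
  obtain ⟨q, hq, hqT⟩ := h.exists_period_eq hl
  obtain ⟨_, _, x, T, hev, h0, hT⟩ := h
  obtain ⟨k, hk⟩ := exists_nat_gt θ
  have ht₀ : 0 < -θ + k * (2 * Real.pi) := by
    have : (0 : ℝ) ≤ k := k.cast_nonneg
    nlinarith [Real.pi_gt_three]
  have hw : rot n (-θ + k * (2 * Real.pi)) (polar θ p) = polar 0 p := by
    rw [rot_add_period, polar_eq_rot θ, rot_neg_rot]
  obtain ⟨σ, _, _, hae, _⟩ := exists_tendsto_bifurcationSpace hl (hev.mono fun ε h => h.2.1)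
    h0 hT ht₀ (by rw [hw, polar_zero_zero_one]) (by rw [hw, polar_zero_zero_zero]; exact hp 0)
    (m := q) (k := 1) hq (by rw [hqT]; simp)
  rw [hw] at hae
  exact averaged_eq_zero_of_averagedEquation hp hae

theorem atMostOneBifurcates_of_forall_isIsolatedZero
    (h : ∀ p ∈ slowDomain n, averaged A b p = 0 → IsIsolatedZero A b p) :
    AtMostOneBifurcates A b {x | ∃ θ, ∃ p ∈ slowDomain n, x = polar θ p} := by
  intro l hl Γ Γ' x₀ x₀' T₀ T₀' ⟨θ, p, hp, hx₀⟩ ⟨θ', p', hp', hx₀'⟩ hΓ hΓ'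
  rcases l.eq_or_neBot with rfl | hbot
  · exact eventually_bot
  subst hx₀ hx₀'
  have hz := hΓ.averaged_eq_zero hl hp
  exact atMostOneBifurcates_of_isIsolatedZero hp (h p hp hz) l hl Γ Γ' _ _ T₀ T₀'
    (polar_ne_zero hp) (polar_ne_zero hp') hΓ hΓ'

end

section

variable {n : ℕ}

/-! ### Existence of bifurcating periodic solutions -/

/-- A solution of an autonomous equation on a compact interval with equal values at the endpoints
extends to a periodic solution. -/
theorem exists_periodic_extension {f : Phase n → Phase n} {z : ℝ → Phase n} {T : ℝ} (hT : 0 < T)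
    (hz : ∀ t ∈ Set.Icc 0 T, HasDerivAt z (f (z t)) t) (hzT : z T = z 0) :
    ∃ x : ℝ → Phase n, (∀ t, HasDerivAt x (f (x t)) t) ∧ Function.Periodic x T ∧
      ∀ t ∈ Set.Ico 0 T, x t = z t := by
  let x : ℝ → Phase n := fun t => z (toIcoMod hT 0 t)
  have hper : Function.Periodic x T := fun t => by simp [x]
  have hx : ∀ t ∈ Set.Ico 0 T, x t = z t := fun t ht => by
    have : toIcoMod hT 0 t = t := (toIcoMod_eq_self hT).2 (by simpa using ht)
    simp only [x, this]
  have hbase : ∀ t ∈ Set.Ico 0 T, HasDerivAt x (f (x t)) t := by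
    intro t ht
    rw [hx t ht]
    rcases ht.1.eq_or_lt with rfl | h0
    · have hright : HasDerivWithinAt x (f (z 0)) (Set.Ici 0) 0 := by
        refine ((hz 0 ⟨le_rfl, hT.le⟩).hasDerivWithinAt).congr_of_eventuallyEq ?_ (hx 0 ht)
        filter_upwards [Ico_mem_nhdsGE hT] with s hs using hx s hs
      have hleft : HasDerivWithinAt x (f (z 0)) (Set.Iic 0) 0 := by
        have h₁ : HasDerivAt (fun t => z (t + T)) (f (z 0)) 0 := by
          have := hz T ⟨hT.le, le_rfl⟩
          rw [hzT] at this
          exact HasDerivAt.comp_add_const 0 T (by rwa [zero_add])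
        refine h₁.hasDerivWithinAt.congr_of_eventuallyEq ?_ ?_
        · filter_upwards [Ioc_mem_nhdsLE (neg_lt_zero.2 hT)] with s hs
          rcases hs.2.eq_or_lt with rfl | hs0
          · rw [zero_add, hzT, hx 0 ht]
          · rw [← hper s, hx]
            exact ⟨by linarith [hs.1], by linarith⟩
        · rw [zero_add, hzT, hx 0 ht]
      have := hleft.union hright
      rwa [Set.Iic_union_Ici, hasDerivWithinAt_univ] at this
    · refine (hz t ⟨ht.1, ht.2.le⟩).congr_of_eventuallyEq ?_
      filter_upwards [Ioo_mem_nhds h0 ht.2] with s hs using hx s ⟨hs.1.le, hs.2⟩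
  refine ⟨x, fun t => ?_, hper, hx⟩
  have hmem := toIcoMod_mem_Ico' hT t
  have h₁ := hbase _ hmem
  have hsub : toIcoMod hT 0 t = t - toIcoDiv hT 0 t • T := rfl
  have hshift : ∀ s, x (s - toIcoDiv hT 0 t • T) = x s := fun s => hper.sub_zsmul_eq _
  rw [hsub, hshift] at h₁
  have h₂ := HasDerivAt.comp_sub_const t (toIcoDiv hT 0 t • T) h₁
  simpa only [hshift] using h₂

variable [NeZero n] {A : Mat n} {b : Phase n}

/-- Solutions of the bifurcation equations over one period give periodic solutions. -/
theorem exists_periodic_of_bifurcationMap_eq {ε σ : ℝ} {y : Curves 1 n} {w : Phase n}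
    (h : bifurcationMap A b 1 (ε, y, w, σ) = (ε, 0, 0, 0)) (hκ : 0 < 1 + ε * σ) :
    ∃ x : ℝ → Phase n, (∀ t, HasDerivAt x (field A b ε (x t)) t) ∧
      Function.Periodic x ((1 + ε * σ) * (2 * Real.pi)) ∧
      ∀ t ∈ Set.Ico 0 (2 * Real.pi), x ((1 + ε * σ) * t) = rot n t (extendCurve y t) := by
  set κ := 1 + ε * σ
  have hL : multiPeriod 1 = 2 * Real.pi := by simp [multiPeriod]
  have h₁ : y - ContinuousMap.const _ w - ε • driftOperator A b 1 ε y σ = 0 :=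
    congrArg (fun u : BifurcationSpace 1 n => u.2.1) h
  have h₂ : driftOperator A b 1 ε y σ (endTime 1) = 0 :=
    congrArg (fun u : BifurcationSpace 1 n => u.2.2.1) h
  let N : ℝ → Phase n := fun s => σ • centerMap n (extendCurve y s) +
    κ • rotatingField A b s (extendCurve y s)
  have hN : Continuous N := by
    have h₁ : Continuous fun s => centerMap n (extendCurve y s) :=
      (centerMap n).continuous.comp (continuous_extendCurve y)
    have h₂ := continuous_rotatingField_curve A b y
    fun_prop
  -- A differentiable function on the whole line that agrees with `y` on the interval, so that
  -- derivatives exist at the endpoints too.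
  let Y : ℝ → Phase n := fun t => w + ε • ∫ s in (0 : ℝ)..t, N s
  have hY : ∀ t, HasDerivAt Y (ε • N t) t := fun t =>
    ((intervalIntegral.integral_hasDerivAt_right (hN.intervalIntegrable _ _)
      (hN.stronglyMeasurableAtFilter _ _) hN.continuousAt).const_smul ε).const_add w
  have hYy : ∀ t ∈ Set.Icc 0 (2 * Real.pi), extendCurve y t = Y t := by
    intro t ht
    rw [← hL] at ht
    have h₃ := congrArg (fun z : Curves 1 n => z ⟨t, ht⟩) h₁
    simp only [ContinuousMap.sub_apply, ContinuousMap.smul_apply, driftOperator_apply,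
      ContinuousMap.const_apply, ContinuousMap.zero_apply] at h₃
    rw [extendCurve_of_mem y ht]
    rw [sub_sub, sub_eq_zero] at h₃
    exact h₃
  have hYend : Y (2 * Real.pi) = Y 0 := by
    have : ∫ s in (0 : ℝ)..(2 * Real.pi), N s = 0 := by
      rw [driftOperator_apply] at h₂
      simpa only [endTime, hL] using h₂
    simp only [Y, this, intervalIntegral.integral_same]
  -- Undo the change of time and the rotation.
  let z : ℝ → Phase n := fun t => rot n (κ⁻¹ * t) (Y (κ⁻¹ * t))
  have hκ' := hκ.ne'
  have hz : ∀ t ∈ Set.Icc 0 (κ * (2 * Real.pi)), HasDerivAt z (field A b ε (z t)) t := by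
    intro t ht
    have hmem : κ⁻¹ * t ∈ Set.Icc 0 (2 * Real.pi) := by
      refine ⟨by have := ht.1; positivity, ?_⟩
      rw [inv_mul_le_iff₀ hκ]
      exact ht.2
    have hτ : HasDerivAt (fun t => κ⁻¹ * t) κ⁻¹ t := by
      simpa using (hasDerivAt_id t).const_mul κ⁻¹
    refine (hasDerivAt_rot_comp hτ ((hY (κ⁻¹ * t)).scomp t hτ)).congr_deriv ?_
    change _ = field A b ε (rot n (κ⁻¹ * t) (Y (κ⁻¹ * t)))
    simp only [Function.comp_apply, N, hYy _ hmem, field_eq, rotatingField, map_smul, map_add, rot_centerMap,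
      rot_rot_neg]
    have e : κ⁻¹ + κ⁻¹ * (ε * σ) = 1 := by
      rw [← mul_one_add, inv_mul_cancel₀ hκ']
    calc _ = (κ⁻¹ + κ⁻¹ * (ε * σ)) • centerMap n (rot n (κ⁻¹ * t) (Y (κ⁻¹ * t))) +
          (κ⁻¹ * κ * ε) • perturbation A b (rot n (κ⁻¹ * t) (Y (κ⁻¹ * t))) := by module
      _ = _ := by rw [e, inv_mul_cancel₀ hκ', one_smul, one_mul]
  obtain ⟨x, hx, hper, hxz⟩ := exists_periodic_extension (mul_pos hκ Real.two_pi_pos) hz (by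
    simp only [z, inv_mul_cancel_left₀ hκ', hYend, mul_zero, rot_zero]
    simpa using rot_add_period 0 1 (Y 0))
  refine ⟨x, hx, hper, fun t ht => ?_⟩
  rw [hxz _ ⟨mul_nonneg hκ.le ht.1, mul_lt_mul_of_pos_left ht.2 hκ⟩]
  simp only [z, inv_mul_cancel_left₀ hκ', hYy t ⟨ht.1, ht.2.le⟩]

/-- Near a nondegenerate solution of the averaged equations there is a family of periodic
solutions. -/
theorem IsNondegenerate.exists_periodicSolutions {σ : ℝ} {w : Phase n}
    (h : IsNondegenerate A b σ w) : ∃ (x : ℝ → ℝ → Phase n) (T : ℝ → ℝ),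
      (∀ᶠ ε in 𝓝[≠] 0, IsPeriodicSolution (field A b ε) (x ε) (T ε)) ∧
      Tendsto (fun ε => x ε 0) (𝓝[≠] 0) (𝓝 w) ∧ Tendsto T (𝓝[≠] 0) (𝓝 (2 * Real.pi)) := by
  classical
  obtain ⟨D, hD⟩ := h.exists_equiv one_ne_zero (m := 1)
  set u₀ : BifurcationSpace 1 n := (0, ContinuousMap.const _ w, w, σ)
  have hu₀ : bifurcationMap A b 1 u₀ = (0, 0, 0, 0) := by
    refine Prod.ext rfl (Prod.ext ?_ (Prod.ext ?_ h.im_eq_zero))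
    · simp [bifurcationMap, u₀]
    · change driftOperator A b 1 0 (ContinuousMap.const _ w) σ (endTime 1) = 0
      have := h.eq
      rw [AveragedEquation] at this
      rw [driftOperator, ContinuousMap.add_apply, ContinuousMap.smul_apply,
        ContinuousMap.smul_apply, center_integralOperator_const_endTime,
        perturbationOperator_const_endTime, ← this]
      module
  let g := hD.localInverse
  have hg : Tendsto g (𝓝 (0, 0, 0, 0)) (𝓝 u₀) := by
    have := hD.localInverse_tendsto
    rwa [hu₀] at this
  have hinv : ∀ᶠ v in 𝓝 (0, 0, 0, 0), bifurcationMap A b 1 (g v) = v := by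
    have := hD.eventually_right_inverse
    rwa [hu₀] at this
  have hι : Tendsto (fun ε : ℝ => ((ε, 0, 0, 0) : BifurcationSpace 1 n)) (𝓝[≠] 0)
      (𝓝 (0, 0, 0, 0)) := by
    have : Continuous fun ε : ℝ => ((ε, 0, 0, 0) : BifurcationSpace 1 n) := by fun_prop
    exact (this.tendsto 0).mono_left nhdsWithin_le_nhds
  let u : ℝ → BifurcationSpace 1 n := fun ε => g (ε, 0, 0, 0)
  have hu : Tendsto u (𝓝[≠] 0) (𝓝 u₀) := hg.comp hι
  have hmap : ∀ᶠ ε in 𝓝[≠] 0, bifurcationMap A b 1 (u ε) = (ε, 0, 0, 0) := hι.eventually hinv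
  have hy : Tendsto (fun ε => (u ε).2.1) (𝓝[≠] 0) (𝓝 (ContinuousMap.const _ w)) :=
    (Continuous.tendsto (by fun_prop : Continuous fun u : BifurcationSpace 1 n => u.2.1) u₀).comp
      hu
  have hσ : Tendsto (fun ε => (u ε).2.2.2) (𝓝[≠] 0) (𝓝 σ) :=
    (Continuous.tendsto (by fun_prop : Continuous fun u : BifurcationSpace 1 n => u.2.2.2) u₀).comp
      hu
  have hκ : Tendsto (fun ε => 1 + ε * (u ε).2.2.2) (𝓝[≠] 0) (𝓝 1) := by
    have h0 : Tendsto (fun ε : ℝ => ε) (𝓝[≠] 0) (𝓝 0) := nhdsWithin_le_nhds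
    simpa using (h0.mul hσ).const_add 1
  have hex : ∀ ε, ∃ x : ℝ → Phase n, bifurcationMap A b 1 (u ε) = (ε, 0, 0, 0) →
      0 < 1 + ε * (u ε).2.2.2 → (∀ t, HasDerivAt x (field A b ε (x t)) t) ∧
      Function.Periodic x ((1 + ε * (u ε).2.2.2) * (2 * Real.pi)) ∧
      ∀ t ∈ Set.Ico 0 (2 * Real.pi),
        x ((1 + ε * (u ε).2.2.2) * t) = rot n t (extendCurve (u ε).2.1 t) := by
    intro ε
    by_cases hε : bifurcationMap A b 1 (u ε) = (ε, 0, 0, 0) ∧ 0 < 1 + ε * (u ε).2.2.2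
    · have h₁ : (u ε).1 = ε := congrArg Prod.fst hε.1
      obtain ⟨x, hx⟩ := exists_periodic_of_bifurcationMap_eq (ε := ε) (σ := (u ε).2.2.2)
        (y := (u ε).2.1) (w := (u ε).2.2.1) (by
          rw [← hε.1]; congr 1; exact Prod.ext h₁.symm rfl) hε.2
      exact ⟨x, fun _ _ => hx⟩
    · exact ⟨0, fun h₁ h₂ => absurd ⟨h₁, h₂⟩ hε⟩
  choose x hx using hex
  have hpos := hκ.eventually (lt_mem_nhds one_pos)
  have hx0 : ∀ᶠ ε in 𝓝[≠] 0, extendCurve (u ε).2.1 0 = x ε 0 := by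
    filter_upwards [hmap, hpos] with ε h₁ h₂
    have := (hx ε h₁ h₂).2.2 0 ⟨le_rfl, Real.two_pi_pos⟩
    rw [mul_zero, rot_zero] at this
    exact this.symm
  have heval : ∀ t, Tendsto (fun ε => extendCurve (u ε).2.1 t) (𝓝[≠] 0) (𝓝 w) := by
    intro t
    have hc : Continuous fun y : Curves 1 n => extendCurve y t :=
      (ContinuousMap.evalCLM ℝ (Set.projIcc 0 (multiPeriod 1) (multiPeriod_nonneg 1) t) :
        Curves 1 n →L[ℝ] Phase n).continuous
    exact (hc.tendsto (ContinuousMap.const _ w)).comp hy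
  -- Used to exclude constant solutions: after half a turn the first coordinate is negative.
  have hcoord : ∀ t, ∀ᶠ ε in 𝓝[≠] 0, 0 < extendCurve (u ε).2.1 t (0, 0) := by
    intro t
    have := ((continuous_apply ((0 : Fin n), (0 : Fin 2))).tendsto w).comp (heval t)
    exact this.eventually (lt_mem_nhds (one_pos.trans h.one_lt))
  refine ⟨x, fun ε => (1 + ε * (u ε).2.2.2) * (2 * Real.pi), ?_, (heval 0).congr' hx0, ?_⟩
  · filter_upwards [hmap, hpos, hx0, hcoord 0, hcoord Real.pi] with ε h₁ h₂ h₃ h₄ h₅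
    obtain ⟨hsol, hper, hval⟩ := hx ε h₁ h₂
    refine ⟨mul_pos h₂ Real.two_pi_pos, hsol, hper, (1 + ε * (u ε).2.2.2) * Real.pi, fun e => ?_⟩
    rw [hval Real.pi ⟨Real.pi_pos.le, by linarith [Real.pi_pos]⟩, ← h₃] at e
    have e' := congrFun e (0, 0)
    rw [rot_apply_zero, freq_zero, one_mul, Real.cos_pi, Real.sin_pi] at e'
    linarith
  · simpa using hκ.mul_const (2 * Real.pi)

end

section

/-! ### Parametrization of planar curves by the angle -/

/-- A nonvanishing differentiable curve in the complex plane has a differentiable logarithm. -/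
theorem exists_log_lift {z q : ℝ → ℂ} (hz : ∀ t, HasDerivAt z (z t * q t) t) (hq : Continuous q)
    (h0 : z 0 ≠ 0) :
    ∃ ζ : ℝ → ℂ, (∀ t, HasDerivAt ζ (q t) t) ∧ ∀ t, z t = Complex.exp (ζ t) := by
  let ζ : ℝ → ℂ := fun t => Complex.log (z 0) + ∫ s in (0 : ℝ)..t, q s
  have hζ : ∀ t, HasDerivAt ζ (q t) t := fun t =>
    (intervalIntegral.integral_hasDerivAt_right (hq.intervalIntegrable _ _)
      (hq.stronglyMeasurableAtFilter _ _) hq.continuousAt).const_add _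
  refine ⟨ζ, hζ, fun t => ?_⟩
  have hder : ∀ t, HasDerivAt (fun t => z t * Complex.exp (-ζ t)) 0 t := fun t => by
    refine ((hz t).mul (hζ t).neg.cexp).congr_deriv ?_
    ring
  have hconst := is_const_of_deriv_eq_zero (fun t => (hder t).differentiableAt)
    (fun t => (hder t).deriv) t 0
  have hζ0 : ζ 0 = Complex.log (z 0) := by simp [ζ]
  simp only [hζ0, Complex.exp_neg, Complex.exp_log h0, mul_inv_cancel₀ h0] at hconst
  exact (mul_inv_eq_one₀ (Complex.exp_ne_zero _)).1 hconst

/-- A periodic planar curve that turns around the origin with positive angular velocity can be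
parametrized by its angle. -/
theorem exists_angle_parametrization {z q : ℝ → ℂ} (hz : ∀ t, HasDerivAt z (z t * q t) t)
    (hq : Continuous q) (h0 : z 0 ≠ 0) (him : ∀ t, 1 / 2 ≤ (q t).im) {T : ℝ} (hT : 0 < T)
    (hzT : Function.Periodic z T) (hqT : Function.Periodic q T) :
    ∃ τ ℓ : ℝ → ℝ, (∀ φ, z (τ φ) = Complex.exp (ℓ φ + φ * Complex.I)) ∧
      (∀ φ, HasDerivAt ℓ ((q (τ φ)).re / (q (τ φ)).im) φ) ∧
      ∃ k : ℕ, k ≠ 0 ∧ Function.Periodic ℓ (k * (2 * Real.pi)) := by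
  obtain ⟨ζ, hζ, hzζ⟩ := exists_log_lift hz hq h0
  have hre : ∀ t, HasDerivAt (fun t => (ζ t).re) (q t).re t := fun t =>
    Complex.reCLM.hasFDerivAt.comp_hasDerivAt t (hζ t)
  have hθ : ∀ t, HasDerivAt (fun t => (ζ t).im) (q t).im t := fun t =>
    Complex.imCLM.hasFDerivAt.comp_hasDerivAt t (hζ t)
  have hθc : Continuous fun t => (ζ t).im :=
    continuous_iff_continuousAt.2 fun t => (hθ t).continuousAt
  -- Angular velocity at least `1 / 2` makes the angle strictly increasing and onto, hence
  -- invertible.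
  have hgrow : Monotone fun t => (ζ t).im - 1 / 2 * t := by
    refine monotone_of_hasDerivAt_nonneg (f' := fun t => (q t).im - 1 / 2 * 1) (fun t =>
      (hθ t).sub ((hasDerivAt_id t).const_mul (1 / 2))) fun t => ?_
    simp only [Pi.zero_apply]
    linarith [him t]
  have hmono : StrictMono fun t => (ζ t).im := fun s t hst => by
    have := hgrow hst.le
    simp only at this ⊢
    linarith
  have hsurj : Function.Surjective fun t => (ζ t).im := by
    refine hθc.surjective ?_ ?_
    · refine tendsto_atTop_mono' atTop (f₁ := fun t => (ζ 0).im + 1 / 2 * t) ?_ ?_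
      · filter_upwards [eventually_ge_atTop 0] with t ht
        have := hgrow ht
        simp only at this
        linarith
      · exact tendsto_atTop_add_const_left _ _ (tendsto_id.const_mul_atTop (by norm_num))
    · refine tendsto_atBot_mono' atBot (f₁ := fun t => (ζ 0).im + 1 / 2 * t) ?_ ?_
      · filter_upwards [eventually_le_atBot 0] with t ht
        have := hgrow ht
        simp only at this
        linarith
      · exact tendsto_atBot_add_const_left _ _ (tendsto_id.const_mul_atBot (by norm_num))
  let e : ℝ ≃o ℝ := hmono.orderIsoOfSurjective _ hsurj
  let τ : ℝ → ℝ := e.symm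
  have hτ : ∀ φ, (ζ (τ φ)).im = φ := fun φ => e.apply_symm_apply φ
  have hτ' : ∀ t, τ (ζ t).im = t := fun t => e.symm_apply_apply t
  have hτd : ∀ φ, HasDerivAt τ ((q (τ φ)).im)⁻¹ φ := fun φ =>
    (hθ (τ φ)).of_local_left_inverse e.symm.continuous.continuousAt (by linarith [him (τ φ)])
      (Eventually.of_forall hτ)
  refine ⟨τ, fun φ => (ζ (τ φ)).re, fun φ => ?_, fun φ => ?_, ?_⟩
  · rw [hzζ]
    congr 1
    apply Complex.ext <;> simp [hτ]
  · rw [div_eq_mul_inv]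
    exact (hre (τ φ)).comp φ (hτd φ)
  -- the logarithm changes by a multiple of `2πi` over a period
  have hder : ∀ t, HasDerivAt (fun t => ζ (t + T) - ζ t) 0 t := fun t => by
    have h₁ := HasDerivAt.comp_add_const t T (hζ (t + T))
    have h₂ := h₁.sub (hζ t)
    rwa [hqT t, sub_self] at h₂
  have hconst : ∀ t, ζ (t + T) - ζ t = ζ T - ζ 0 := fun t => by
    have := is_const_of_deriv_eq_zero (fun t => (hder t).differentiableAt)
      (fun t => (hder t).deriv) t 0
    simpa using this
  have hexp : Complex.exp (ζ T - ζ 0) = 1 := by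
    rw [Complex.exp_sub, ← hzζ, ← hzζ]
    have : z T = z 0 := by simpa using hzT 0
    rw [this, div_self h0]
  obtain ⟨k, hk⟩ := Complex.exp_eq_one_iff.1 hexp
  have hk_re : ∀ t, (ζ (t + T)).re = (ζ t).re := fun t => by
    have := congrArg Complex.re (hconst t)
    rw [hk] at this
    simp at this
    linarith
  have hk_im : ∀ t, (ζ (t + T)).im = (ζ t).im + k * (2 * Real.pi) := fun t => by
    have := congrArg Complex.im (hconst t)
    rw [hk] at this
    simp at this
    linarith
  have hk0 : 0 < k := by
    have h₁ : (ζ 0).im < (ζ (0 + T)).im := hmono (by linarith)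
    rw [hk_im] at h₁
    have : (0 : ℝ) < k := by
      by_contra! hle
      nlinarith [Real.two_pi_pos]
    exact_mod_cast this
  lift k to ℕ using hk0.le
  refine ⟨k, by rintro rfl; simp at hk0, fun φ => ?_⟩
  have h₁ : τ (φ + k * (2 * Real.pi)) = τ φ + T := by
    rw [← hτ' (τ φ + T), hk_im, hτ]
    simp
  change (ζ (τ (φ + k * (2 * Real.pi)))).re = (ζ (τ φ)).re
  rw [h₁, hk_re]

/-! ### Comparison of planar periodic orbits -/

/-- Logarithmic radial velocity with respect to the angle `φ`, at radius `exp ℓ`, of the planar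
field `ż = (i - ε) z + ε β φ(Re z)`. -/
def radialSpeed (ε β φ ℓ : ℝ) : ℝ :=
  (-ε + ε * β * (sat (Real.exp ℓ * Real.cos φ) / Real.exp ℓ) * Real.cos φ) /
    (1 - ε * β * (sat (Real.exp ℓ * Real.cos φ) / Real.exp ℓ) * Real.sin φ)

theorem abs_sat_div_exp_le {ℓ : ℝ} (h : 0 < ℓ) (c : ℝ) : |sat (Real.exp ℓ * c) / Real.exp ℓ| ≤ 1 := by
  rw [abs_div, abs_of_pos (Real.exp_pos ℓ), div_le_one (Real.exp_pos ℓ)]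
  exact (abs_sat_le_one _).trans (Real.one_le_exp h.le)

theorem half_le_one_sub {ε β u s : ℝ} (hε : |ε * β| ≤ 1 / 2) (hu : |u| ≤ 1) (hs : |s| ≤ 1) :
    1 / 2 ≤ 1 - ε * β * u * s := by
  have : |ε * β * u * s| ≤ 1 / 2 := by
    rw [abs_mul, abs_mul]
    calc |ε * β| * |u| * |s| ≤ 1 / 2 * 1 * 1 := by gcongr
      _ = 1 / 2 := by norm_num
  linarith [(abs_le.1 this).2]

/-- The radial speed divided by `ε` is nonincreasing in the radius. -/
theorem mul_radialSpeed_sub_nonpos {ε β M φ ℓ₁ ℓ₂ : ℝ} (hβ : 0 < β) (hεβ : |ε * β| ≤ 1 / 2)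
    (hM : 0 < M) (hε : |ε| * M ≤ 1) (h₁ : 0 < ℓ₁) (h₁₂ : ℓ₁ < ℓ₂) (h₂ : Real.exp ℓ₂ < M) :
    ε * (radialSpeed ε β φ ℓ₂ - radialSpeed ε β φ ℓ₁) ≤ 0 := by
  unfold radialSpeed
  set c := Real.cos φ
  set s := Real.sin φ
  have hd₁ := half_le_one_sub hεβ (abs_sat_div_exp_le h₁ c) (Real.abs_sin_le_one φ)
  have hd₂ := half_le_one_sub hεβ (abs_sat_div_exp_le (h₁.trans h₁₂) c) (Real.abs_sin_le_one φ)
  have hr₁ := Real.exp_pos ℓ₁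
  have hr₂ := Real.exp_pos ℓ₂
  have hr := Real.exp_lt_exp.2 h₁₂
  set r₁ := Real.exp ℓ₁
  set r₂ := Real.exp ℓ₂
  set u₁ := sat (r₁ * c) / r₁ with hu₁
  set u₂ := sat (r₂ * c) / r₂ with hu₂
  have hsign : (u₂ - u₁) * c ≤ 0 := by
    have h := mul_sat_mul_sign_le (c := c) hr₁ hr.le
    have e : (u₂ - u₁) * c = -((r₂ * sat (r₁ * c) - r₁ * sat (r₂ * c)) * c) / (r₁ * r₂) := by
      rw [hu₁, hu₂]; field_simp; ring
    rw [e]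
    exact div_nonpos_of_nonpos_of_nonneg (by linarith) (by positivity)
  -- If `u₁` and `u₂` differ, the larger radius is saturated, so `M |c| > 1` and `|ε s| ≤ |ε| <
  -- |c|`. Then `c - ε s` has the sign of `c` and `hsign` applies.
  have key : (u₂ - u₁) * (c - ε * s) ≤ 0 := by
    rcases le_or_gt (r₂ * |c|) 1 with h | h
    · have e₂ : u₂ = c := by
        rw [hu₂, sat_of_abs_le (by rwa [abs_mul, abs_of_pos hr₂]), mul_div_cancel_left₀ _ hr₂.ne']
      have e₁ : u₁ = c := by
        rw [hu₁, sat_of_abs_le, mul_div_cancel_left₀ _ hr₁.ne']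
        rw [abs_mul, abs_of_pos hr₁]
        exact (mul_le_mul_of_nonneg_right hr.le (abs_nonneg c)).trans h
      rw [e₁, e₂, sub_self, zero_mul]
    · have hcε : |ε * s| < |c| := by
        have hs : |s| ≤ 1 := Real.abs_sin_le_one φ
        have h₃ : |ε * s| ≤ |ε| := by
          rw [abs_mul]; exact mul_le_of_le_one_right (abs_nonneg _) hs
        have h₄ : 1 < M * |c| := h.trans_le (mul_le_mul_of_nonneg_right h₂.le (abs_nonneg c))
        by_contra! hle
        nlinarith [abs_nonneg c, abs_nonneg ε]
      obtain ⟨h₅, h₆⟩ := abs_lt.1 hcε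
      rcases le_total 0 c with hc | hc
      · rw [abs_of_nonneg hc] at h₅ h₆
        have hc' : 0 < c := by linarith
        have : u₂ - u₁ ≤ 0 := by nlinarith
        nlinarith
      · rw [abs_of_nonpos hc] at h₅ h₆
        have hc' : c < 0 := by linarith
        have : 0 ≤ u₂ - u₁ := by nlinarith
        nlinarith
  -- The products `u₁ u₂` cancel in the numerator of the difference of quotients.
  have e : ε * ((-ε + ε * β * u₂ * c) / (1 - ε * β * u₂ * s) -
      (-ε + ε * β * u₁ * c) / (1 - ε * β * u₁ * s)) =
      (ε ^ 2 * β * ((u₂ - u₁) * (c - ε * s))) /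
        ((1 - ε * β * u₂ * s) * (1 - ε * β * u₁ * s)) := by
    have n₁ : 1 - ε * β * u₁ * s ≠ 0 := by linarith
    have n₂ : 1 - ε * β * u₂ * s ≠ 0 := by linarith
    rw [div_sub_div _ _ n₂ n₁, mul_div_assoc']
    congr 1
    ring
  rw [e]
  refine div_nonpos_of_nonpos_of_nonneg ?_ (mul_nonneg (by linarith) (by linarith))
  exact mul_nonpos_of_nonneg_of_nonpos (by positivity) key

/-- Two periodic solutions of the radial equation cannot be ordered. -/
theorem false_of_radial_lt {ε β M : ℝ} (hε0 : ε ≠ 0) (hβ : 0 < β) (hεβ : |ε * β| ≤ 1 / 2)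
    (hM : 0 < M) (hε : |ε| * M ≤ 1) {ℓ₁ ℓ₂ : ℝ → ℝ}
    (hd₁ : ∀ φ, HasDerivAt ℓ₁ (radialSpeed ε β φ (ℓ₁ φ)) φ)
    (hd₂ : ∀ φ, HasDerivAt ℓ₂ (radialSpeed ε β φ (ℓ₂ φ)) φ) {k₁ k₂ : ℕ} (hk₁ : k₁ ≠ 0)
    (hk₂ : k₂ ≠ 0) (hp₁ : Function.Periodic ℓ₁ (k₁ * (2 * Real.pi)))
    (hp₂ : Function.Periodic ℓ₂ (k₂ * (2 * Real.pi))) (hpos : ∀ φ, 0 < ℓ₁ φ)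
    (hlt : ∀ φ, ℓ₁ φ < ℓ₂ φ) (hlt' : ∀ φ, Real.exp (ℓ₂ φ) < M) : False := by
  let D : ℝ → ℝ := fun φ => ε * (ℓ₂ φ - ℓ₁ φ)
  have hD : ∀ φ, HasDerivAt D (ε * (radialSpeed ε β φ (ℓ₂ φ) - radialSpeed ε β φ (ℓ₁ φ))) φ :=
    fun φ => ((hd₂ φ).sub (hd₁ φ)).const_mul ε
  have hanti : Antitone D := antitone_of_hasDerivAt_nonpos hD fun φ =>
    mul_radialSpeed_sub_nonpos hβ hεβ hM hε (hpos φ) (hlt φ) (hlt' φ)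
  let P : ℝ := ((k₁ * k₂ : ℕ) : ℝ) * (2 * Real.pi)
  have hP : 0 < P := by
    have : 0 < k₁ * k₂ := Nat.pos_of_ne_zero (mul_ne_zero hk₁ hk₂)
    have : (0 : ℝ) < (k₁ * k₂ : ℕ) := by exact_mod_cast this
    exact mul_pos this Real.two_pi_pos
  have hperD : Function.Periodic D P := by
    have h₁ : Function.Periodic ℓ₁ P := by
      have := hp₁.nat_mul k₂
      convert! this using 1
      simp only [P]; push_cast; ring
    have h₂ : Function.Periodic ℓ₂ P := by
      have := hp₂.nat_mul k₁
      convert! this using 1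
      simp only [P]; push_cast; ring
    intro φ
    simp only [D, h₁ φ, h₂ φ]
  -- A monotone periodic function is constant; two periods are used so that `P` is an interior
  -- point.
  have hconst : ∀ φ ∈ Set.Icc 0 (P + P), D φ = D 0 := fun φ hφ =>
    le_antisymm (hanti hφ.1) (by
      have := hanti hφ.2
      rwa [hperD, ← zero_add P, hperD] at this)
  have hzero : HasDerivAt D 0 P := by
    refine (hasDerivAt_const P (D 0)).congr_of_eventuallyEq ?_
    filter_upwards [Icc_mem_nhds hP (lt_add_of_pos_left P hP)] with φ hφ using hconst φ hφ
  have h := (hD P).unique hzero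
  -- At this angle both oscillations are saturated and the speeds depend strictly on the radius, so
  -- equal speeds contradict the strict order.
  have hcos : Real.cos P = 1 := Real.cos_nat_mul_two_pi _
  have hsin : Real.sin P = 0 := by
    have := Real.sin_add_nat_mul_two_pi 0 (k₁ * k₂)
    simpa [P] using this
  have hpos₂ : 0 < ℓ₂ P := (hpos P).trans (hlt P)
  simp only [radialSpeed, hcos, hsin, mul_one, sat_of_one_le (Real.one_le_exp hpos₂.le),
    sat_of_one_le (Real.one_le_exp (hpos P).le)] at h
  have h' := (mul_eq_zero.1 h).resolve_left hε0
  simp only [mul_zero, sub_zero, div_one] at h'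
  have h₃ : (1 : ℝ) / Real.exp (ℓ₂ P) = 1 / Real.exp (ℓ₁ P) := by
    have : ε * β ≠ 0 := mul_ne_zero hε0 hβ.ne'
    refine mul_left_cancel₀ this ?_
    linarith
  have h₄ : Real.exp (ℓ₂ P) = Real.exp (ℓ₁ P) := by
    rwa [one_div, one_div, inv_inj] at h₃
  exact (hlt P).ne' (Real.exp_injective h₄)

/-! ### A class of systems with isolated periodic orbits -/

variable {n : ℕ} [NeZero n]

/-- The squared norm of the first pair of coordinates. -/
def firstRadiusSq (x : Phase n) : ℝ := x (0, 0) ^ 2 + x (0, 1) ^ 2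

theorem continuous_firstRadiusSq : Continuous (firstRadiusSq (n := n)) := by
  unfold firstRadiusSq; fun_prop

theorem firstRadiusSq_rot (t : ℝ) (x : Phase n) : firstRadiusSq (rot n t x) = firstRadiusSq x := by
  simp only [firstRadiusSq, rot_apply_zero, rot_apply_one, freq_zero, one_mul]
  linear_combination (x (0, 0) ^ 2 + x (0, 1) ^ 2) * Real.sin_sq_add_cos_sq t

/-- The first pair of coordinates as a complex number. -/
def firstComplex (x : Phase n) : ℂ := ⟨x (0, 0), x (0, 1)⟩

theorem normSq_firstComplex (x : Phase n) : Complex.normSq (firstComplex x) = firstRadiusSq x := by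
  simp [firstComplex, firstRadiusSq, Complex.normSq_apply, sq]

theorem field_neg_one_eq (b : Phase n) (ε : ℝ) (x : Phase n) :
    field (-1) b ε x = centerMap n x - ε • x + (ε * sat (x (0, 0))) • b := by
  rw [field_eq, perturbation, Matrix.neg_mulVec, Matrix.one_mulVec]
  module

variable {b : Phase n}

/-- For `A = -1` the first plane obeys `ż = (i - ε) z + ε β sat (Re z)` on its own. The function `q`
is its logarithmic derivative, and for `|z| > 1` the smallness of `ε β` keeps the angular velocity
above `1 / 2`. -/
theorem exists_radial_solution (hb : b (0, 1) = 0) {ε M : ℝ} (hεβ : |ε * b (0, 0)| ≤ 1 / 2)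
    {x : ℝ → Phase n} {T : ℝ} (hx : IsPeriodicSolution (field (-1) b ε) x T)
    (h₁ : ∀ t, 1 < firstRadiusSq (x t)) (hM : 0 < M) (h₂ : ∀ t, firstRadiusSq (x t) < M ^ 2) :
    ∃ τ ℓ : ℝ → ℝ, (∀ φ, firstComplex (x (τ φ)) = Complex.exp (ℓ φ + φ * Complex.I)) ∧
      (∀ φ, HasDerivAt ℓ (radialSpeed ε (b (0, 0)) φ (ℓ φ)) φ) ∧ (∀ φ, 0 < ℓ φ) ∧
      (∀ φ, Real.exp (ℓ φ) < M) ∧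
      ∃ k : ℕ, k ≠ 0 ∧ Function.Periodic ℓ (k * (2 * Real.pi)) := by
  obtain ⟨hT, hsol, hper, -⟩ := hx
  let z : ℝ → ℂ := fun t => firstComplex (x t)
  have hsq : ∀ t, Complex.normSq (z t) = firstRadiusSq (x t) := fun t => normSq_firstComplex _
  have hz0 : ∀ t, z t ≠ 0 := fun t h => by
    have h₃ := h₁ t
    rw [← hsq, h, map_zero] at h₃
    linarith
  let q : ℝ → ℂ := fun t => Complex.I - ε + (ε * b (0, 0) * sat (x t (0, 0)) : ℝ) / z t
  have hzd : ∀ t, HasDerivAt z (z t * q t) t := by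
    intro t
    have hc := hasDerivAt_pi.1 (hsol t)
    have h₃ : HasDerivAt (fun t => (x t (0, 0) : ℂ) + (x t (0, 1) : ℂ) * Complex.I) _ t :=
      (hc (0, 0)).ofReal_comp.add ((hc (0, 1)).ofReal_comp.mul_const Complex.I)
    have e : z = fun t => (x t (0, 0) : ℂ) + (x t (0, 1) : ℂ) * Complex.I :=
      funext fun t => Complex.mk_eq_add_mul_I _ _
    rw [e]
    refine h₃.congr_deriv (Eq.trans ?_ (congrArg (· * q t) (congrFun e t)))
    simp only [q]
    rw [mul_add, mul_div_cancel₀ _ (hz0 t), field_neg_one_eq]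
    apply Complex.ext
    · simp [z, firstComplex, freq_zero]
      ring
    · simp [z, firstComplex, freq_zero, hb]
      ring
  have hxc : Continuous x := continuous_iff_continuousAt.2 fun t => (hsol t).continuousAt
  have hzc : Continuous z := continuous_iff_continuousAt.2 fun t => (hzd t).continuousAt
  have hqc : Continuous q := by
    have h₃ : Continuous fun t => sat (x t (0, 0)) :=
      continuous_sat.comp ((continuous_apply _).comp hxc)
    exact continuous_const.add ((Complex.continuous_ofReal.comp (continuous_const.mul h₃)).div hzc
      hz0)
  have hzT : Function.Periodic z T := fun t => by simp only [z, hper t]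
  have hqT : Function.Periodic q T := fun t => by simp only [q, z, hper t]
  -- the angular and radial velocities
  have hpol : ∀ t ℓ φ : ℝ, z t = Complex.exp (ℓ + φ * Complex.I) →
      (q t).re = -ε + ε * b (0, 0) * (sat (Real.exp ℓ * Real.cos φ) / Real.exp ℓ) * Real.cos φ ∧
      (q t).im = 1 - ε * b (0, 0) * (sat (Real.exp ℓ * Real.cos φ) / Real.exp ℓ) * Real.sin φ ∧
      0 < ℓ ∧ Real.exp ℓ < M := by
    intro t ℓ φ h
    have hre : x t (0, 0) = Real.exp ℓ * Real.cos φ := by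
      have := congrArg Complex.re h
      rw [Complex.exp_re] at this
      simpa [z, firstComplex] using this
    have hinv : (z t)⁻¹ = Complex.exp (((-ℓ : ℝ) : ℂ) + ((-φ : ℝ) : ℂ) * Complex.I) := by
      rw [h, ← Complex.exp_neg]; congr 1; push_cast; ring
    have hqe : q t = Complex.I - ε + (ε * b (0, 0) * sat (x t (0, 0)) : ℝ) *
        Complex.exp (((-ℓ : ℝ) : ℂ) + ((-φ : ℝ) : ℂ) * Complex.I) := by
      rw [← hinv]; rfl
    have hnorm : firstRadiusSq (x t) = Real.exp ℓ ^ 2 := by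
      rw [← hsq, h, Complex.normSq_eq_norm_sq, Complex.norm_exp]
      simp
    refine ⟨?_, ?_, ?_, ?_⟩
    · rw [hqe, Complex.add_re, Complex.re_ofReal_mul, Complex.exp_re, hre]
      simp only [Complex.add_re, Complex.ofReal_re, Complex.re_ofReal_mul, Complex.I_re, mul_zero,
        add_zero, Complex.add_im, Complex.ofReal_im, Complex.im_ofReal_mul, Complex.I_im, mul_one,
        zero_add, Complex.sub_re, Real.cos_neg, Real.exp_neg]
      ring
    · rw [hqe, Complex.add_im, Complex.im_ofReal_mul, Complex.exp_im, hre]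
      simp only [Complex.add_re, Complex.ofReal_re, Complex.re_ofReal_mul, Complex.I_re, mul_zero,
        add_zero, Complex.add_im, Complex.ofReal_im, Complex.im_ofReal_mul, Complex.I_im, mul_one,
        zero_add, Complex.sub_im, Real.sin_neg, Real.exp_neg]
      ring
    · have h₃ := h₁ t
      rw [hnorm] at h₃
      refine Real.one_lt_exp_iff.1 ?_
      nlinarith [Real.exp_pos ℓ]
    · have h₃ := h₂ t
      rw [hnorm] at h₃
      exact lt_of_pow_lt_pow_left₀ 2 hM.le h₃
  have him : ∀ t, 1 / 2 ≤ (q t).im := by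
    intro t
    have h : z t = Complex.exp ((Real.log ‖z t‖ : ℝ) + (Complex.arg (z t) : ℝ) * Complex.I) := by
      rw [Complex.exp_add, ← Complex.ofReal_exp, Real.exp_log (norm_pos_iff.2 (hz0 t)),
        Complex.norm_mul_exp_arg_mul_I]
    obtain ⟨-, h₄, h₅, -⟩ := hpol t _ _ h
    rw [h₄]
    exact half_le_one_sub hεβ (abs_sat_div_exp_le h₅ _) (Real.abs_sin_le_one _)
  obtain ⟨τ, ℓ, hτ, hℓ, hk⟩ := exists_angle_parametrization hzd hqc (hz0 0) him hT hzT hqT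
  refine ⟨τ, ℓ, hτ, fun φ => ?_, fun φ => (hpol _ _ _ (hτ φ)).2.2.1,
    fun φ => (hpol _ _ _ (hτ φ)).2.2.2, hk⟩
  have := hℓ φ
  rwa [(hpol _ _ _ (hτ φ)).1, (hpol _ _ _ (hτ φ)).2.1] at this

/-! ### Reduction to the first plane and isolation of periodic orbits. -/

/-- Projection to the first pair of coordinates. -/
def firstBlock (x : Phase n) : Phase 1 := fun q => x (0, q.2)

omit [NeZero n] in
/-- Bounded solutions of the linear part vanish. -/
theorem eq_zero_of_bounded_linear {ε : ℝ} (hε : ε ≠ 0) {y : ℝ → Phase n}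
    (hy : ∀ t, HasDerivAt y (centerMap n (y t) - ε • y t) t) {C : ℝ} (hC : ∀ t, ‖y t‖ ≤ C) :
    y 0 = 0 := by
  have hder : ∀ t, HasDerivAt (fun t => Real.exp (ε * t) • rot n (-t) (y t)) 0 t := by
    intro t
    have h₁ : HasDerivAt (fun t => Real.exp (ε * t)) (Real.exp (ε * t) * ε) t := by
      simpa using ((hasDerivAt_id t).const_mul ε).exp
    refine (h₁.smul (hasDerivAt_rot_comp (hasDerivAt_neg t) (hy t))).congr_deriv ?_
    rw [map_sub, map_smul, rot_centerMap]
    module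
  have hconst : ∀ t, Real.exp (ε * t) • rot n (-t) (y t) = y 0 := fun t => by
    have := is_const_of_deriv_eq_zero (fun t => (hder t).differentiableAt)
      (fun t => (hder t).deriv) t 0
    simpa using this
  -- Evaluating at time `-s / ε` treats both signs of `ε` at once.
  have hbound : ∀ s : ℝ, ‖y 0‖ ≤ Real.exp (-s) * (2 * C) := by
    intro s
    rw [← hconst (-s / ε), norm_smul, mul_div_cancel₀ _ hε, Real.norm_of_nonneg (Real.exp_pos _).le]
    gcongr
    exact (norm_rot_apply_le _ _).trans (by linarith [hC (-s / ε)])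
  have hlim : Tendsto (fun s : ℝ => Real.exp (-s) * (2 * C)) atTop (𝓝 0) := by
    simpa using Real.tendsto_exp_neg_atTop_nhds_zero.mul_const (2 * C)
  exact norm_le_zero_iff.1 (ge_of_tendsto' hlim hbound)

omit [NeZero n] in
theorem IsPeriodicSolution.exists_norm_le {f : Phase n → Phase n} {x : ℝ → Phase n} {T : ℝ}
    (h : IsPeriodicSolution f x T) : ∃ C, ∀ t, ‖x t‖ ≤ C := by
  have hc : Continuous x := continuous_iff_continuousAt.2 fun t => (h.2.1 t).continuousAt
  have hcomp : IsCompact (Set.range x) := by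
    rw [← h.2.2.1.image_Icc h.1 0]
    exact isCompact_Icc.image hc
  obtain ⟨C, hC⟩ := hcomp.isBounded.exists_norm_le
  exact ⟨C, fun t => hC _ ⟨t, rfl⟩⟩

/-- Periodic solutions which agree in the first pair of coordinates at one time have the same
orbit. -/
theorem range_eq_of_firstBlock_eq {ε : ℝ} (hε : ε ≠ 0) {x y : ℝ → Phase n} {T T' : ℝ}
    (hx : IsPeriodicSolution (field (-1) b ε) x T) (hy : IsPeriodicSolution (field (-1) b ε) y T')
    {s s' : ℝ} (h : firstBlock (x s) = firstBlock (y s')) : Set.range x = Set.range y := by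
  -- The first pair solves a system of the same form with a single block, to which uniqueness
  -- applies.
  have hproj : ∀ {z : ℝ → Phase n}, (∀ t, HasDerivAt z (field (-1) b ε (z t)) t) →
      ∀ t, HasDerivAt (fun t => firstBlock (z t))
        (field (-1) (firstBlock b) ε (firstBlock (z t))) t := by
    intro z hz t
    have hc := hasDerivAt_pi.1 (hz t)
    refine hasDerivAt_pi.2 fun ⟨j, i⟩ => (hc (0, i)).congr_deriv ?_
    rw [field_neg_one_eq, field_neg_one_eq]
    have hj : j = 0 := Subsingleton.elim _ _
    subst hj
    fin_cases i <;> simp [firstBlock, freq_zero]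
  have hfirst := solution_unique (hproj hx.2.1) (hproj hy.2.1) h
  have hsat : ∀ t, x (s + t) (0, 0) = y (s' + t) (0, 0) := fun t =>
    congrFun (hfirst t) (0, 0)
  obtain ⟨C, hC⟩ := hx.exists_norm_le
  obtain ⟨C', hC'⟩ := hy.exists_norm_le
  -- Equal first coordinates make the saturation terms cancel, so the difference is a bounded
  -- solution of the linear part.
  have hzero := eq_zero_of_bounded_linear hε (y := fun t => x (s + t) - y (s' + t))
    (C := C + C') (fun t => by
      have h₁ := HasDerivAt.comp_const_add s t (hx.2.1 (s + t))
      have h₂ := HasDerivAt.comp_const_add s' t (hy.2.1 (s' + t))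
      refine (h₁.sub h₂).congr_deriv ?_
      rw [field_neg_one_eq, field_neg_one_eq, hsat t, map_sub]
      module) (fun t => (norm_sub_le _ _).trans (add_le_add (hC _) (hC' _)))
  simp only [add_zero, sub_eq_zero] at hzero
  exact range_eq_of_eq hx.2.1 hy.2.1 hzero

/-- The neighbourhood is the preimage of an annulus in the first plane. If the radial functions of
two periodic orbits never met, continuity would order them strictly, which `false_of_radial_lt`
excludes; a meeting point identifies the orbits. -/
theorem isLimitCycle_of_firstRadiusSq {ε M : ℝ} (hε0 : ε ≠ 0) (hb : b (0, 1) = 0)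
    (hβ : 0 < b (0, 0)) (hεβ : |ε * b (0, 0)| ≤ 1 / 2) (hM : 0 < M) (hε : |ε| * M ≤ 1)
    {x : ℝ → Phase n} {T : ℝ} (hx : IsPeriodicSolution (field (-1) b ε) x T)
    (h₁ : ∀ t, 1 < firstRadiusSq (x t)) (h₂ : ∀ t, firstRadiusSq (x t) < M ^ 2) :
    IsLimitCycle (field (-1) b ε) (Set.range x) := by
  refine ⟨⟨x, T, hx, rfl⟩, {v | 1 < firstRadiusSq v ∧ firstRadiusSq v < M ^ 2},
    (isOpen_lt continuous_const continuous_firstRadiusSq).inter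
      (isOpen_lt continuous_firstRadiusSq continuous_const), ?_, ?_⟩
  · rintro _ ⟨t, rfl⟩
    exact ⟨h₁ t, h₂ t⟩
  rintro _ ⟨y, T', hy, rfl⟩ hsub
  have h₁' : ∀ t, 1 < firstRadiusSq (y t) := fun t => (hsub ⟨t, rfl⟩).1
  have h₂' : ∀ t, firstRadiusSq (y t) < M ^ 2 := fun t => (hsub ⟨t, rfl⟩).2
  obtain ⟨τ₁, ℓ₁, hz₁, hd₁, hp₁, hm₁, k₁, hk₁, hper₁⟩ :=
    exists_radial_solution hb hεβ hx h₁ hM h₂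
  obtain ⟨τ₂, ℓ₂, hz₂, hd₂, hp₂, hm₂, k₂, hk₂, hper₂⟩ :=
    exists_radial_solution hb hεβ hy h₁' hM h₂'
  have hc₁ : Continuous ℓ₁ := continuous_iff_continuousAt.2 fun φ => (hd₁ φ).continuousAt
  have hc₂ : Continuous ℓ₂ := continuous_iff_continuousAt.2 fun φ => (hd₂ φ).continuousAt
  have hmeet : ∃ φ, ℓ₁ φ = ℓ₂ φ := by
    by_contra! hne
    rcases lt_or_gt_of_ne (hne 0) with h | h
    · refine false_of_radial_lt hε0 hβ hεβ hM hε hd₁ hd₂ hk₁ hk₂ hper₁ hper₂ hp₁ (fun φ => ?_) hm₂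
      by_contra! hle
      obtain ⟨ψ, hψ⟩ := mem_range_of_exists_le_of_exists_ge (hc₁.sub hc₂)
        ⟨0, (sub_neg.2 h).le⟩ ⟨φ, sub_nonneg.2 hle⟩
      exact hne ψ (sub_eq_zero.1 hψ)
    · refine false_of_radial_lt hε0 hβ hεβ hM hε hd₂ hd₁ hk₂ hk₁ hper₂ hper₁ hp₂ (fun φ => ?_) hm₁
      by_contra! hle
      obtain ⟨ψ, hψ⟩ := mem_range_of_exists_le_of_exists_ge (hc₂.sub hc₁)
        ⟨0, (sub_neg.2 h).le⟩ ⟨φ, sub_nonneg.2 hle⟩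
      exact hne ψ (sub_eq_zero.1 hψ).symm
  obtain ⟨φ, hφ⟩ := hmeet
  refine (range_eq_of_firstBlock_eq hε0 hx hy (s := τ₁ φ) (s' := τ₂ φ) ?_).symm
  have e : firstComplex (x (τ₁ φ)) = firstComplex (y (τ₂ φ)) := by rw [hz₁, hz₂, hφ]
  funext ⟨j, i⟩
  fin_cases i
  · exact congrArg Complex.re e
  · exact congrArg Complex.im e

end

section

variable {n : ℕ}

/-! ### The Fourier coefficients of the saturated oscillation as functions of the amplitude -/

theorem hasDerivAt_sat {s : ℝ} (hs : |s| ≠ 1) : HasDerivAt sat (if |s| < 1 then 1 else 0) s := by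
  rcases lt_or_gt_of_ne hs with h | h
  · rw [if_pos h]
    refine (hasDerivAt_id s).congr_of_eventuallyEq ?_
    filter_upwards [continuous_abs.continuousAt.eventually_lt_const h] with t ht
    exact sat_of_abs_le ht.le
  · rw [if_neg h.not_gt]
    rcases lt_abs.1 h with h | h
    · refine (hasDerivAt_const s (1 : ℝ)).congr_of_eventuallyEq ?_
      filter_upwards [eventually_gt_nhds h] with t ht using sat_of_one_le ht.le
    · refine (hasDerivAt_const s (-1 : ℝ)).congr_of_eventuallyEq ?_
      filter_upwards [eventually_lt_nhds (lt_neg.1 h)] with t ht using sat_of_le_neg_one ht.le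

/-- Differentiation under the integral sign: the integrand is `1`-Lipschitz in `r` and
differentiable except at the null set of switching times. -/
theorem hasDerivAt_satCoeff (j : Fin n) (r : ℝ) : HasDerivAt (satCoeff j)
    (∫ t in (0 : ℝ)..(2 * Real.pi), satSlope r t * (Real.cos t * Real.cos (freq j * t))) r := by
  have hs := continuous_sat
  refine (intervalIntegral.hasDerivAt_integral_of_dominated_loc_of_lip (bound := fun _ => 1)
    (F := fun r t => sat (r * Real.cos t) * Real.cos (freq j * t)) univ_mem
    (Eventually.of_forall fun r => Continuous.aestronglyMeasurable (by fun_prop))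
    (Continuous.intervalIntegrable (by fun_prop) _ _) ?_ (Eventually.of_forall fun t _ => ?_)
    intervalIntegrable_const ?_).2
  · exact ((measurable_satSlope r).mul (Continuous.measurable
      (f := fun t => Real.cos t * Real.cos (freq j * t)) (by fun_prop))).aestronglyMeasurable
  · refine LipschitzOnWith.of_dist_le_mul fun u _ v _ => ?_
    rw [Real.dist_eq, Real.dist_eq, ← sub_mul, abs_mul, Real.coe_nnabs, abs_one, one_mul]
    refine (mul_le_of_le_one_right (abs_nonneg _) (Real.abs_cos_le_one _)).trans ?_
    refine (abs_sat_sub_sat_le _ _).trans ?_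
    rw [← sub_mul, abs_mul]
    exact mul_le_of_le_one_right (abs_nonneg _) (Real.abs_cos_le_one _)
  · filter_upwards [ae_abs_mul_cos_ne_one r] with t ht _
    have h₁ : HasDerivAt (fun r => r * Real.cos t) (Real.cos t) r := by
      simpa using (hasDerivAt_id r).mul_const (Real.cos t)
    refine (((hasDerivAt_sat ht).comp r h₁).mul_const (Real.cos (freq j * t))).congr_deriv ?_
    rw [satSlope]
    ring

theorem continuousAt_satSlope {r t : ℝ} (h : |r * Real.cos t| ≠ 1) :
    ContinuousAt (fun r => satSlope r t) r := by
  have hc : Continuous fun r => |r * Real.cos t| := by fun_prop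
  unfold satSlope
  rcases lt_or_gt_of_ne h with h | h
  · refine (continuousAt_const (y := (1 : ℝ))).congr ?_
    filter_upwards [hc.continuousAt.eventually_lt_const h] with s hs
    rw [if_pos hs]
  · refine (continuousAt_const (y := (0 : ℝ))).congr ?_
    filter_upwards [hc.continuousAt.eventually_const_lt h] with s hs
    rw [if_neg hs.not_gt]

theorem contDiff_satCoeff (j : Fin n) : ContDiff ℝ 1 (satCoeff j) := by
  refine contDiff_one_iff_deriv.2 ⟨fun r => (hasDerivAt_satCoeff j r).differentiableAt, ?_⟩
  rw [show deriv (satCoeff j) = _ from funext fun r => (hasDerivAt_satCoeff j r).deriv]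
  refine continuous_iff_continuousAt.2 fun r =>
    intervalIntegral.continuousAt_of_dominated_interval (bound := fun _ => 1)
      (Eventually.of_forall fun r => ?_) (Eventually.of_forall fun r => Eventually.of_forall
        fun t _ => ?_) intervalIntegrable_const ?_
  · exact ((measurable_satSlope r).mul (Continuous.measurable
      (f := fun t => Real.cos t * Real.cos (freq j * t)) (by fun_prop))).aestronglyMeasurable
  · rw [norm_mul, Real.norm_of_nonneg (satSlope_nonneg r t)]
    exact (mul_le_of_le_one_left (norm_nonneg _) (satSlope_le_one r t)).trans
      (abs_cos_mul_cos_le _ _)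
  · filter_upwards [ae_abs_mul_cos_ne_one r] with t ht _
    exact (continuousAt_satSlope ht).mul continuousAt_const

theorem integral_cos_freq_mul (j : Fin n) (s t : ℝ) :
    ∫ u in s..t, Real.cos (freq j * u) =
      (Real.sin (freq j * t) - Real.sin (freq j * s)) / freq j := by
  rw [intervalIntegral.integral_comp_mul_left _ (freq_pos j).ne', integral_cos, smul_eq_mul]
  ring

theorem tendsto_integral_sat_mul {s t σ : ℝ} (hst : s ≤ t) {l : Filter ℝ}
    [l.IsCountablyGenerated] (j : Fin n)
    (h : ∀ u ∈ Set.Ioo s t, ∀ᶠ r in l, sat (r * Real.cos u) = σ) :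
    Tendsto (fun r => ∫ u in s..t, sat (r * Real.cos u) * Real.cos (freq j * u)) l
      (𝓝 (σ * ((Real.sin (freq j * t) - Real.sin (freq j * s)) / freq j))) := by
  have hs := continuous_sat
  rw [← integral_cos_freq_mul, ← intervalIntegral.integral_const_mul]
  refine intervalIntegral.tendsto_integral_filter_of_dominated_convergence (fun _ => 1)
    (Eventually.of_forall fun r => Continuous.aestronglyMeasurable (by fun_prop))
    (Eventually.of_forall fun r => Eventually.of_forall fun u _ => ?_)
    intervalIntegrable_const ?_
  · rw [norm_mul]
    exact mul_le_one₀ (abs_sat_le_one _) (norm_nonneg _) (Real.abs_cos_le_one _)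
  · filter_upwards [(MeasureTheory.Measure.ae_ne MeasureTheory.volume t)] with u hu hmem
    rw [Set.uIoc_of_le hst] at hmem
    refine tendsto_const_nhds.congr' ?_
    filter_upwards [h u ⟨hmem.1, lt_of_le_of_ne hmem.2 hu⟩] with r hr
    rw [hr]

theorem eventually_sat_mul_eq_one {c : ℝ} (hc : 0 < c) : ∀ᶠ r in atTop, sat (r * c) = 1 := by
  filter_upwards [(tendsto_id.atTop_mul_const hc).eventually_ge_atTop 1] with r hr
  exact sat_of_one_le hr

theorem eventually_sat_mul_eq_neg_one {c : ℝ} (hc : c < 0) :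
    ∀ᶠ r in atTop, sat (r * c) = -1 := by
  filter_upwards [eventually_sat_mul_eq_one (neg_pos.2 hc)] with r hr
  rw [mul_neg, sat_neg] at hr
  linarith

/-- As the amplitude grows, the saturated cosine tends to a square wave, constant on the three arcs
between zeros of the cosine in `[0, 2π]`. -/
theorem tendsto_satCoeff_atTop (j : Fin n) :
    Tendsto (satCoeff j) atTop (𝓝 (4 * (-1) ^ (j : ℕ) / freq j)) := by
  have hs := continuous_sat
  have hπ := Real.pi_pos
  have h₁ := tendsto_integral_sat_mul (s := 0) (t := Real.pi / 2) (by linarith) j (l := atTop)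
    (σ := 1) fun u hu => eventually_sat_mul_eq_one
      (Real.cos_pos_of_mem_Ioo ⟨by linarith [hu.1], hu.2⟩)
  have h₂ := tendsto_integral_sat_mul (s := Real.pi / 2) (t := 3 * Real.pi / 2) (by linarith) j
    (l := atTop) (σ := -1) fun u hu => eventually_sat_mul_eq_neg_one
      (Real.cos_neg_of_pi_div_two_lt_of_lt hu.1 (by linarith [hu.2]))
  have h₃ := tendsto_integral_sat_mul (s := 3 * Real.pi / 2) (t := 2 * Real.pi) (by linarith) j
    (l := atTop) (σ := 1) fun u hu => eventually_sat_mul_eq_one (by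
      rw [← Real.cos_sub_two_pi]
      exact Real.cos_pos_of_mem_Ioo ⟨by linarith [hu.1], by linarith [hu.2]⟩)
  have e₁ : Real.sin (freq j * (Real.pi / 2)) = (-1) ^ (j : ℕ) := by
    rw [show freq j * (Real.pi / 2) = (j : ℕ) * Real.pi + Real.pi / 2 by rw [freq]; ring,
      Real.sin_add_pi_div_two, Real.cos_nat_mul_pi]
  have e₂ : Real.sin (freq j * (3 * Real.pi / 2)) = -(-1) ^ (j : ℕ) := by
    rw [show freq j * (3 * Real.pi / 2) =
        ((3 * (j : ℕ) + 1 : ℕ) : ℝ) * Real.pi + Real.pi / 2 by rw [freq]; push_cast; ring,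
      Real.sin_add_pi_div_two, Real.cos_nat_mul_pi, pow_succ, pow_mul]
    norm_num
  have e₃ : Real.sin (freq j * (2 * Real.pi)) = 0 := by
    rw [show freq j * (2 * Real.pi) = ((2 * (2 * (j : ℕ) + 1) : ℕ) : ℝ) * Real.pi by
      rw [freq]; push_cast; ring]
    exact Real.sin_nat_mul_pi _
  have h := (h₁.add h₂).add h₃
  rw [e₁, e₂, e₃, mul_zero, Real.sin_zero] at h
  refine (h.congr fun r => ?_).trans_eq ?_
  · have hi : ∀ s t, IntervalIntegrable (fun u => sat (r * Real.cos u) * Real.cos (freq j * u))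
      MeasureTheory.volume s t := fun s t => Continuous.intervalIntegrable (by fun_prop) _ _
    rw [intervalIntegral.integral_add_adjacent_intervals (hi _ _) (hi _ _),
      intervalIntegral.integral_add_adjacent_intervals (hi _ _) (hi _ _)]
    rfl
  · congr 1
    ring

/-- These coefficients are the denominators in `dampedInput`; for large `ρ` they are close to the
nonzero coefficients of the square wave. -/
theorem exists_satCoeff_ne_zero (n : ℕ) : ∃ ρ : ℝ, 1 < ρ ∧ ∀ j : Fin n, satCoeff j ρ ≠ 0 := by
  have h : ∀ᶠ ρ in atTop, ∀ j : Fin n, satCoeff j ρ ≠ 0 := eventually_all.2 fun j =>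
    (tendsto_satCoeff_atTop j).eventually_ne
      (div_ne_zero (mul_ne_zero four_ne_zero (pow_ne_zero _ (by norm_num))) (freq_pos j).ne')
  exact ((eventually_gt_atTop 1).and h).exists

variable [NeZero n]

theorem satCoeff_zero_pos {ρ : ℝ} (hρ : 1 < ρ) : 0 < satCoeff (0 : Fin n) ρ := by
  refine lt_of_le_of_lt (mul_nonneg (by linarith) ?_) (mul_integral_satSlope_lt_satCoeff hρ)
  exact intervalIntegral.integral_nonneg Real.two_pi_pos.le fun t _ =>
    mul_nonneg (satSlope_nonneg _ _) (mul_self_nonneg _)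

/-! ### A system with a simple zero of the averaged function -/

/-- The amplitudes of the oscillation in the uniformly damped system. -/
def dampedAmplitude (n : ℕ) [NeZero n] (ρ : ℝ) (j : Fin n) : ℝ := if j = 0 then ρ else 1

/-- The input vector for which the uniformly damped system has the given oscillation. -/
def dampedInput (n : ℕ) [NeZero n] (ρ : ℝ) : Phase n := fun q =>
  if q.2 = 0 then 2 * Real.pi * dampedAmplitude n ρ q.1 / satCoeff q.1 ρ else 0

/-- The zero of the averaged function of the uniformly damped system. -/
def dampedZero (n : ℕ) [NeZero n] (ρ : ℝ) : Slow n := (dampedAmplitude n ρ, 0)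

@[simp] theorem dampedAmplitude_zero (ρ : ℝ) : dampedAmplitude n ρ 0 = ρ := if_pos rfl

@[simp] theorem dampedZero_fst_zero (ρ : ℝ) : (dampedZero n ρ).1 0 = ρ := by
  simp [dampedZero]

theorem dampedAmplitude_pos {ρ : ℝ} (hρ : 1 < ρ) (j : Fin n) : 0 < dampedAmplitude n ρ j := by
  unfold dampedAmplitude
  split_ifs <;> linarith

theorem dampedZero_mem_slowDomain {ρ : ℝ} (hρ : 1 < ρ) : dampedZero n ρ ∈ slowDomain n :=
  dampedAmplitude_pos hρ

theorem satCoeff_mul_dampedInput {ρ : ℝ} {j : Fin n} (h : satCoeff j ρ ≠ 0) :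
    satCoeff j ρ * dampedInput n ρ (j, 0) = 2 * Real.pi * dampedAmplitude n ρ j := by
  rw [dampedInput, if_pos rfl, mul_div_cancel₀ _ h]

@[simp] theorem dampedInput_one (ρ : ℝ) (j : Fin n) : dampedInput n ρ (j, 1) = 0 :=
  if_neg one_ne_zero

theorem dampedInput_pos {ρ : ℝ} (hρ : 1 < ρ) : 0 < dampedInput n ρ (0, 0) := by
  have := satCoeff_zero_pos (n := n) hρ
  have := Real.pi_pos
  rw [dampedInput, if_pos rfl, dampedAmplitude_zero]
  positivity

omit [NeZero n] in
@[simp] theorem blockRe_neg_one (j : Fin n) : blockRe (-1) j = -(2 * Real.pi) := by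
  simp [blockRe]; ring

omit [NeZero n] in
@[simp] theorem blockIm_neg_one (j : Fin n) : blockIm (-1) j = 0 := by
  simp [blockIm]

theorem averaged_neg_one_eq {b : Phase n} (hb : ∀ j, b (j, 1) = 0) {p : Slow n}
    (hp : p ∈ slowDomain n) : averaged (-1) b p =
      (fun j => -(2 * Real.pi) * p.1 j + satCoeff j (p.1 0) * (b (j, 0) * Real.cos (phase 0 p j)),
        fun j : {j : Fin n // j ≠ 0} => -(satCoeff (j : Fin n) (p.1 0) *
          (b (j, 0) * Real.sin (p.2 j)) / p.1 j)) := by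
  refine Prod.ext (funext fun j => ?_) (funext fun j => ?_)
  · rw [averaged_radial, blockRe_neg_one, hb, zero_mul, add_zero]
  · rw [averaged_angular hp, blockIm_neg_one, blockIm_neg_one, hb, hb,
      phase_zero_of_ne p j.2]
    simp only [zero_mul, mul_zero, zero_div, add_zero, zero_add, sub_zero, zero_sub, mul_neg,
      neg_div]

theorem phase_dampedZero (ρ : ℝ) (j : Fin n) : phase 0 (dampedZero n ρ) j = 0 := by
  simp [phase, dampedZero]

theorem averaged_dampedZero {ρ : ℝ} (hρ : 1 < ρ) (hc : ∀ j : Fin n, satCoeff j ρ ≠ 0) :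
    averaged (-1) (dampedInput n ρ) (dampedZero n ρ) = 0 := by
  rw [averaged_neg_one_eq (dampedInput_one ρ) (dampedZero_mem_slowDomain hρ)]
  refine Prod.ext (funext fun j => ?_) (funext fun j => ?_)
  · simp only [phase_dampedZero, Real.cos_zero, mul_one]
    have := satCoeff_mul_dampedInput (hc j)
    simp only [dampedZero, dampedAmplitude_zero] at this ⊢
    rw [this]
    simp
  · simp [dampedZero]

theorem isNondegenerate_dampedZero {ρ : ℝ} (hρ : 1 < ρ) (hc : ∀ j : Fin n, satCoeff j ρ ≠ 0) :
    IsNondegenerate (-1) (dampedInput n ρ) 0 (polar 0 (dampedZero n ρ)) where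
  one_lt := by rwa [polar_zero_zero_zero, dampedZero_fst_zero]
  im_eq_zero := polar_zero_zero_one _
  input_ne_zero := (dampedInput_pos hρ).ne'
  eq := by
    refine averagedEquation_of_components (polar_zero_zero_one _) fun j => ?_
    have := satCoeff_mul_dampedInput (hc j)
    simp only [polar_apply_zero, polar_apply_one, phase_dampedZero, Real.cos_zero, Real.sin_zero]
    simp only [dampedZero, dampedAmplitude_zero, blockRe_neg_one, blockIm_neg_one, mul_zero,
      mul_one, sub_zero, add_zero, dampedInput_one, zero_mul, and_true, this]
    ring
  block_ne_zero j _ := Or.inl (by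
    rw [blockRe_neg_one]
    exact neg_ne_zero.2 Real.two_pi_pos.ne')

theorem slowDomain_mem_nhds {p : Slow n} (hp : p ∈ slowDomain n) :
    slowDomain n ∈ 𝓝 p := by
  refine eventually_all.2 fun j => ?_
  have hc : Continuous fun q : Slow n => q.1 j := by fun_prop
  exact hc.continuousAt.eventually_const_lt (hp j)

theorem contDiff_phase (θ : ℝ) (j : Fin n) : ContDiff ℝ 1 fun p : Slow n => phase θ p j := by
  unfold phase
  split_ifs <;> fun_prop

theorem contDiffAt_averaged_neg_one {b : Phase n} (hb : ∀ j, b (j, 1) = 0) {p : Slow n}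
    (hp : p ∈ slowDomain n) : ContDiffAt ℝ 1 (averaged (-1) b) p := by
  refine ContDiffAt.congr_of_eventuallyEq ?_ (by
    filter_upwards [slowDomain_mem_nhds hp] with q hq using averaged_neg_one_eq hb hq)
  have h₀ : ∀ j : Fin n, ContDiff ℝ 1 fun p : Slow n => satCoeff j (p.1 0) := fun j =>
    (contDiff_satCoeff j).comp (by fun_prop)
  refine ContDiffAt.prodMk (contDiffAt_pi.2 fun j => ContDiff.contDiffAt ?_)
    (contDiffAt_pi.2 fun j => ?_)
  · have h₁ := contDiff_phase (n := n) 0 j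
    have h₂ := h₀ j
    fun_prop
  · have h₁ : ContDiff ℝ 1 fun p : Slow n =>
        satCoeff (j : Fin n) (p.1 0) * (b (j, 0) * Real.sin (p.2 j)) := by
      have h₂ := h₀ j
      fun_prop
    have h₂ : ContDiff ℝ 1 fun p : Slow n => p.1 j := by fun_prop
    exact (h₁.contDiffAt.div h₂.contDiffAt (hp j).ne').neg

/-- A kernel vector `v` of the derivative is shown to vanish by differentiating along it. The
angular components give `v.2 = 0`; the first radial one gives `(I b (0, 0) - 2π) v.1 0 = 0`, whose
factor is nonzero by `mul_integral_satSlope_lt_satCoeff`; the other radial ones then reduce to the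
damping. -/
theorem isSimpleZero_dampedZero {ρ : ℝ} (hρ : 1 < ρ) (hc : ∀ j : Fin n, satCoeff j ρ ≠ 0) :
    IsSimpleZero (-1) (dampedInput n ρ) (dampedZero n ρ) := by
  set b := dampedInput n ρ
  set p := dampedZero n ρ with hpdef
  have hp : p ∈ slowDomain n := dampedZero_mem_slowDomain hρ
  have hC := contDiffAt_averaged_neg_one (dampedInput_one ρ) hp
  refine ⟨averaged_dampedZero hρ hc, hC, fun hdet => ?_⟩
  obtain ⟨v, hv, hv0⟩ := Submodule.exists_mem_ne_zero_of_ne_bot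
    (LinearMap.bot_lt_ker_of_det_eq_zero hdet).ne'
  have hv' : fderiv ℝ (averaged (-1) b) p v = 0 := hv
  have hline : HasDerivAt (fun t : ℝ => p + t • v) v 0 := by
    simpa using ((hasDerivAt_id (0 : ℝ)).smul_const v).const_add p
  have hd : HasDerivAt (fun t : ℝ => averaged (-1) b (p + t • v)) 0 0 := by
    have h := (hC.differentiableAt one_ne_zero).hasFDerivAt
    rw [← hv']
    refine HasFDerivAt.comp_hasDerivAt (l := averaged (-1) b) (0 : ℝ) ?_ hline
    rw [zero_smul, add_zero]
    exact h
  have hev : ∀ᶠ t : ℝ in 𝓝 0, p + t • v ∈ slowDomain n := by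
    refine hline.continuousAt.eventually_mem ?_
    rw [zero_smul, add_zero]
    exact slowDomain_mem_nhds hp
  have hp1 : p.1 0 = ρ := dampedZero_fst_zero ρ
  have hcoef : ∀ j : Fin n, HasDerivAt (fun t : ℝ => satCoeff j ((p + t • v).1 0))
      ((∫ t in (0 : ℝ)..(2 * Real.pi), satSlope ρ t * (Real.cos t * Real.cos (freq j * t))) *
        v.1 0) 0 := by
    intro j
    have h₁ : HasDerivAt (fun t : ℝ => (p + t • v).1 0) (v.1 0) 0 := by
      simpa using ((hasDerivAt_id (0 : ℝ)).mul_const (v.1 0)).const_add (p.1 0)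
    refine HasDerivAt.comp (h₂ := satCoeff j) (0 : ℝ) ?_ h₁
    have : (p + (0 : ℝ) • v).1 0 = ρ := by simp [hp1]
    rw [this]
    exact hasDerivAt_satCoeff j ρ
  -- All phases vanish at the zero, a critical point of the cosine, so angular increments do not
  -- enter the radial equations to first order.
  have hphase : ∀ j : Fin n, HasDerivAt (fun t : ℝ => Real.cos (phase 0 (p + t • v) j)) 0 0 := by
    intro j
    have h₁ : ∃ d, HasDerivAt (fun t : ℝ => phase 0 (p + t • v) j) d 0 := by
      have h := (((contDiff_phase 0 j).differentiable one_ne_zero) (p + (0 : ℝ) • v)).hasFDerivAt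
      exact ⟨_, HasFDerivAt.comp_hasDerivAt (l := fun p : Slow n => phase 0 p j) (0 : ℝ) h hline⟩
    obtain ⟨d, hd⟩ := h₁
    refine hd.cos.congr_deriv ?_
    rw [zero_smul, add_zero, phase_dampedZero, Real.sin_zero, neg_zero, zero_mul]
  have hradial : ∀ j : Fin n, -(2 * Real.pi) * v.1 j +
      (∫ t in (0 : ℝ)..(2 * Real.pi), satSlope ρ t * (Real.cos t * Real.cos (freq j * t))) *
        v.1 0 * b (j, 0) = 0 := by
    intro j
    have h₁ : HasDerivAt (fun t : ℝ => (averaged (-1) b (p + t • v)).1 j) 0 0 :=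
      hasDerivAt_pi.1 (hasFDerivAt_fst.comp_hasDerivAt (0 : ℝ) hd) j
    have h₂ : HasDerivAt (fun t : ℝ => -(2 * Real.pi) * (p + t • v).1 j) _ 0 :=
      (((hasDerivAt_id (0 : ℝ)).mul_const (v.1 j)).const_add (p.1 j)).const_mul _
    have h₃ := h₂.add ((hcoef j).mul ((hphase j).const_mul (b (j, 0))))
    have h₄ := h₁.unique (h₃.congr_of_eventuallyEq (by
      filter_upwards [hev] with t ht
      rw [averaged_neg_one_eq (dampedInput_one ρ) ht]
      rfl))
    rw [zero_smul, add_zero, phase_dampedZero, Real.cos_zero] at h₄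
    linarith
  have hangular : ∀ j : {j : Fin n // j ≠ 0}, v.2 j = 0 := by
    intro j
    have h₁ : HasDerivAt (fun t : ℝ => (averaged (-1) b (p + t • v)).2 j) 0 0 :=
      hasDerivAt_pi.1 (hasFDerivAt_snd.comp_hasDerivAt (0 : ℝ) hd) j
    have h₂ : HasDerivAt (fun t : ℝ => (p + t • v).2 j) (v.2 j) 0 := by
      simpa using ((hasDerivAt_id (0 : ℝ)).mul_const (v.2 j)).const_add (p.2 j)
    have h₅ : HasDerivAt (fun t : ℝ => (p + t • v).1 j) (v.1 j) 0 := by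
      simpa using ((hasDerivAt_id (0 : ℝ)).mul_const (v.1 j)).const_add (p.1 j)
    have hne : (p + (0 : ℝ) • v).1 j ≠ 0 := by
      rw [zero_smul, add_zero]; exact (hp j).ne'
    have h₃ := (((hcoef j).mul (h₂.sin.const_mul (b (j, 0)))).div h₅ hne).neg
    have h₄ := h₁.unique (h₃.congr_of_eventuallyEq (by
      filter_upwards [hev] with t ht
      rw [averaged_neg_one_eq (dampedInput_one ρ) ht]
      rfl))
    have hp2 : p.2 j = 0 := rfl
    simp only [Pi.mul_apply, zero_smul, add_zero, hp1, hp2, Real.sin_zero, Real.cos_zero, mul_zero, one_mul,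
      zero_add, zero_mul, sub_zero] at h₄
    have h₆ := satCoeff_mul_dampedInput (hc j)
    rw [← mul_assoc, show satCoeff (j : Fin n) ρ * b (j, 0) = _ from h₆, eq_comm, neg_eq_zero,
      div_eq_zero_iff] at h₄
    have h₇ : (2 * Real.pi * dampedAmplitude n ρ j) * p.1 j ≠ 0 :=
      mul_ne_zero (mul_pos Real.two_pi_pos (dampedAmplitude_pos hρ _)).ne' (hp j).ne'
    rcases h₄ with h₄ | h₄
    · exact (mul_eq_zero.1 ((mul_right_comm _ _ _).symm.trans h₄)).resolve_left h₇
    · exact absurd h₄ (pow_ne_zero 2 (hp j).ne')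
  have hzero : v.1 0 = 0 := by
    have h₁ := hradial 0
    have h₂ := mul_integral_satSlope_lt_satCoeff (n := n) hρ
    have h₃ : 0 < b (0, 0) := dampedInput_pos hρ
    have h₄ : satCoeff (0 : Fin n) ρ * b (0, 0) = _ := satCoeff_mul_dampedInput (hc 0)
    simp only [freq_zero, one_mul] at h₁
    rw [dampedAmplitude_zero] at h₄
    set I := ∫ t in (0 : ℝ)..(2 * Real.pi), satSlope ρ t * (Real.cos t * Real.cos t)
    have h₅ : ρ * (I * b (0, 0)) < ρ * (2 * Real.pi) := by
      have := mul_lt_mul_of_pos_right h₂ h₃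
      linarith
    have h₆ : I * b (0, 0) - 2 * Real.pi ≠ 0 :=
      (sub_neg.2 (lt_of_mul_lt_mul_left h₅ (by linarith))).ne
    refine (mul_eq_zero.1 ?_).resolve_left h₆
    linear_combination h₁
  refine hv0 (Prod.ext (funext fun j => ?_) (funext hangular))
  have h₁ := hradial j
  rw [hzero, mul_zero, zero_mul, add_zero] at h₁
  exact (mul_eq_zero.1 h₁).resolve_left (neg_ne_zero.2 Real.two_pi_pos.ne')

/-- The radius in the first plane is invariant under rotation, so it suffices that the slowly moving
curve in rotating coordinates stays in the annulus between `1` and `ρ + 1` for one period. -/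
theorem exists_bifurcatesFrom_dampedZero {ρ : ℝ} (hρ : 1 < ρ)
    (hc : ∀ j : Fin n, satCoeff j ρ ≠ 0) :
    ∃ Γ : ℝ → Set (Phase n), BifurcatesFrom (-1) (dampedInput n ρ) (𝓝[≠] 0) Γ
      (polar 0 (dampedZero n ρ)) (2 * Real.pi) := by
  obtain ⟨x, T, hper, hx, hT⟩ := (isNondegenerate_dampedZero hρ hc).exists_periodicSolutions
  refine ⟨fun ε => Set.range (x ε), polar_ne_zero (dampedZero_mem_slowDomain hρ),
    Real.two_pi_pos, x, T, ?_, hx, hT⟩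
  set b := dampedInput n ρ
  set w := polar 0 (dampedZero n ρ)
  have hw₁ : w (0, 1) = 0 := polar_zero_zero_one _
  have hw₀ : w (0, 0) = ρ := (polar_zero_zero_zero _).trans (dampedZero_fst_zero ρ)
  have hw : firstRadiusSq w = ρ ^ 2 := by rw [firstRadiusSq, hw₁, hw₀]; ring
  let U : Set (Phase n) := {v | 1 < firstRadiusSq v ∧ firstRadiusSq v < (ρ + 1) ^ 2}
  have hU : IsOpen U := (isOpen_lt continuous_const continuous_firstRadiusSq).inter
    (isOpen_lt continuous_firstRadiusSq continuous_const)
  have hwU : w ∈ U := ⟨by rw [hw]; nlinarith, by rw [hw]; nlinarith⟩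
  obtain ⟨δ, hδ, hball⟩ := Metric.nhds_basis_closedBall.mem_iff.1 (hU.mem_nhds hwU)
  have hid : Tendsto id (𝓝[≠] (0 : ℝ)) (𝓝 0) := tendsto_id.mono_left nhdsWithin_le_nhds
  have hclose := eventually_rotCurve_close (A := -1) (b := b) (κ := fun _ => 1) (s := fun _ => 0)
    hid (hper.mono fun ε h => h.2.1) tendsto_const_nhds hx (2 * Real.pi + 1) hδ
  have hsmall₁ : ∀ᶠ ε : ℝ in 𝓝[≠] 0, |ε * b (0, 0)| < 1 / 2 := by
    have : Tendsto (fun ε : ℝ => |ε * b (0, 0)|) (𝓝[≠] 0) (𝓝 0) := by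
      simpa using (hid.mul_const (b (0, 0))).abs
    exact this.eventually_lt_const (by norm_num)
  have hsmall₂ : ∀ᶠ ε : ℝ in 𝓝[≠] 0, |ε| * (ρ + 1) < 1 := by
    have : Tendsto (fun ε : ℝ => |ε| * (ρ + 1)) (𝓝[≠] 0) (𝓝 0) := by
      simpa using hid.abs.mul_const (ρ + 1)
    exact this.eventually_lt_const one_pos
  filter_upwards [hper, hclose, hsmall₁, hsmall₂, self_mem_nhdsWithin,
    hT.eventually_lt_const (lt_add_one (2 * Real.pi))] with ε hsol hcl h₁ h₂ hε hTε
  refine ⟨?_, hsol, rfl⟩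
  have hmem : ∀ t, x ε t ∈ U := by
    intro t
    have ht : x ε t ∈ x ε '' Set.Icc 0 (0 + T ε) := by
      rw [hsol.2.2.1.image_Icc hsol.1]; exact ⟨t, rfl⟩
    obtain ⟨s, hs, hst⟩ := ht
    have h₃ : rotCurve (x ε) 1 0 s ∈ U := hball (by
      rw [mem_closedBall_iff_norm]
      exact hcl s ⟨hs.1, by linarith [hs.2]⟩)
    have h₄ : firstRadiusSq (x ε s) = firstRadiusSq (rotCurve (x ε) 1 0 s) := by
      rw [← firstRadiusSq_rot s (rotCurve (x ε) 1 0 s), rot_rotCurve, one_mul, add_zero]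
    rw [← hst]
    exact ⟨h₄ ▸ h₃.1, h₄ ▸ h₃.2⟩
  exact isLimitCycle_of_firstRadiusSq hε (dampedInput_one ρ 0) (dampedInput_pos hρ) h₁.le
    (by linarith) h₂.le hsol (fun t => (hmem t).1) fun t => (hmem t).2

end

end SatControl

end

open SatControl in
theorem theorem1 (n : ℕ) [NeZero n] :
    (∀ (A : Mat n) (b : Phase n), b ≠ 0 →
      ((∃ p ∈ slowDomain n, IsIsolatedZero A b p) → AtMostOneBifurcates A b {x | x ≠ 0}) ∧
      ((∀ p ∈ slowDomain n, averaged A b p = 0 → IsIsolatedZero A b p) →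
        AtMostOneBifurcates A b {x | ∃ θ, ∃ p ∈ slowDomain n, x = polar θ p})) ∧
    (∃ (A : Mat n) (b : Phase n), b ≠ 0 ∧ ∃ p ∈ slowDomain n, IsSimpleZero A b p ∧
      (∃ Γ : ℝ → Set (Phase n),
        BifurcatesFrom A b (𝓝[≠] 0) Γ (polar 0 p) (2 * Real.pi)) ∧
      AtMostOneBifurcates A b {x | x ≠ 0}) := by
  refine ⟨fun A b _ => ⟨fun ⟨p, hp, h⟩ => atMostOneBifurcates_of_isIsolatedZero hp h,
    atMostOneBifurcates_of_forall_isIsolatedZero⟩, ?_⟩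
  obtain ⟨ρ, hρ, hc⟩ := exists_satCoeff_ne_zero n
  refine ⟨-1, dampedInput n ρ, fun h => ?_, dampedZero n ρ, dampedZero_mem_slowDomain hρ,
    isSimpleZero_dampedZero hρ hc, exists_bifurcatesFrom_dampedZero hρ hc,
    (isNondegenerate_dampedZero hρ hc).atMostOneBifurcates⟩
  exact (dampedInput_pos (n := n) hρ).ne' (congrFun h (0, 0))
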